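/- Let $N\ge 1$, let $\lambda_1,\dots,\lambda_N$ be distinct real numbers, $\Lambda=\mathrm{diag}(\lambda_1,\dots,\lambda_N)$, and for $(p,q)\in\mathbb R^{2N}$ let $Q_\lambda(u,v)=\sum_{j}\frac{u_jv_j}{\lambda-\lambda_j}$ and $$V_\lambda=\begin{pmatrix}-Q_\lambda(p,q)&Q_\lambda(p,p)\\-1-Q_\lambda(q,q)&Q_\lambda(p,q)\end{pmatrix}.$$ Put $\{f,g\}=\sum_j\big(\frac{\partial f}{\partial q_j}\frac{\partial g}{\partial p_j}-\frac{\partial f}{\partial p_j}\frac{\partial g}{\partial q_j}\big)$, $F=\langle p,q\rangle$, $G=\langle p,p\rangle-1$, $TS^{N-1}=\{F=G=0\}$, and $\{f,g\}_D=\{f,g\}+\frac1{\{F,G\}}(\{f,F\}\{G,g\}-\{f,G\}\{F,g\})$. Let $F_1=\langle\Lambda p,p\rangle+\langle q,q\rangle$, $F_2=\langle\Lambda^2p,p\rangle+\langle\Lambda p,p\rangle\langle q,q\rangle+\langle\Lambda q,q\rangle$, $F_k=\langle\Lambda^kp,p\rangle+\sum_{j=0}^{k-1}\big(\langle\Lambda^jp,p\rangle\langle\Lambda^{k-1-j}q,q\rangle-\langle\Lambda^{k-1-j}p,q\rangle\langle\Lambda^jp,q\rangle\big)$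 for $k\ge3$, and $H_0=0$, $H_k=-\frac12F_k+\frac12\sum_{j=0}^kH_jH_{k-j}$ for $k\ge1$. The forward Neumann flow with time $t_k$ is $\frac{dp}{dt_k}=\{p,H_k\}_D$, $\frac{dq}{dt_k}=\{q,H_k\}_D$ on $TS^{N-1}$. The flow with time $t^+_\lambda$ ($\lambda$ real) is the one with Hamiltonian $H^+_\lambda=1-\sqrt{\lambda\det V_\lambda}$. Let $\lambda_{N+1},\dots,\lambda_{2N-1}\in\mathbb C$ be such that $\lambda_1,\dots,\lambda_{2N-1}$ are pairwise distinct, and put $R(\lambda)=\prod_{k=1}^{2N-1}(\lambda-\lambda_k)$, $a(\lambda)=\prod_{k=1}^N(\lambda-\lambda_k)$. Consider a solution of one of these flows on an open interval that at one time lies on the level set $\det V_\lambda=R(\lambda)/a(\lambda)^2$. Let $\Gamma$ be the compact Riemann surface of $\xi^2+R(\lambda)=0$, of genus $N-1$, with the holomorphic differentials $\tilde\omega_j=\frac{\lambda^{N-1-j}d\lambda}{4\xi}$, $1\le j\le N-1$. Let $\{a_j,b_j\}$ be a canonical basis of homological cycles on $\Gamma$, $A_{ij}=\int_{a_j}\tilde\omega_i$,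 $C=A^{-1}$ with columns $C_1,\dots,C_{N-1}$, $\omega=C(\tilde\omega_1,\dots,\tilde\omega_{N-1})^T$, $\mathcal T\subset\mathbb C^{N-1}$ the lattice spanned by the vectors $\int_{a_j}\omega$, $\int_{b_j}\omega$, and $J(\Gamma)=\mathbb C^{N-1}/\mathcal T$. Let $\mu_1,\dots,\mu_{N-1}$ be the zeros of the polynomial $a(\lambda)Q_\lambda(p,p)$, let $P(\mu_k)=(\mu_k,\xi_k)\in\Gamma$ with $\xi_k$ the value at $\lambda=\mu_k$ of the polynomial $-a(\lambda)Q_\lambda(p,q)$, let $P_0$ be a fixed finite point of $\Gamma$, and let $\bar\phi=\sum_{k=1}^{N-1}\int_{P_0}^{P(\mu_k)}\omega\in J(\Gamma)$ be the Abel–Jacobi variable. Let $\bar\Lambda_k$ be the coefficients of the expansion $\frac1{\sqrt{R(\lambda)}}=\sum_{k\ge0}\bar\Lambda_k\lambda^{-k-N+\frac12}$, $\bar\Lambda_0=1$, for $|\lambda|>\max_j|\lambda_j|$. Then along the solution $\bar\phi$ is a well-defined curve on $J(\Gamma)$, and the forward Neumann flows are linearized by $\bar\phi$: $$\frac{d\bar\phi}{dt_{k+1}}=\Omega_k\quad(k\ge0),\qquad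 \frac{d\bar\phi}{dt^+_\lambda}=\sum_{k=0}^\infty\Omega_k\lambda^{-k-1}\quad(\lambda\in\mathbb R,\ |\lambda|>\max_{1\le j\le 2N-1}|\lambda_j|),$$ where $$\Omega_k=\tfrac12\sum_{i=1}^{\min(k+1,\,N-1)}\bar\Lambda_{k+1-i}\,C_i ,$$ that is, $\Omega_0=\frac12C_1$, $\Omega_1=\frac12(\bar\Lambda_1C_1+C_2)$, $\Omega_2=\frac12(\bar\Lambda_2C_1+\bar\Lambda_1C_2+C_3)$, and so on, where $C_i$ is omitted for $i>N-1$. Moreover, for these $\lambda$, $H^+_\lambda=\sum_{k\ge0}H_k\lambda^{-k}$ along the solutions of the $t^+_\lambda$-flow. -/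

import Mathlib

open Polynomial

noncomputable section

namespace NeumannKdV

/-! ### Phase space, Dirac-Poisson bracket, Neumann systems -/

/-- The phase space `ℝ^{2N}`; a point is a pair `(p, q)`. -/
abbrev Phase (N : ℕ) : Type := (Fin N → ℝ) × (Fin N → ℝ)

/-- The partial derivative `∂f/∂p_j`. -/
def partialP {N : ℕ} (f : Phase N → ℝ) (z : Phase N) (j : Fin N) : ℝ :=
  fderiv ℝ f z (Pi.single j 1, 0)

/-- The partial derivative `∂f/∂q_j`. -/
def partialQ {N : ℕ} (f : Phase N → ℝ) (z : Phase N) (j : Fin N) : ℝ :=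
  fderiv ℝ f z (0, Pi.single j 1)

/-- `{f, g} = ∑ (∂f/∂q_j ∂g/∂p_j - ∂f/∂p_j ∂g/∂q_j)`. -/
def poisson {N : ℕ} (f g : Phase N → ℝ) (z : Phase N) : ℝ :=
  ∑ j, (partialQ f z j * partialP g z j - partialP f z j * partialQ g z j)

/-- The constraint function `F = ⟨p, q⟩`. -/
def constraintF {N : ℕ} (z : Phase N) : ℝ := z.1 ⬝ᵥ z.2

/-- The constraint function `G = ⟨p, p⟩ - 1`. -/
def constraintG {N : ℕ} (z : Phase N) : ℝ := z.1 ⬝ᵥ z.1 - 1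

/-- The tangent bundle `T S^{N-1}` of the unit sphere. -/
def tangentSphere (N : ℕ) : Set (Phase N) := {z | constraintF z = 0 ∧ constraintG z = 0}

/-- The Dirac-Poisson bracket. -/
def dirac {N : ℕ} (f g : Phase N → ℝ) (z : Phase N) : ℝ :=
  poisson f g z + 1 / poisson constraintF constraintG z *
    (poisson f constraintF z * poisson constraintG g z
      - poisson f constraintG z * poisson constraintF g z)

/-- `z = (p, q)` solves `p' = {p, H}_D`, `q' = {q, H}_D` on `T S^{N-1}` for times in `I`. -/
def IsSolution {N : ℕ} (H : Phase N → ℝ) (I : Set ℝ) (z : ℝ → Phase N) : Prop :=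
  ∀ t ∈ I, z t ∈ tangentSphere N ∧ ∀ j,
    HasDerivAt (fun s => (z s).1 j) (dirac (fun y => y.1 j) H (z t)) t ∧
    HasDerivAt (fun s => (z s).2 j) (dirac (fun y => y.2 j) H (z t)) t

/-- `⟨Λ^k u, v⟩` for `Λ = diag(λ_1, …, λ_N)`. -/
def moment {N : ℕ} (lam : Fin N → ℝ) (k : ℕ) (u v : Fin N → ℝ) : ℝ :=
  ∑ j, lam j ^ k * u j * v j

/-- The integrals of motion `F_1, F_2, F_3, …` (and the leading coefficient `F_0 = 1`). -/
def forwardIntegral {N : ℕ} (lam : Fin N → ℝ) : ℕ → Phase N → ℝ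
  | 0, _ => 1
  | 1, z => moment lam 1 z.1 z.1 + moment lam 0 z.2 z.2
  | 2, z => moment lam 2 z.1 z.1 + moment lam 1 z.1 z.1 * moment lam 0 z.2 z.2
      + moment lam 1 z.2 z.2
  | (k + 3), z => moment lam (k + 3) z.1 z.1 + ∑ j ∈ Finset.range (k + 3),
      (moment lam j z.1 z.1 * moment lam (k + 2 - j) z.2 z.2
        - moment lam (k + 2 - j) z.1 z.2 * moment lam j z.1 z.2)

/-- The Hamiltonians `H_0 = 0`, `H_k = -½ F_k + ½ ∑_{j=0}^k H_j H_{k-j}` for `k ≥ 1`; since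
`H_0 = 0`, only the products with both indices at least one are written. -/
def hamiltonian {N : ℕ} (lam : Fin N → ℝ) : ℕ → Phase N → ℝ
  | 0, _ => 0
  | (k + 1), z => -(1 / 2) * forwardIntegral lam (k + 1) z
      + 1 / 2 * ∑ j : Fin k, hamiltonian lam (j + 1) z * hamiltonian lam (k - j) z
  termination_by k => k
  decreasing_by all_goals omega

theorem hamiltonian_zero {N : ℕ} (lam : Fin N → ℝ) (z : Phase N) :
    hamiltonian lam 0 z = 0 := by
  rw [hamiltonian]

/-- The recursion in its usual form. -/
theorem hamiltonian_succ {N : ℕ} (lam : Fin N → ℝ) (k : ℕ) (z : Phase N) :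
    hamiltonian lam (k + 1) z = -(1 / 2) * forwardIntegral lam (k + 1) z
      + 1 / 2 * ∑ j ∈ Finset.range (k + 2), hamiltonian lam j z * hamiltonian lam (k + 1 - j) z := by
  rw [Finset.sum_range_succ, Finset.sum_range_succ']
  simp only [hamiltonian_zero, Nat.sub_self, mul_zero, zero_mul, add_zero, Nat.add_sub_add_right]
  rw [Finset.sum_range fun j => hamiltonian lam (j + 1) z * hamiltonian lam (k - j) z]
  conv_lhs => rw [hamiltonian]

theorem hamiltonian_one {N : ℕ} (lam : Fin N → ℝ) (z : Phase N) :
    hamiltonian lam 1 z = -(1 / 2) * (moment lam 1 z.1 z.1 + moment lam 0 z.2 z.2) := by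
  rw [hamiltonian]; simp [forwardIntegral]

theorem hamiltonian_two {N : ℕ} (lam : Fin N → ℝ) (z : Phase N) :
    hamiltonian lam 2 z = -(1 / 2) * (moment lam 2 z.1 z.1 + moment lam 1 z.2 z.2)
      - 1 / 4 * moment lam 1 z.1 z.1 * moment lam 0 z.2 z.2
      + 1 / 8 * (moment lam 1 z.1 z.1 ^ 2 + moment lam 0 z.2 z.2 ^ 2) := by
  rw [hamiltonian]
  simp only [Fin.sum_univ_one, Fin.val_zero, zero_add, Nat.sub_zero, hamiltonian_one,
    forwardIntegral]
  ring

/-! ### Lax matrix and elliptic variables -/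

/-- `Q_x(u, v) = ∑ u_j v_j / (x - λ_j)`. -/
def resolventForm {N : ℕ} (lam : Fin N → ℝ) (x : ℝ) (u v : Fin N → ℝ) : ℝ :=
  ∑ j, u j * v j / (x - lam j)

/-- The Lax matrix `V_x` at the point `z = (p, q)`. -/
def laxMatrix {N : ℕ} (lam : Fin N → ℝ) (x : ℝ) (z : Phase N) : Matrix (Fin 2) (Fin 2) ℝ :=
  !![-resolventForm lam x z.1 z.2, resolventForm lam x z.1 z.1;
     -(1 + resolventForm lam x z.2 z.2), resolventForm lam x z.1 z.2]

/-- The generating Hamiltonian `H⁺_x`, determined by `det V_x = x⁻¹ (1 - H⁺_x)²`, with the branch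
of the square root for which `H⁺_x → 0` as `x → ∞`. -/
def generatingHamiltonian {N : ℕ} (lam : Fin N → ℝ) (x : ℝ) (z : Phase N) : ℝ :=
  1 - Real.sqrt (x * (laxMatrix lam x z).det)

/-- The polynomial `∑_j w_j ∏_{l ≠ j} (X - λ_l)`. -/
def numerator {N : ℕ} (lam w : Fin N → ℝ) : ℝ[X] :=
  ∑ j, C (w j) * ∏ l ∈ Finset.univ.erase j, (X - C (lam l))

theorem eval_numerator {N : ℕ} (lam w : Fin N → ℝ) (x : ℝ) (hx : ∀ j, x ≠ lam j) :
    (numerator lam w).eval x = (∏ l, (x - lam l)) * ∑ j, w j / (x - lam j) := by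
  simp only [numerator, eval_finsetSum, eval_mul, eval_C, eval_prod, eval_sub, eval_X,
    Finset.mul_sum]
  refine Finset.sum_congr rfl fun j _ => ?_
  rw [← Finset.mul_prod_erase Finset.univ (fun l => x - lam l) (Finset.mem_univ j)]
  have : x - lam j ≠ 0 := sub_ne_zero.2 (hx j)
  field_simp

/-- `m = a V¹²`, where `a = ∏ (X - λ_j)`. -/
def mPoly {N : ℕ} (lam : Fin N → ℝ) (z : Phase N) : ℝ[X] :=
  numerator lam fun j => z.1 j * z.1 j

/-- `a V¹¹`, where `a = ∏ (X - λ_j)`. -/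
def nPoly {N : ℕ} (lam : Fin N → ℝ) (z : Phase N) : ℝ[X] :=
  numerator lam fun j => -(z.1 j * z.2 j)

theorem eval_mPoly {N : ℕ} (lam : Fin N → ℝ) (z : Phase N) (x : ℝ) (hx : ∀ j, x ≠ lam j) :
    (mPoly lam z).eval x = (∏ l, (x - lam l)) * laxMatrix lam x z 0 1 := by
  rw [mPoly, eval_numerator lam _ x hx]; simp [laxMatrix, resolventForm]

theorem eval_nPoly {N : ℕ} (lam : Fin N → ℝ) (z : Phase N) (x : ℝ) (hx : ∀ j, x ≠ lam j) :
    (nPoly lam z).eval x = (∏ l, (x - lam l)) * laxMatrix lam x z 0 0 := by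
  rw [nPoly, eval_numerator lam _ x hx]; simp [laxMatrix, resolventForm, neg_div]

/-- The elliptic variables: the roots `μ_1, …, μ_{N-1}` of `m`, in any order. -/
def IsEllipticVariables {g : ℕ} (lam : Fin (g + 1) → ℝ) (z : Phase (g + 1)) (μ : Fin g → ℂ) :
    Prop :=
  (mPoly lam z).map (algebraMap ℝ ℂ) = ∏ k, (X - C (μ k))

/-- The level set `det V = b / a`, where `a = ∏ (X - λ_j)` and `b = ∏ (X - ν_k)`; the `ν_k` are
the remaining branch points `λ_{N+1}, …, λ_{2N-1}`. -/
def OnLevelSet {g : ℕ} (lam : Fin (g + 1) → ℝ) (ν : Fin g → ℂ) (z : Phase (g + 1)) : Prop :=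
  ∀ x : ℝ, (∀ j, x ≠ lam j) →
    (((laxMatrix lam x z).det : ℝ) : ℂ) = (∏ k, ((x : ℂ) - ν k)) / ∏ j, ((x : ℂ) - lam j)

/-- The `2N - 1` finite branch points. -/
def branchPoint {g : ℕ} (lam : Fin (g + 1) → ℝ) (ν : Fin g → ℂ) : Fin (g + 1) ⊕ Fin g → ℂ :=
  Sum.elim (fun j => (lam j : ℂ)) ν

/-! ### The hyperelliptic curve

Throughout, `e` is the family of the `2g + 1` finite branch points. The compact Riemann surface has
one further point `∞`. Removing it changes neither the first homology group nor (up to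
periods) the integrals of holomorphic differentials, so all cycles and paths below are taken
in the finite part of the surface. -/

/-- `R = ∏ (X - e_i)`. -/
def curvePoly {g : ℕ} (e : Fin (g + 1) ⊕ Fin g → ℂ) : ℂ[X] := ∏ i, (X - C (e i))

/-- The finite part `{(λ, ξ) | ξ² + R(λ) = 0}` of the Riemann surface. -/
def curve {g : ℕ} (e : Fin (g + 1) ⊕ Fin g → ℂ) : Set (ℂ × ℂ) :=
  {P | P.2 ^ 2 + (curvePoly e).eval P.1 = 0}

/-- The holomorphic differential `λ^{g-j} dλ / (4 ξ)`, `1 ≤ j ≤ g` (the index `j` of the code is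
one less). At the branch points, where `ξ = 0`, it is written in the local coordinate `ξ`, by
means of the relation `2 ξ dξ = -R'(λ) dλ` on the curve. -/
def holoForm {g : ℕ} (e : Fin (g + 1) ⊕ Fin g → ℂ) (j : Fin g) (P : ℂ × ℂ) : ℂ × ℂ →L[ℂ] ℂ :=
  if P.2 ≠ 0 then
    (P.1 ^ (g - 1 - (j : ℕ)) / (4 * P.2)) • ContinuousLinearMap.fst ℂ ℂ ℂ
  else
    (-(P.1 ^ (g - 1 - (j : ℕ)) / (2 * (curvePoly e).derivative.eval P.1))) •
      ContinuousLinearMap.snd ℂ ℂ ℂ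

/-- A path on the curve, seen in `ℂ²`. -/
def ambient {g : ℕ} {e : Fin (g + 1) ⊕ Fin g → ℂ} {P Q : curve e} (γ : Path P Q) :
    Path (P : ℂ × ℂ) (Q : ℂ × ℂ) :=
  γ.map continuous_subtype_val

/-- A path on the curve is continuously differentiable. -/
def IsC1 {g : ℕ} {e : Fin (g + 1) ⊕ Fin g → ℂ} {P Q : curve e} (γ : Path P Q) : Prop :=
  ContDiffOn ℝ 1 (ambient γ).extend (Set.Icc 0 1)

/-- The velocity vector of a path on the curve. -/
def velocity {g : ℕ} {e : Fin (g + 1) ⊕ Fin g → ℂ} {P Q : curve e} (γ : Path P Q) (s : ℝ) :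
    ℂ × ℂ :=
  derivWithin (ambient γ).extend (Set.Icc 0 1) s

/-- For vectors `v, w` of the same complex tangent line, the area of the parallelogram spanned
by `v` and `w`, positive if `(v, w)` is positively oriented. -/
def orientedArea (v w : ℂ × ℂ) : ℝ :=
  (starRingEnd ℂ v.1 * w.1 + starRingEnd ℂ v.2 * w.2).im

/-- Two closed curves meet only transversally, and not at their base points. -/
def InGeneralPosition {g : ℕ} {e : Fin (g + 1) ⊕ Fin g → ℂ} {P Q : curve e}
    (γ : Path P P) (δ : Path Q Q) : Prop :=
  ∀ s t : unitInterval, γ s = δ t →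
    (s : ℝ) ∈ Set.Ioo 0 1 ∧ (t : ℝ) ∈ Set.Ioo 0 1 ∧
      orientedArea (velocity γ s) (velocity δ t) ≠ 0

/-- The algebraic intersection number of two closed curves in general position. -/
def intersectionNumber {g : ℕ} {e : Fin (g + 1) ⊕ Fin g → ℂ} {P Q : curve e}
    (γ : Path P P) (δ : Path Q Q) : ℤ :=
  ∑ᶠ x ∈ {x : unitInterval × unitInterval | γ x.1 = δ x.2},
    (SignType.sign (orientedArea (velocity γ x.1) (velocity δ x.2)) : ℤ)

/-- The canonical intersection matrix: `a_i ∘ b_j = δ_ij`, `a_i ∘ a_j = b_i ∘ b_j = 0`. -/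
def canonicalIntersection {g : ℕ} : Fin g ⊕ Fin g → Fin g ⊕ Fin g → ℤ
  | Sum.inl i, Sum.inr j => if i = j then 1 else 0
  | Sum.inr i, Sum.inl j => if i = j then -1 else 0
  | _, _ => 0

/-- The first homology group, as the abelianized fundamental group. -/
abbrev Homology {g : ℕ} (e : Fin (g + 1) ⊕ Fin g → ℂ) (P₀ : curve e) : Type :=
  Additive (Abelianization (FundamentalGroup (curve e) P₀))

/-- The homology class of a loop. -/
def homologyClass {g : ℕ} {e : Fin (g + 1) ⊕ Fin g → ℂ} {P₀ : curve e} (γ : Path P₀ P₀) :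
    Homology e P₀ :=
  Additive.ofMul (Abelianization.of (FundamentalGroup.fromPath (Path.Homotopic.Quotient.mk γ)))

/-- A canonical basis of homological cycles `a_1, …, a_g, b_1, …, b_g` (the left summand indexes
the `a_j`, the right one the `b_j`). The paths `link` join `P₀` to the base points of the
cycles; the homology class of a cycle does not depend on them. -/
structure CanonicalBasis {g : ℕ} (e : Fin (g + 1) ⊕ Fin g → ℂ) (P₀ : curve e) where
  base : Fin g ⊕ Fin g → curve e
  cycle : ∀ i, Path (base i) (base i)
  link : ∀ i, Path P₀ (base i)
  isC1 : ∀ i, IsC1 (cycle i)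
  general : ∀ i j, i ≠ j → InGeneralPosition (cycle i) (cycle j)
  intersection : ∀ i j, i ≠ j →
    intersectionNumber (cycle i) (cycle j) = canonicalIntersection i j
  independent : LinearIndependent ℤ
    fun i => homologyClass (((link i).trans (cycle i)).trans (link i).symm)
  spanning : Submodule.span ℤ
    (Set.range fun i => homologyClass (((link i).trans (cycle i)).trans (link i).symm)) = ⊤

/-! ### Jacobi variety and Abel-Jacobi variable -/

/-- `A_ij = ∫_{a_j} ω̃_i`. -/
def aPeriodMatrix {g : ℕ} {e : Fin (g + 1) ⊕ Fin g → ℂ} {P₀ : curve e}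
    (B : CanonicalBasis e P₀) : Matrix (Fin g) (Fin g) ℂ :=
  Matrix.of fun i j => curveIntegral (holoForm e i) (ambient (B.cycle (Sum.inl j)))

/-- `C = A⁻¹` (`A` is invertible for every canonical basis). -/
def normMatrix {g : ℕ} {e : Fin (g + 1) ⊕ Fin g → ℂ} {P₀ : curve e}
    (B : CanonicalBasis e P₀) : Matrix (Fin g) (Fin g) ℂ :=
  (aPeriodMatrix B)⁻¹

/-- The normalized holomorphic differential `ω_j = ∑_l C_jl ω̃_l`. -/
def normalizedForm {g : ℕ} {e : Fin (g + 1) ⊕ Fin g → ℂ} {P₀ : curve e}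
    (B : CanonicalBasis e P₀) (j : Fin g) (P : ℂ × ℂ) : ℂ × ℂ →L[ℂ] ℂ :=
  ∑ l, normMatrix B j l • holoForm e l P

/-- The vector `∫_γ ω`. -/
def abelIntegral {g : ℕ} {e : Fin (g + 1) ⊕ Fin g → ℂ} {P₀ : curve e}
    (B : CanonicalBasis e P₀) {P Q : curve e} (γ : Path P Q) : Fin g → ℂ :=
  fun j => curveIntegral (normalizedForm B j) (ambient γ)

/-- The lattice spanned by the period vectors `∫_{a_j} ω` and `∫_{b_j} ω`. -/
def periodLattice {g : ℕ} {e : Fin (g + 1) ⊕ Fin g → ℂ} {P₀ : curve e}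
    (B : CanonicalBasis e P₀) : AddSubgroup (Fin g → ℂ) :=
  AddSubgroup.closure (Set.range fun i => abelIntegral B (B.cycle i))

/-- The Jacobi variety. -/
abbrev Jacobian {g : ℕ} {e : Fin (g + 1) ⊕ Fin g → ℂ} {P₀ : curve e}
    (B : CanonicalBasis e P₀) : Type :=
  (Fin g → ℂ) ⧸ periodLattice B

/-- `φ` is the value of the Abel-Jacobi variable at `z = (p, q)`: the class of
`∑_k ∫_{P₀}^{P(μ_k)} ω`, where `P(μ_k) = (μ_k, ξ_k)` and `ξ_k = a(μ_k) V¹¹(μ_k)` is the value of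
`√(-R(μ_k))` singled out by the Lax matrix. -/
def IsAbelJacobi {g : ℕ} (lam : Fin (g + 1) → ℝ) {e : Fin (g + 1) ⊕ Fin g → ℂ} {P₀ : curve e}
    (B : CanonicalBasis e P₀) (z : Phase (g + 1)) (φ : Jacobian B) : Prop :=
  ∃ (μ : Fin g → ℂ) (P : Fin g → curve e) (γ : ∀ k, Path P₀ (P k)),
    IsEllipticVariables lam z μ ∧
    (∀ k, (P k : ℂ × ℂ) = (μ k, aeval (μ k) (nPoly lam z))) ∧
    (∀ k, IsC1 (γ k)) ∧
    φ = QuotientAddGroup.mk (∑ k, abelIntegral B (γ k))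

/-- A curve `φ` on the Jacobi variety has derivative `v` at `t`: near `t` it has a lift to `ℂ^g`
with derivative `v` at `t`. -/
def HasJacobianDerivAt {g : ℕ} {e : Fin (g + 1) ⊕ Fin g → ℂ} {P₀ : curve e}
    {B : CanonicalBasis e P₀} (φ : ℝ → Jacobian B) (v : Fin g → ℂ) (t : ℝ) : Prop :=
  ∃ Φ : ℝ → Fin g → ℂ, (∀ᶠ s in nhds t, QuotientAddGroup.mk (Φ s) = φ s) ∧ HasDerivAt Φ v t

/-- Along `z`, the Abel-Jacobi variable is a well-defined curve on the Jacobi variety, and it has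
the constant derivative `v`. -/
def IsLinearized {g : ℕ} (lam : Fin (g + 1) → ℝ) {e : Fin (g + 1) ⊕ Fin g → ℂ} {P₀ : curve e}
    (B : CanonicalBasis e P₀) (I : Set ℝ) (z : ℝ → Phase (g + 1)) (v : Fin g → ℂ) : Prop :=
  ∃ φ : ℝ → Jacobian B,
    (∀ t ∈ I, ∀ x, IsAbelJacobi lam B (z t) x ↔ x = φ t) ∧
    ∀ t ∈ I, HasJacobianDerivAt φ v t

/-! ### The frequency vectors -/

/-- The power series `∏_i (1 - e_i w)^{-1/2}`, which is the expansion of `w^{-(g + 1/2)} / √R(1/w)`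
at `w = 0`. -/
def invSqrtSeries {g : ℕ} (e : Fin (g + 1) ⊕ Fin g → ℂ) : PowerSeries ℂ :=
  ∏ i, PowerSeries.rescale (-e i) (PowerSeries.binomialSeries ℂ (-(1 / 2) : ℂ))

/-- The series has constant term one, and its square is the inverse of `∏_i (1 - e_i w)`. -/
theorem invSqrtSeries_spec {g : ℕ} (e : Fin (g + 1) ⊕ Fin g → ℂ) :
    PowerSeries.constantCoeff (invSqrtSeries e) = 1 ∧
    invSqrtSeries e ^ 2 * ∏ i, (1 - PowerSeries.C (e i) * PowerSeries.X) = 1 := by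
  constructor
  · simp only [invSqrtSeries, map_prod]
    refine Finset.prod_eq_one fun i _ => ?_
    simp [← PowerSeries.coeff_zero_eq_constantCoeff_apply, PowerSeries.coeff_rescale]
  · rw [invSqrtSeries, ← Finset.prod_pow, ← Finset.prod_mul_distrib]
    refine Finset.prod_eq_one fun i _ => ?_
    have h1 : PowerSeries.binomialSeries ℂ (-(1 / 2) : ℂ) ^ 2 * (1 + PowerSeries.X) = 1 := by
      have h2 : (1 + PowerSeries.X : PowerSeries ℂ) = PowerSeries.binomialSeries ℂ (1 : ℂ) := by
        have := PowerSeries.binomialSeries_nat (R := ℂ) (A := ℂ) 1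
        simpa using this.symm
      rw [h2, sq, ← PowerSeries.binomialSeries_add, ← PowerSeries.binomialSeries_add]
      have : (-(1 / 2) + -(1 / 2) + 1 : ℂ) = 0 := by norm_num
      rw [this, PowerSeries.binomialSeries_zero]
    have h3 := congrArg (PowerSeries.rescale (-e i)) h1
    rw [map_mul, map_pow, map_one, map_add, map_one, PowerSeries.rescale_X] at h3
    rw [map_neg, neg_mul, ← sub_eq_add_neg] at h3
    exact h3

/-- The expansion coefficients `Λ̄_k` of `1 / √R(λ) = ∑_k Λ̄_k λ^{-k-N+1/2}` at infinity. -/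
def lambdaBar {g : ℕ} (e : Fin (g + 1) ⊕ Fin g → ℂ) (k : ℕ) : ℂ :=
  PowerSeries.coeff k (invSqrtSeries e)

/-- `Ω_k = ½ (Λ̄_k C_1 + Λ̄_{k-1} C_2 + ⋯)`, where `C_1, …, C_g` are the columns of `C`, and
coefficients with a negative index are zero. -/
def frequency {g : ℕ} {e : Fin (g + 1) ⊕ Fin g → ℂ} {P₀ : curve e}
    (B : CanonicalBasis e P₀) (k : ℕ) : Fin g → ℂ :=
  (1 / 2 : ℂ) • ∑ i : Fin g,
    (if (i : ℕ) ≤ k then lambdaBar e (k - i) else 0) • fun j => normMatrix B j i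

end NeumannKdV

end

/-! With `w = 1/λ` and `s_j = 1/(1 - λ_j w)`, the function `λ det V_λ` becomes a polynomial `genFun`
in `w`, `s`, `p`, `q`, and every flow in question has a Hamiltonian built from `1 - u` with `u² =
genFun` on the tangent sphere. For the generating flow, `u` is a real square root. For the forward
flows, `u = 1 - ∑ H_k w^k` is a formal series: the recursion for `H_k` says that `u² = ∑ F_k w^k`,
which is `genFun` up to multiples of the constraints, and the Dirac bracket ignores these
(`formal_flow`). Both cases are instances of `GenFlow`: identities over a commutative algebra `A`
(`ℝ` or `ℝ⟦w⟧`), followed by a linear functional `L` (the identity or the extraction of one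
coefficient).

Write `m`, `n`, `-l` for the entries 12, 11, 21 of `a V`. The Dirac field of `genFun` preserves `m l
- n² = a² det V` (`isospectral`). At a root `μ_k` of `m` it yields a number `κ_k` with `m'(μ_k) dμ_k
= 4 κ_k n(μ_k)`, so that `λ^d dλ/(4ξ)` takes the value `μ_k^d κ_k / m'(μ_k)` on the velocity of
`P(μ_k)` (`holoForm_rootMotion`). Since `κ_k` carries the denominator `1 - μ_k w`, the sum over `k`
is a Lagrange interpolation. In `A` it says `2 u ∏(1 - λ_j w) ∑_k μ_k^{g-1-i} κ_k / m'(μ_k) =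
w^{i+1}`, with `i` counted from zero (`GenFlow.sum_kappa`). On the level set, `u ∏(1 - λ_j w)` is a
square root of `∏(1 - e_i w)`, so the sum is `½ w^{i+1} ∑ Λ̄_k w^k`. The sign of the root is fixed
by the constant term (`formal_sqrt_mul`) or by continuity from `w = 0` (`sqrt_mul_eq_one`). The
coefficient of `w^{k+1}` gives `Ω_k`, and the value at `w = 1/λ` gives the series of the `Ω_k`.

The geometric half makes the Abel-Jacobi variable a differentiable curve. The roots of `m` are real
and simple (`exists_roots`), so they move differentiably. The differentials have local primitives on
the curve. Continuing these along paths, through the covering space of germs, gives increments that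
are homotopy invariant and equal to the curve integrals on `C¹` paths. Increments along loops lie in
the period lattice because the cycles span the homology. Hence the Abel map is well defined, the
local primitives lift it to `ℂ^g`, and derivatives can be computed in the lift
(`isLinearized_of_hasDerivAt`). -/

open Topology Filter

noncomputable section

namespace NeumannKdV

/-! ### Continuation of local primitives along paths, and their periods. -/

section Cocycle

/-- A family of functions `F P` on a space `X`, which agree locally up to additive constants. -/
structure LocalPrimitives (X A : Type) [TopologicalSpace X] [AddCommGroup A] where
  toFun : X → X → A
  compat : ∀ P, ∀ᶠ Q in 𝓝 P, ∀ᶠ S in 𝓝 Q, toFun Q S - toFun Q Q = toFun P S - toFun P Q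

variable {X A : Type} [TopologicalSpace X] [AddCommGroup A] (F : LocalPrimitives X A)

/-- `g` is a primitive along the map `γ`. -/
def LocalPrimitives.IsAlong {Y : Type} [TopologicalSpace Y] (γ : Y → X) (g : Y → A) : Prop :=
  ∀ y, ∀ᶠ y' in 𝓝 y, g y' - g y = F.toFun (γ y) (γ y') - F.toFun (γ y) (γ y)

theorem LocalPrimitives.IsAlong.comp {F : LocalPrimitives X A} {Y Z : Type} [TopologicalSpace Y]
    [TopologicalSpace Z] {γ : Y → X} {g : Y → A} (h : F.IsAlong γ g) {σ : Z → Y}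
    (hσ : Continuous σ) : F.IsAlong (γ ∘ σ) (g ∘ σ) :=
  fun z => (hσ.tendsto z).eventually (h (σ z))

/-- Two primitives along the same map differ by a locally constant function. -/
theorem LocalPrimitives.IsAlong.sub_const {F : LocalPrimitives X A} {Y : Type} [TopologicalSpace Y]
    [PreconnectedSpace Y] {γ : Y → X} {g h : Y → A} (hg : F.IsAlong γ g) (hh : F.IsAlong γ h)
    (y z : Y) : g y - g z = h y - h z := by
  have hc : IsLocallyConstant fun y => g y - h y := by
    rw [IsLocallyConstant.iff_eventually_eq]
    intro y
    filter_upwards [hg y, hh y] with y' h1 h2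
    have := h1.trans h2.symm
    rw [sub_eq_sub_iff_sub_eq_sub] at this
    exact this
  have := hc.apply_eq_of_isPreconnected isPreconnected_univ (Set.mem_univ y) (Set.mem_univ z)
  rwa [sub_eq_sub_iff_sub_eq_sub] at this

/-- The points near `P` at which all local primitives agree with the one of `P`. -/
def LocalPrimitives.domain (P : X) : Set X :=
  interior {Q | ∀ᶠ S in 𝓝 Q, F.toFun Q S - F.toFun Q Q = F.toFun P S - F.toFun P Q}

/-- Subtract the two germ identities at `Q`. This local constancy makes the transition functions
below continuous for the discrete fibre. -/
theorem LocalPrimitives.eventually_transition {P P' Q : X} (h : Q ∈ F.domain P)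
    (h' : Q ∈ F.domain P') :
    ∀ᶠ S in 𝓝 Q, F.toFun P S - F.toFun P' S = F.toFun P Q - F.toFun P' Q := by
  have h1 := interior_subset h
  have h2 := interior_subset h'
  filter_upwards [h1, h2] with S h3 h4
  have := h3.symm.trans h4
  rwa [sub_eq_sub_iff_sub_eq_sub] at this

/-- The covering space of germs of primitives. -/
def LocalPrimitives.bundle :
    letI : TopologicalSpace A := ⊥
    FiberBundleCore X X A :=
  letI : TopologicalSpace A := ⊥
  haveI : DiscreteTopology A := ⟨rfl⟩
  { baseSet := F.domain
    isOpen_baseSet := fun _ => isOpen_interior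
    indexAt := id
    mem_baseSet_at := fun P => mem_interior_iff_mem_nhds.2 (F.compat P)
    -- A germ `F_P + v` at `x` is rewritten as `F_{P'} + v'`. The cocycle law is a telescoping sum
    -- valid at every `x`; the base sets matter only for continuity.
    coordChange := fun P P' x v => v + (F.toFun P x - F.toFun P' x)
    coordChange_self := fun P x _ v => by simp
    continuousOn_coordChange := fun P P' => by
      rintro ⟨x, v⟩ ⟨⟨hx, hx'⟩, -⟩
      refine ContinuousAt.continuousWithinAt ?_
      refine (continuousAt_const (y := v + (F.toFun P x - F.toFun P' x))).congr ?_
      rw [nhds_prod_eq]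
      have h1 := F.eventually_transition hx hx'
      have h2 : ∀ᶠ u in 𝓝 v, u = v := by simp
      filter_upwards [h1.prod_mk h2] with y hy
      rw [hy.1, hy.2]
    coordChange_comp := fun P P' P'' x _ v => by
      abel }

/-- The germ `(x, v)` stands for the primitive `F_x + v` and has the value `v + F_x(x)` at its own
point. The fibre is discrete, so the projection is a covering. Along a continuous lift the fibre
coordinate in a fixed trivialization is locally constant, which says exactly that the values change
by a local primitive. -/
theorem LocalPrimitives.exists_lift_value (P : X) :
    ∃ (E : Type) (_ : TopologicalSpace E) (p : E → X) (val : E → A), IsCoveringMap p ∧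
      (∃ e, p e = P) ∧
      ∀ {Y : Type} [TopologicalSpace Y] (L : Y → E), Continuous L →
        F.IsAlong (p ∘ L) (val ∘ L) := by
  let _ : TopologicalSpace A := ⊥
  have : DiscreteTopology A := ⟨rfl⟩
  let Z := F.bundle
  refine ⟨Z.TotalSpace, inferInstance, Bundle.TotalSpace.proj,
    fun e => (show A from e.2) + F.toFun e.1 e.1,
    FiberBundle.isCoveringMap (F := A) (E := Z.Fiber), ⟨⟨P, (0 : A)⟩, rfl⟩, ?_⟩
  intro Y _ L hL y
  have hcont : ContinuousAt (fun y' => (Z.localTriv (L y).1 (L y')).2) y := by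
    refine ContinuousAt.comp (f := L) (g := fun e => (Z.localTriv (L y).1 e).2) ?_ hL.continuousAt
    refine continuous_snd.continuousAt.comp ?_
    refine (Z.localTriv (L y).1).continuousAt ?_
    rw [(Z.localTriv (L y).1).mem_source]
    exact Z.mem_baseSet_at (L y).1
  have hev : ∀ᶠ y' in 𝓝 y, (Z.localTriv (L y).1 (L y')).2 = (Z.localTriv (L y).1 (L y)).2 := by
    have := hcont.tendsto
    rw [nhds_discrete A] at this
    filter_upwards [this (mem_pure.2 rfl)] with y' hy'
    exact Eq.symm hy'
  filter_upwards [hev] with y' hy'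
  simp only [FiberBundleCore.localTriv_apply] at hy'
  change (show A from (L y').2) + (F.toFun (L y').1 (L y').1 - F.toFun (L y).1 (L y').1)
    = (show A from (L y).2) + (F.toFun (L y).1 (L y).1 - F.toFun (L y).1 (L y).1) at hy'
  simp only [Function.comp]
  have h3 : (show A from (L y').2) + F.toFun (L y').1 (L y').1
      = (show A from (L y).2) + F.toFun (L y).1 (L y').1 := by
    rw [sub_self, add_zero] at hy'
    rw [← hy']
    abel
  rw [h3]
  abel

/-- Lift `γ` to the covering of germs and read off the values. -/
theorem LocalPrimitives.exists_isAlong {P Q : X} (γ : Path P Q) : ∃ g, F.IsAlong γ g := by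
  obtain ⟨E, _, p, val, hp, ⟨e, he⟩, h⟩ := F.exists_lift_value P
  have h0 : (γ : C(unitInterval, X)) 0 = p e := by simp [he]
  refine ⟨val ∘ hp.liftPath γ e h0, ?_⟩
  have := h _ (hp.liftPath γ e h0).continuous
  rwa [hp.liftPath_lifts] at this

/-- The increment of a primitive along a path. -/
def LocalPrimitives.increment {P Q : X} (γ : Path P Q) : A :=
  (F.exists_isAlong γ).choose 1 - (F.exists_isAlong γ).choose 0

theorem LocalPrimitives.IsAlong.increment_eq {F : LocalPrimitives X A} {P Q : X} {γ : Path P Q}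
    {g : unitInterval → A} (h : F.IsAlong γ g) : F.increment γ = g 1 - g 0 :=
  (F.exists_isAlong γ).choose_spec.sub_const h 1 0

/-- By monodromy, the lifts of homotopic paths from a common germ end at a common germ. -/
theorem LocalPrimitives.increment_homotopic {P Q : X} {γ δ : Path P Q}
    (h : Path.Homotopic γ δ) : F.increment γ = F.increment δ := by
  obtain ⟨E, _, p, val, hp, ⟨e, he⟩, hval⟩ := F.exists_lift_value P
  have h0 : (γ : C(unitInterval, X)) 0 = p e := by simp [he]
  have h1 : (δ : C(unitInterval, X)) 0 = p e := by simp [he]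
  have e0 : F.IsAlong γ (val ∘ hp.liftPath γ e h0) := by
    have := hval _ (hp.liftPath γ e h0).continuous
    rwa [hp.liftPath_lifts] at this
  have e1 : F.IsAlong δ (val ∘ hp.liftPath δ e h1) := by
    have := hval _ (hp.liftPath δ e h1).continuous
    rwa [hp.liftPath_lifts] at this
  rw [e0.increment_eq, e1.increment_eq]
  simp only [Function.comp, hp.liftPath_zero]
  exact congrArg (fun v => val v - val e) (hp.liftPath_apply_one_eq_of_homotopicRel h e h0 h1)

theorem LocalPrimitives.increment_symm {P Q : X} (γ : Path P Q) :
    F.increment γ.symm = -F.increment γ := by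
  obtain ⟨g, hg⟩ := F.exists_isAlong γ
  have h : F.IsAlong γ.symm (g ∘ unitInterval.symm) := hg.comp unitInterval.continuous_symm
  rw [h.increment_eq, hg.increment_eq]
  simp

theorem LocalPrimitives.increment_trans {P Q S : X} (γ : Path P Q) (δ : Path Q S) :
    F.increment (γ.trans δ) = F.increment γ + F.increment δ := by
  obtain ⟨g, hg⟩ := F.exists_isAlong (γ.trans δ)
  let σ : unitInterval → unitInterval := fun t => ⟨t / 2, by
    constructor
    · have := t.2.1; positivity
    · have := t.2.2; linarith⟩
  let τ : unitInterval → unitInterval := fun t => ⟨(t + 1) / 2, by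
    constructor
    · have := t.2.1; positivity
    · have := t.2.2; linarith⟩
  have hσ : Continuous σ := by unfold σ; fun_prop
  have hτ : Continuous τ := by unfold τ; fun_prop
  have e1 : (γ.trans δ) ∘ σ = γ := by
    funext t
    have ht : (t : ℝ) / 2 ≤ 1 / 2 := by have := t.2.2; linarith
    simp only [Function.comp, Path.trans_apply, σ, ht, dif_pos]
    congr 1
    ext
    simp; ring
  have e2 : (γ.trans δ) ∘ τ = δ := by
    funext t
    simp only [Function.comp, Path.trans_apply, τ]
    split_ifs with ht
    · have h0 : (t : ℝ) = 0 := le_antisymm (by linarith) t.2.1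
      have h0' : t = 0 := by ext; exact h0
      subst h0'
      simp
    · congr 1
      ext
      simp; ring
  have a1 : F.IsAlong γ (g ∘ σ) := by have := hg.comp hσ; rwa [e1] at this
  have a2 : F.IsAlong δ (g ∘ τ) := by have := hg.comp hτ; rwa [e2] at this
  rw [hg.increment_eq, a1.increment_eq, a2.increment_eq]
  have h1 : σ 1 = τ 0 := by ext; simp [σ, τ]
  have h2 : σ 0 = 0 := by ext; simp [σ]
  have h3 : τ 1 = 1 := by ext; simp [τ]
  simp only [Function.comp, h1, h2, h3]
  abel

/-- The increment as a homomorphism from the fundamental group. -/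
def LocalPrimitives.periodHom (P : X) : FundamentalGroup X P →* Multiplicative A where
  toFun γ := Multiplicative.ofAdd
    (Quotient.lift (s := Path.Homotopic.setoid P P) (F.increment (P := P) (Q := P))
      (fun _ _ h => F.increment_homotopic h) γ)
  map_one' := by
    have : F.increment (Path.refl P) = 0 := by
      have h : F.IsAlong (Path.refl P) (fun _ => 0) := fun y => by simp
      rw [h.increment_eq, sub_self]
    exact congrArg Multiplicative.ofAdd this
  map_mul' := by
    rintro ⟨γ⟩ ⟨δ⟩
    -- The product of the classes of `γ` and `δ` is the class of `δ.trans γ`; the order is harmless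
    -- because `A` is commutative.
    refine congrArg Multiplicative.ofAdd ((F.increment_trans δ γ).trans (add_comm _ _))

/-- The increment on the first homology group. -/
def LocalPrimitives.homologyHom (P : X) :
    Additive (Abelianization (FundamentalGroup X P)) →+ A :=
  MonoidHom.toAdditiveLeft (Abelianization.lift (F.periodHom P))

theorem LocalPrimitives.homologyHom_of (P : X) (γ : Path P P) :
    F.homologyHom P (Additive.ofMul (Abelianization.of
      (FundamentalGroup.fromPath (Path.Homotopic.Quotient.mk γ)))) = F.increment γ := rfl

/-- If the classes of the loops `c i` span the homology, then the increment along each loop is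
in the group generated by the increments along the `c i`. -/
theorem LocalPrimitives.increment_mem_closure {ι : Type} {P : X} (c : ι → Path P P)
    (hc : Submodule.span ℤ (Set.range fun i => Additive.ofMul (Abelianization.of
      (FundamentalGroup.fromPath (Path.Homotopic.Quotient.mk (c i))))) = ⊤) (γ : Path P P) :
    F.increment γ ∈ AddSubgroup.closure (Set.range fun i => F.increment (c i)) := by
  rw [← F.homologyHom_of]
  set a := Additive.ofMul (Abelianization.of
      (FundamentalGroup.fromPath (Path.Homotopic.Quotient.mk γ)))
  have ha : a ∈ Submodule.span ℤ (Set.range fun i => Additive.ofMul (Abelianization.of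
      (FundamentalGroup.fromPath (Path.Homotopic.Quotient.mk (c i))))) := hc ▸ Submodule.mem_top
  clear_value a
  induction ha using Submodule.span_induction with
  | mem x hx =>
    obtain ⟨i, rfl⟩ := hx
    exact AddSubgroup.subset_closure ⟨i, rfl⟩
  | zero => rw [map_zero]; exact zero_mem _
  | add x y _ _ hx hy => rw [map_add]; exact add_mem hx hy
  | smul n x _ hx => rw [map_zsmul]; exact zsmul_mem hx n

end Cocycle

/-! ### The implicit function theorem for one scalar equation. -/

section Implicit

theorem isInvertible_of_apply_one_ne_zero {𝕜 : Type*} [NontriviallyNormedField 𝕜] (L : 𝕜 →L[𝕜] 𝕜)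
    (h : L 1 ≠ 0) : L.IsInvertible := by
  refine ⟨ContinuousLinearEquiv.unitsEquivAut 𝕜 (Units.mk0 _ h), ?_⟩
  ext
  simp

/-- The implicit function theorem for one scalar equation. -/
theorem exists_implicit {𝕜 E : Type*} [RCLike 𝕜] [NormedAddCommGroup E] [NormedSpace 𝕜 E]
    [CompleteSpace E] {f : E × 𝕜 → 𝕜} {x₀ : E} {y₀ : 𝕜} (hf : ContDiff 𝕜 1 f)
    (h : fderiv 𝕜 f (x₀, y₀) (0, 1) ≠ 0) :
    ∃ ψ : E → 𝕜, ψ x₀ = y₀ ∧ (∀ᶠ x in 𝓝 x₀, DifferentiableAt 𝕜 ψ x ∧ f (x, ψ x) = f (x₀, y₀)) ∧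
      ∀ᶠ v in 𝓝 (x₀, y₀), f v = f (x₀, y₀) → ψ v.1 = v.2 := by
  have hc : ContDiffAt 𝕜 1 f (x₀, y₀) := hf.contDiffAt
  have hi : (fderiv 𝕜 f (x₀, y₀) ∘L .inr 𝕜 E 𝕜).IsInvertible :=
    isInvertible_of_apply_one_ne_zero _ (by simpa using h)
  refine ⟨hc.implicitFunction one_ne_zero hi, hc.implicitFunction_apply_self one_ne_zero hi,
    ?_, ?_⟩
  · have h1 := (hc.contDiffAt_implicitFunction one_ne_zero hi).eventually (by simp)
    filter_upwards [h1, hc.eventually_apply_implicitFunction one_ne_zero hi] with x hx hx'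
    exact ⟨hx.differentiableAt one_ne_zero, hx'⟩
  · filter_upwards [hc.eventually_apply_eq_iff_implicitFunction one_ne_zero hi] with v hv
    exact hv.1

end Implicit

/-! ### Holomorphic charts and local primitives on the curve. -/

section Curve

variable {g : ℕ} (e : Fin (g + 1) ⊕ Fin g → ℂ)

/-- The differential `q(λ) dλ / (4 ξ)`, written as in `holoForm`. -/
def polyForm (q : ℂ[X]) (P : ℂ × ℂ) : ℂ × ℂ →L[ℂ] ℂ :=
  if P.2 ≠ 0 then
    (q.eval P.1 / (4 * P.2)) • ContinuousLinearMap.fst ℂ ℂ ℂ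
  else
    (-(q.eval P.1 / (2 * (curvePoly e).derivative.eval P.1))) •
      ContinuousLinearMap.snd ℂ ℂ ℂ

/-- The left hand side of the equation of the curve. -/
def curveFun (P : ℂ × ℂ) : ℂ := P.2 ^ 2 + (curvePoly e).eval P.1

theorem contDiff_curveFun : ContDiff ℂ 1 (curveFun e) := by
  unfold curveFun
  exact (contDiff_snd.pow 2).add ((curvePoly e).contDiff_aeval (𝕜 := ℂ) 1 |>.comp contDiff_fst)

theorem hasFDerivAt_curveFun (P : ℂ × ℂ) : HasFDerivAt (curveFun e)
    ((2 * P.2) • ContinuousLinearMap.snd ℂ ℂ ℂ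
      + (curvePoly e).derivative.eval P.1 • ContinuousLinearMap.fst ℂ ℂ ℂ) P := by
  have h1 : HasFDerivAt (fun P : ℂ × ℂ => P.2 ^ 2) ((2 * P.2) • ContinuousLinearMap.snd ℂ ℂ ℂ) P := by
    have := (hasFDerivAt_snd (𝕜 := ℂ) (p := P)).pow 2
    simpa using this
  have h2 := ((curvePoly e).hasDerivAt P.1).comp_hasFDerivAt P (hasFDerivAt_fst (𝕜 := ℂ) (p := P))
  exact h1.add h2

theorem mem_curve_iff (P : ℂ × ℂ) : P ∈ curve e ↔ curveFun e P = 0 := Iff.rfl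

variable {e}

/-- Distinct branch points make `R` separable, so a Bézout relation excludes a common zero of `R`
and `R'`. This is the smoothness of the curve at its branch points. -/
theorem curvePoly_derivative_ne_zero (he : Function.Injective e) {x : ℂ}
    (hx : (curvePoly e).eval x = 0) : (curvePoly e).derivative.eval x ≠ 0 := by
  have hs : (curvePoly e).Separable := by
    unfold curvePoly
    exact separable_prod_X_sub_C_iff.2 he
  intro h
  obtain ⟨a, b, hab⟩ := hs
  have := congrArg (Polynomial.eval x) hab
  simp [hx, h] at this

/-- A holomorphic local parametrization of the curve, inverse to one of the coordinates. -/
theorem exists_chart (he : Function.Injective e) {P : ℂ × ℂ} (hP : P ∈ curve e) :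
    ∃ (π : ℂ × ℂ →L[ℂ] ℂ) (ψ : ℂ → ℂ × ℂ), ψ (π P) = P ∧
      (∀ᶠ ζ in 𝓝 (π P), DifferentiableAt ℂ ψ ζ ∧ ψ ζ ∈ curve e ∧ π (ψ ζ) = ζ) ∧
      (∀ᶠ Q in 𝓝[curve e] P, ψ (π Q) = Q) ∧
      ((P.2 ≠ 0 ∧ π = ContinuousLinearMap.fst ℂ ℂ ℂ) ∨
        (P.2 = 0 ∧ π = ContinuousLinearMap.snd ℂ ℂ ℂ)) := by
  have hP0 : curveFun e P = 0 := hP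
  by_cases h : P.2 = 0
  · have hR : (curvePoly e).derivative.eval P.1 ≠ 0 := by
      refine curvePoly_derivative_ne_zero he ?_
      have := hP
      simpa [curve, h] using this
    -- At a branch point the equation is solved for `λ` in terms of `ξ`, hence the swap of
    -- coordinates.
    let f : ℂ × ℂ → ℂ := fun v => curveFun e (v.2, v.1)
    have hf : ContDiff ℂ 1 f := (contDiff_curveFun e).comp (contDiff_snd.prodMk contDiff_fst)
    have hf' : fderiv ℂ f (P.2, P.1) (0, 1) ≠ 0 := by
      have h1 := HasFDerivAt.comp (g := curveFun e) (f := fun v : ℂ × ℂ => (v.2, v.1)) (P.2, P.1)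
        (hasFDerivAt_curveFun e (P.1, P.2))
        ((hasFDerivAt_snd (𝕜 := ℂ) (p := (P.2, P.1))).prodMk hasFDerivAt_fst)
      change HasFDerivAt f _ (P.2, P.1) at h1
      rw [h1.fderiv]
      simpa using hR
    obtain ⟨ψ, h0, h1, h2⟩ := exists_implicit hf hf'
    refine ⟨ContinuousLinearMap.snd ℂ ℂ ℂ, fun ζ => (ψ ζ, ζ), by simp [h0], ?_, ?_,
      Or.inr ⟨h, rfl⟩⟩
    · filter_upwards [h1] with ζ hζ
      refine ⟨hζ.1.prodMk differentiableAt_id, ?_, rfl⟩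
      rw [mem_curve_iff]
      exact hζ.2.trans hP0
    · have hsw : Tendsto (fun Q : ℂ × ℂ => (Q.2, Q.1)) (𝓝 P) (𝓝 (P.2, P.1)) :=
        (continuous_snd.prodMk continuous_fst).tendsto P
      filter_upwards [(hsw.eventually h2).filter_mono nhdsWithin_le_nhds,
        self_mem_nhdsWithin] with Q hQ hQ'
      have h3 := hQ (((mem_curve_iff e Q).1 hQ').trans hP0.symm)
      exact Prod.ext h3 rfl
  · let f : ℂ × ℂ → ℂ := curveFun e
    have hf' : fderiv ℂ f (P.1, P.2) (0, 1) ≠ 0 := by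
      rw [(hasFDerivAt_curveFun e (P.1, P.2)).fderiv]
      simpa using h
    obtain ⟨ψ, h0, h1, h2⟩ := exists_implicit (contDiff_curveFun e) hf'
    refine ⟨ContinuousLinearMap.fst ℂ ℂ ℂ, fun ζ => (ζ, ψ ζ), by simp [h0], ?_, ?_,
      Or.inl ⟨h, rfl⟩⟩
    · filter_upwards [h1] with ζ hζ
      refine ⟨differentiableAt_id.prodMk hζ.1, ?_, rfl⟩
      rw [mem_curve_iff]
      exact hζ.2.trans hP0
    · filter_upwards [h2.filter_mono nhdsWithin_le_nhds, self_mem_nhdsWithin] with Q hQ hQ'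
      have h3 := hQ (((mem_curve_iff e Q).1 hQ').trans hP0.symm)
      exact Prod.ext rfl h3

/-- A function which is holomorphic near a point has a primitive near this point. -/
theorem exists_primitive_near {h : ℂ → ℂ} {c : ℂ} (hh : ∀ᶠ ζ in 𝓝 c, DifferentiableAt ℂ h ζ) :
    ∃ f : ℂ → ℂ, ∀ᶠ ζ in 𝓝 c, HasDerivAt f (h ζ) ζ := by
  obtain ⟨r, hr, hball⟩ := Metric.eventually_nhds_iff_ball.1 hh
  obtain ⟨f, hf⟩ := DifferentiableOn.isExactOn_ball (f := h) (c := c) (r := r)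
    fun ζ hζ => (hball ζ hζ).differentiableWithinAt
  exact ⟨f, Metric.eventually_nhds_iff_ball.2 ⟨r, hr, hf⟩⟩

theorem contDiffAt_of_eventually_hasDerivAt {f h : ℂ → ℂ} {c : ℂ}
    (hf : ∀ᶠ ζ in 𝓝 c, HasDerivAt f (h ζ) ζ) : ContDiffAt ℂ 1 f c :=
  (Complex.analyticAt_iff_eventually_differentiableAt.2
    (hf.mono fun _ hζ => hζ.differentiableAt)).contDiffAt

/-- In a chart the differential is a holomorphic function times `dζ` and has a primitive on a disc;
composing with the coordinate gives a function on `ℂ²`. Its derivative is prescribed only within the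
curve, where multiples of the differential of the equation do not count. -/
theorem exists_local_primitive (he : Function.Injective e) (q : ℂ[X]) {P : ℂ × ℂ}
    (hP : P ∈ curve e) :
    ∃ F : ℂ × ℂ → ℂ, ContDiffAt ℂ 1 F P ∧ ∀ᶠ Q in 𝓝[curve e] P,
      HasFDerivWithinAt F (polyForm e q Q) (curve e) Q := by
  obtain ⟨π, ψ, h0, h1, h2, ⟨h3, rfl⟩ | ⟨h3, rfl⟩⟩ := exists_chart he hP
  · have hc : ContinuousAt ψ P.1 := h1.self_of_nhds.1.continuousAt
    have hne : ∀ᶠ ζ in 𝓝 P.1, (ψ ζ).2 ≠ 0 := by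
      refine (continuous_snd.continuousAt.comp hc).eventually_ne ?_
      have : ψ P.1 = P := h0
      simpa [this] using h3
    obtain ⟨f, hf⟩ := exists_primitive_near (c := P.1) (h := fun ζ => q.eval ζ / (4 * (ψ ζ).2)) (by
      filter_upwards [h1, hne] with ζ hζ hζ'
      refine q.differentiableAt.div ((differentiableAt_snd.comp ζ hζ.1).const_mul 4) ?_
      simpa using hζ')
    refine ⟨fun Q => f Q.1, (contDiffAt_of_eventually_hasDerivAt hf).comp P contDiffAt_fst, ?_⟩
    have ht : Tendsto (fun Q : ℂ × ℂ => Q.1) (𝓝[curve e] P) (𝓝 P.1) :=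
      (continuous_fst.tendsto P).mono_left nhdsWithin_le_nhds
    filter_upwards [h2, ht.eventually hf, ht.eventually hne] with Q hQ hQ1 hQ2
    have hQ' : ψ Q.1 = Q := hQ
    rw [hQ'] at hQ1 hQ2
    have : polyForm e q Q = (q.eval Q.1 / (4 * Q.2)) • ContinuousLinearMap.fst ℂ ℂ ℂ := by
      simp [polyForm, hQ2]
    rw [this]
    exact (hQ1.comp_hasFDerivAt Q hasFDerivAt_fst).hasFDerivWithinAt
  · have h00 : ψ P.2 = P := h0
    have hc : ContinuousAt ψ P.2 := h1.self_of_nhds.1.continuousAt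
    have hR : (curvePoly e).derivative.eval P.1 ≠ 0 := by
      refine curvePoly_derivative_ne_zero he ?_
      have := hP
      simpa [curve, h3] using this
    have hne : ∀ᶠ ζ in 𝓝 P.2, (curvePoly e).derivative.eval (ψ ζ).1 ≠ 0 := by
      refine ContinuousAt.eventually_ne (g := fun ζ => (curvePoly e).derivative.eval (ψ ζ).1) ?_ ?_
      · exact (curvePoly e).derivative.continuous.continuousAt.comp
          (continuous_fst.continuousAt.comp hc)
      · rwa [h00]
    obtain ⟨f, hf⟩ := exists_primitive_near (c := P.2)
        (h := fun ζ => -(q.eval (ψ ζ).1 / (2 * (curvePoly e).derivative.eval (ψ ζ).1))) (by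
      filter_upwards [h1, hne] with ζ hζ hζ'
      have h5 : DifferentiableAt ℂ (fun ζ => (ψ ζ).1) ζ := differentiableAt_fst.comp ζ hζ.1
      refine DifferentiableAt.neg (DifferentiableAt.div ?_ (DifferentiableAt.const_mul ?_ 2) ?_)
      · exact q.differentiableAt.comp ζ h5
      · exact (curvePoly e).derivative.differentiableAt.comp ζ h5
      · simpa using hζ')
    refine ⟨fun Q => f Q.2, (contDiffAt_of_eventually_hasDerivAt hf).comp P contDiffAt_snd, ?_⟩
    have ht : Tendsto (fun Q : ℂ × ℂ => Q.2) (𝓝[curve e] P) (𝓝 P.2) :=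
      (continuous_snd.tendsto P).mono_left nhdsWithin_le_nhds
    filter_upwards [h2, ht.eventually hf, ht.eventually hne, self_mem_nhdsWithin]
      with Q hQ hQ1 hQ2 hQ3
    have hQ' : ψ Q.2 = Q := hQ
    rw [hQ'] at hQ1 hQ2
    have hd := hQ1.comp_hasFDerivAt Q (hasFDerivAt_snd (𝕜 := ℂ) (p := Q))
    by_cases hξ : Q.2 = 0
    · have : polyForm e q Q = (-(q.eval Q.1 / (2 * (curvePoly e).derivative.eval Q.1))) •
          ContinuousLinearMap.snd ℂ ℂ ℂ := by
        simp [polyForm, hξ]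
      rw [this]
      exact hd.hasFDerivWithinAt
    -- Near a branch point but off it, the form is written with `dλ`. The added multiple of
    -- `curveFun` vanishes on the curve, and its differential turns `-q dξ / (2R')` into `q dλ /
    -- (4ξ)`.
    · have hk : HasFDerivWithinAt (fun S : ℂ × ℂ => f S.2
          + q.eval Q.1 / (4 * Q.2 * (curvePoly e).derivative.eval Q.1) * curveFun e S)
          (polyForm e q Q) (curve e) Q := by
        have := hd.add ((hasFDerivAt_curveFun e Q).const_mul
          (q.eval Q.1 / (4 * Q.2 * (curvePoly e).derivative.eval Q.1)))
        refine this.hasFDerivWithinAt.congr_fderiv ?_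
        ext
        · simp [polyForm, hξ]
          field_simp
        · simp [polyForm, hξ]
          field_simp
          ring
      refine hk.congr (fun S hS => ?_) ?_
      · simp [(mem_curve_iff e S).1 hS]
      · simp [(mem_curve_iff e Q).1 hQ3]

/-- Two functions with the same derivative along the curve differ locally by a constant. -/
theorem eventually_sub_eq_of_hasFDerivWithinAt (he : Function.Injective e) {F G : ℂ × ℂ → ℂ}
    {η : ℂ × ℂ → ℂ × ℂ →L[ℂ] ℂ} {P : ℂ × ℂ} (hP : P ∈ curve e)
    (hF : ∀ᶠ Q in 𝓝[curve e] P, HasFDerivWithinAt F (η Q) (curve e) Q)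
    (hG : ∀ᶠ Q in 𝓝[curve e] P, HasFDerivWithinAt G (η Q) (curve e) Q) :
    ∀ᶠ Q in 𝓝[curve e] P, F Q - F P = G Q - G P := by
  obtain ⟨π, ψ, h0, h1, h2, -⟩ := exists_chart he hP
  have hc : ContinuousAt ψ (π P) := h1.self_of_nhds.1.continuousAt
  have ht : Tendsto ψ (𝓝 (π P)) (𝓝[curve e] P) := by
    refine tendsto_nhdsWithin_iff.2 ⟨?_, h1.mono fun ζ hζ => hζ.2.1⟩
    have := hc.tendsto
    rwa [h0] at this
  -- Pulled back by the chart, the difference has zero derivative, so it is constant on a disc.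
  have h3 : ∀ᶠ ζ in 𝓝 (π P), HasDerivAt (fun ζ => F (ψ ζ) - G (ψ ζ)) 0 ζ := by
    filter_upwards [ht.eventually hF, ht.eventually hG, h1.eventually_nhds] with ζ hζF hζG hζ
    have hd := hζ.self_of_nhds.1.hasDerivAt
    have hm : ∀ᶠ z in 𝓝 ζ, ψ z ∈ curve e := hζ.mono fun z hz => hz.2.1
    have e1 := (hζF.comp_hasDerivAt_of_eq ζ hd hm rfl).sub
      (hζG.comp_hasDerivAt_of_eq ζ hd hm rfl)
    rw [sub_self] at e1
    exact e1
  obtain ⟨r, hr, hball⟩ := Metric.eventually_nhds_iff_ball.1 h3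
  have hconst : ∀ ζ ∈ Metric.ball (π P) r, F (ψ ζ) - G (ψ ζ) = F (ψ (π P)) - G (ψ (π P)) := by
    intro ζ hζ
    refine (convex_ball (π P) r).is_const_of_fderivWithin_eq_zero (𝕜 := ℂ)
      (f := fun ζ => F (ψ ζ) - G (ψ ζ))
      (fun z hz => (hball z hz).differentiableAt.differentiableWithinAt) (fun z hz => ?_) hζ
      (Metric.mem_ball_self hr)
    rw [fderivWithin_of_isOpen Metric.isOpen_ball hz]
    have := (hball z hz).hasFDerivAt.fderiv
    rw [this]; ext; simp
  have htp : Tendsto π (𝓝[curve e] P) (𝓝 (π P)) :=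
    (π.continuous.tendsto P).mono_left nhdsWithin_le_nhds
  filter_upwards [h2, htp.eventually (Metric.ball_mem_nhds _ hr)] with Q hQ hQ'
  have := hconst _ hQ'
  rw [hQ, h0] at this
  linear_combination this

end Curve

/-! ### Curve integrals as increments of primitives. -/

section CurvePrimitives

variable {g : ℕ} {e : Fin (g + 1) ⊕ Fin g → ℂ} {ι : Type}
  (he : Function.Injective e) (q : ι → ℂ[X])

/-- The local primitive as a function on `ℂ²`. -/
def ambientPrimitive (P : curve e) (j : ι) : ℂ × ℂ → ℂ :=
  (exists_local_primitive he (q j) P.2).choose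

theorem contDiffAt_ambientPrimitive (P : curve e) (j : ι) :
    ContDiffAt ℂ 1 (ambientPrimitive he q P j) P :=
  (exists_local_primitive he (q j) P.2).choose_spec.1

theorem hasFDerivWithinAt_ambientPrimitive (P : curve e) (j : ι) :
    HasFDerivWithinAt (ambientPrimitive he q P j) (polyForm e (q j) P) (curve e) P :=
  (exists_local_primitive he (q j) P.2).choose_spec.2.self_of_nhdsWithin P.2

variable [Finite ι]

/-- The local primitives of the differentials `q_j(λ) dλ / (4 ξ)`. -/
def curvePrimitives :
    LocalPrimitives (curve e) (ι → ℂ) where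
  toFun P Q j := (exists_local_primitive he (q j) P.2).choose Q
  compat P := by
    have h1 : ∀ j, ∀ᶠ Q in 𝓝[curve e] (P : ℂ × ℂ), ∀ᶠ S in 𝓝[curve e] Q,
        HasFDerivWithinAt (exists_local_primitive he (q j) P.2).choose (polyForm e (q j) S)
          (curve e) S := fun j =>
      eventually_eventually_nhdsWithin.2 (exists_local_primitive he (q j) P.2).choose_spec.2
    have h2 := (eventually_nhds_subtype_iff (curve e) P _).2 (eventually_all.2 h1)
    filter_upwards [h2] with Q hQ
    have h3 : ∀ᶠ S in 𝓝[curve e] (Q : ℂ × ℂ), ∀ j,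
        (exists_local_primitive he (q j) Q.2).choose S
          - (exists_local_primitive he (q j) Q.2).choose Q
        = (exists_local_primitive he (q j) P.2).choose S
          - (exists_local_primitive he (q j) P.2).choose Q :=
      eventually_all.2 fun j => eventually_sub_eq_of_hasFDerivWithinAt he Q.2
        (exists_local_primitive he (q j) Q.2).choose_spec.2 (hQ j)
    filter_upwards [(eventually_nhds_subtype_iff (curve e) Q _).2 h3] with S hS
    funext j
    exact hS j

theorem curvePrimitives_apply (P Q : curve e) (j : ι) :
    (curvePrimitives he q).toFun P Q j = ambientPrimitive he q P j Q := rfl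

theorem ambient_apply {P Q : curve e} (γ : Path P Q) (t : unitInterval) :
    ambient γ t = γ t := rfl

theorem ambient_extend {P Q : curve e} (γ : Path P Q) {t : ℝ} (ht : t ∈ Set.Icc (0 : ℝ) 1) :
    (ambient γ).extend t = γ ⟨t, ht⟩ := by
  rw [Path.extend_apply _ ht, ambient_apply]

/-- Along a `C¹` path, the curve integral is the increment of the primitives. -/
theorem curveIntegral_eq_increment {P Q : curve e} {γ : Path P Q} (hγ : IsC1 γ) (j : ι) :
    curveIntegral (polyForm e (q j)) (ambient γ) = (curvePrimitives he q).increment γ j := by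
  obtain ⟨f, hf⟩ := (curvePrimitives he q).exists_isAlong γ
  let G : ℝ → ℂ := fun t => f (Set.projIcc 0 1 zero_le_one t) j
  -- Near each time, `G` is a local primitive along the path up to a constant. So `G` is `C¹` with
  -- the integrand as its derivative, and the fundamental theorem of calculus applies.
  have hG : ∀ t (ht : t ∈ Set.Icc (0 : ℝ) 1), G =ᶠ[𝓝[Set.Icc 0 1] t] fun s =>
      ambientPrimitive he q (γ ⟨t, ht⟩) j ((ambient γ).extend s)
        + (G t - ambientPrimitive he q (γ ⟨t, ht⟩) j (γ ⟨t, ht⟩)) := by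
    intro t ht
    have h1 := hf ⟨t, ht⟩
    have h2 : Tendsto (Set.projIcc (0 : ℝ) 1 zero_le_one) (𝓝[Set.Icc 0 1] t)
        (𝓝 (⟨t, ht⟩ : unitInterval)) := by
      have := (continuous_projIcc (h := zero_le_one (α := ℝ))).tendsto t
      rw [Set.projIcc_of_mem _ ht] at this
      exact this.mono_left nhdsWithin_le_nhds
    filter_upwards [h2.eventually h1, self_mem_nhdsWithin] with s hs hs'
    have h3 := congrFun hs j
    simp only [Pi.sub_apply, curvePrimitives_apply] at h3
    have h4 : G t = f ⟨t, ht⟩ j := by simp only [G]; rw [Set.projIcc_of_mem _ ht]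
    rw [h4, ambient_extend γ hs']
    rw [Set.projIcc_of_mem _ hs'] at h3
    have h5 : G s = f ⟨s, hs'⟩ j := by simp only [G]; rw [Set.projIcc_of_mem _ hs']
    rw [h5]
    linear_combination h3
  have hCD : ContDiffOn ℝ 1 G (Set.Icc 0 1) := by
    intro t ht
    refine ContDiffWithinAt.congr_of_eventuallyEq_of_mem ?_ (hG t ht) ht
    refine ContDiffWithinAt.add ?_ contDiffWithinAt_const
    refine ContDiffAt.comp_contDiffWithinAt t
      (g := ambientPrimitive he q (γ ⟨t, ht⟩) j) ?_ (hγ t ht)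
    rw [ambient_extend γ ht]
    exact (contDiffAt_ambientPrimitive he q _ j).restrict_scalars ℝ
  have hder : ∀ t ∈ Set.Icc (0 : ℝ) 1, derivWithin G (Set.Icc 0 1) t
      = curveIntegralFun (polyForm e (q j)) (ambient γ) t := by
    intro t ht
    refine HasDerivWithinAt.derivWithin ?_ (uniqueDiffOn_Icc zero_lt_one t ht)
    refine HasDerivWithinAt.congr_of_eventuallyEq_of_mem ?_ (hG t ht) ht
    refine HasDerivWithinAt.add_const _ ?_
    rw [curveIntegralFun_def]
    have h1 := (hγ.differentiableOn one_ne_zero t ht).hasDerivWithinAt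
    have h2 := (hasFDerivWithinAt_ambientPrimitive he q (γ ⟨t, ht⟩) j).restrictScalars ℝ
    have h3 := ambient_extend γ ht
    rw [h3]
    exact h2.comp_hasDerivWithinAt_of_eq t h1
      (fun s hs => by rw [ambient_extend γ hs]; exact (γ ⟨s, hs⟩).2) h3.symm
  rw [curveIntegral_def, hf.increment_eq]
  have h0 : ∫ t in (0 : ℝ)..1, curveIntegralFun (polyForm e (q j)) (ambient γ) t
      = ∫ t in (0 : ℝ)..1, derivWithin G (Set.Icc 0 1) t := by
    refine intervalIntegral.integral_congr fun t ht => ?_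
    rw [Set.uIcc_of_le zero_le_one] at ht
    exact (hder t ht).symm
  rw [h0, intervalIntegral.integral_derivWithin_Icc_of_contDiffOn_Icc hCD zero_le_one]
  simp [G]

/-- A nearby point can be reached by a path along which the increment is given by the local
primitive. -/
theorem eventually_exists_path (P : curve e) : ∀ᶠ Q in 𝓝 P, ∃ δ : Path P Q,
    (curvePrimitives he q).increment δ
      = (curvePrimitives he q).toFun P Q - (curvePrimitives he q).toFun P P := by
  obtain ⟨π, ψ, h0, h1, h2, -⟩ := exists_chart he P.2
  have hc : ContinuousAt ψ (π P) := h1.self_of_nhds.1.continuousAt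
  -- The path will be a segment in the chart. It must stay where the primitive of `P` agrees with
  -- all the local ones, so that this single function is a primitive along the whole path.
  have hdom : ∀ᶠ ζ in 𝓝 (π P), ∀ h : ψ ζ ∈ curve e,
      (⟨ψ ζ, h⟩ : curve e) ∈ (curvePrimitives he q).domain P := by
    have h3 : ∀ᶠ Q in 𝓝 P, Q ∈ (curvePrimitives he q).domain P :=
      isOpen_interior.mem_nhds (mem_interior_iff_mem_nhds.2 ((curvePrimitives he q).compat P))
    rw [nhds_subtype_eq_comap, eventually_comap] at h3
    have h4 : Tendsto ψ (𝓝 (π P)) (𝓝 (P : ℂ × ℂ)) := by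
      have := hc.tendsto
      rwa [h0] at this
    filter_upwards [h4.eventually h3] with ζ hζ h
    exact hζ ⟨ψ ζ, h⟩ rfl
  obtain ⟨r, hr, hball⟩ := Metric.eventually_nhds_iff_ball.1 (h1.and hdom)
  have htp : Tendsto π (𝓝[curve e] (P : ℂ × ℂ)) (𝓝 (π P)) :=
    (π.continuous.tendsto _).mono_left nhdsWithin_le_nhds
  have h5 := (eventually_nhds_subtype_iff (curve e) P _).2
    (h2.and (htp.eventually (Metric.ball_mem_nhds _ hr)))
  filter_upwards [h5] with Q hQ
  have hmem : ∀ t : unitInterval,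
      AffineMap.lineMap (π P) (π Q) (t : ℝ) ∈ Metric.ball (π (P : ℂ × ℂ)) r := fun t =>
    (convex_ball (π (P : ℂ × ℂ)) r).lineMap_mem (Metric.mem_ball_self hr) hQ.2 t.2
  let δ : Path P Q :=
    { toFun := fun t => ⟨ψ (AffineMap.lineMap (π P) (π Q) (t : ℝ)), (hball _ (hmem t)).1.2.1⟩
      continuous_toFun := by
        refine Continuous.subtype_mk (continuous_iff_continuousAt.2 fun t => ?_) _
        refine ContinuousAt.comp (g := ψ) (hball _ (hmem t)).1.1.continuousAt ?_
        exact (AffineMap.lineMap_continuous.comp continuous_subtype_val).continuousAt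
      source' := by ext1; simp [h0]
      target' := by ext1; simp [hQ.1] }
  refine ⟨δ, ?_⟩
  have hδ : (curvePrimitives he q).IsAlong δ (fun t => (curvePrimitives he q).toFun P (δ t)) := by
    intro t
    have h6 : δ t ∈ (curvePrimitives he q).domain P := (hball _ (hmem t)).2 _
    have h7 := interior_subset h6
    filter_upwards [(δ.continuous.tendsto t).eventually h7] with t' ht'
    exact ht'.symm
  rw [hδ.increment_eq]
  simp

end CurvePrimitives

/-! ### Joining points of the curve by `C¹` paths. -/

section Connected

variable {g : ℕ} {e : Fin (g + 1) ⊕ Fin g → ℂ}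

/-- Two points can be joined by a `C¹` path on the curve which is constant outside `[0, 1]`. -/
def C1Joined (e : Fin (g + 1) ⊕ Fin g → ℂ) (P Q : ℂ × ℂ) : Prop :=
  ∃ c : ℝ → ℂ × ℂ, ContDiff ℝ 1 c ∧ (∀ t, c t ∈ curve e) ∧ (∀ t ≤ 0, c t = P) ∧ ∀ t, 1 ≤ t → c t = Q

theorem C1Joined.symm {P Q : ℂ × ℂ} (h : C1Joined e P Q) : C1Joined e Q P := by
  obtain ⟨c, h1, h2, h3, h4⟩ := h
  exact ⟨fun t => c (1 - t), h1.comp (contDiff_const.sub contDiff_id), fun t => h2 _,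
    fun t ht => h4 _ (by linarith), fun t ht => h3 _ (by linarith)⟩

/-- Both paths are constant outside `[0, 1]`, so the sum minus the midpoint `Q` follows the first
one up to time `1/2` and the second one afterwards. Smoothness at the junction is automatic. -/
theorem C1Joined.trans {P Q S : ℂ × ℂ} (h : C1Joined e P Q) (h' : C1Joined e Q S) :
    C1Joined e P S := by
  obtain ⟨c, h1, h2, h3, h4⟩ := h
  obtain ⟨d, k1, k2, k3, k4⟩ := h'
  refine ⟨fun t => c (2 * t) + d (2 * t - 1) - Q, ?_, fun t => ?_, fun t ht => ?_, fun t ht => ?_⟩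
  · exact ((h1.comp (contDiff_const.mul contDiff_id)).add
      (k1.comp ((contDiff_const.mul contDiff_id).sub contDiff_const))).sub contDiff_const
  · rcases le_total (2 * t) 1 with ht | ht <;> beta_reduce
    · rw [k3 (2 * t - 1) (by linarith), add_sub_cancel_right]
      exact h2 _
    · rw [h4 (2 * t) ht, add_sub_cancel_left]
      exact k2 _
  · beta_reduce
    rw [k3 (2 * t - 1) (by linarith), add_sub_cancel_right, h3 _ (by linarith)]
  · beta_reduce
    rw [h4 (2 * t) (by linarith), add_sub_cancel_left, k4 _ (by linarith)]

/-- Reparametrization by a smooth step function makes the path stationary at its ends. -/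
theorem C1Joined.of_contDiffOn {c : ℝ → ℂ × ℂ} (h : ContDiffOn ℝ 1 c (Set.Icc 0 1))
    (hc : ∀ t ∈ Set.Icc (0 : ℝ) 1, c t ∈ curve e) : C1Joined e (c 0) (c 1) := by
  have hmem : ∀ t, Real.smoothTransition t ∈ Set.Icc (0 : ℝ) 1 := fun t =>
    ⟨Real.smoothTransition.nonneg t, Real.smoothTransition.le_one t⟩
  refine ⟨fun t => c (Real.smoothTransition t), ?_, fun t => hc _ (hmem t), fun t ht => ?_,
    fun t ht => ?_⟩
  · exact h.comp_contDiff Real.smoothTransition.contDiff hmem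
  · beta_reduce
    rw [Real.smoothTransition.zero_of_nonpos ht]
  · beta_reduce
    rw [Real.smoothTransition.one_of_one_le ht]

theorem C1Joined.exists_path {P Q : curve e} (h : C1Joined e P Q) : ∃ γ : Path P Q, IsC1 γ := by
  obtain ⟨c, h1, h2, h3, h4⟩ := h
  let γ : Path P Q :=
    { toFun := fun t => ⟨c t, h2 t⟩
      continuous_toFun := (h1.continuous.comp continuous_subtype_val).subtype_mk _
      source' := by ext1; exact h3 0 le_rfl
      target' := by ext1; exact h4 1 le_rfl }
  refine ⟨γ, h1.contDiffOn.congr fun t ht => ?_⟩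
  rw [ambient_extend γ ht]
  rfl

/-- A square root of `1 + t² w` which is smooth in `t ∈ [0, 1]`. -/
theorem exists_contDiffOn_sqrt (w : ℂ) (hw : ∀ t ∈ Set.Icc (0 : ℝ) 1, 1 + (t : ℂ) * w ≠ 0) :
    ∃ s : ℝ → ℂ, ContDiffOn ℝ 1 s (Set.Icc 0 1) ∧
      ∀ t ∈ Set.Icc (0 : ℝ) 1, s t ^ 2 = 1 + (t : ℂ) ^ 2 * w := by
  have hslit : ∀ t ∈ Set.Icc (0 : ℝ) 1, 1 + (t : ℂ) ^ 2 * w ∈ Complex.slitPlane := by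
    intro t ht
    by_contra hn
    rw [Complex.mem_slitPlane_iff, not_or, not_lt, not_not] at hn
    have hre : (1 + (t : ℂ) ^ 2 * w).re = 1 + t ^ 2 * w.re := by
      rw [← Complex.ofReal_pow, Complex.add_re, Complex.re_ofReal_mul, Complex.one_re]
    have him : (1 + (t : ℂ) ^ 2 * w).im = t ^ 2 * w.im := by
      rw [← Complex.ofReal_pow, Complex.add_im, Complex.im_ofReal_mul, Complex.one_im, zero_add]
    rw [hre, him] at hn
    have ht0 : 0 < t ^ 2 := by
      by_contra h0
      have : t ^ 2 = 0 := le_antisymm (not_lt.1 h0) (sq_nonneg t)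
      rw [this] at hn
      linarith [hn.1]
    have hw0 : w.im = 0 := by
      rcases mul_eq_zero.1 hn.2 with h | h
      · exact absurd h ht0.ne'
      · exact h
    have hwre : w.re ≤ -1 := by
      have h1 : t ^ 2 ≤ 1 := pow_le_one₀ ht.1 ht.2
      by_contra hcon
      push Not at hcon
      nlinarith [hn.1]
    -- A value of `1 + t² w` outside the slit plane forces `w` to be real with `w ≤ -1`, and then `1
    -- + t w` vanishes at `t = -1/w` in `[0, 1]`.
    refine hw (-1 / w.re) ⟨?_, ?_⟩ ?_
    · exact div_nonneg_of_nonpos (by norm_num) (by linarith)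
    · rw [div_le_one_of_neg (by linarith)]; exact hwre
    · have : w = (w.re : ℂ) := Complex.ext rfl (by simp [hw0])
      rw [this]
      have hne : (w.re : ℂ) ≠ 0 := by
        rw [Complex.ofReal_ne_zero]; linarith
      push_cast
      simp only [Complex.ofReal_re]
      field_simp
      ring
  refine ⟨fun t => Complex.exp (Complex.log (1 + (t : ℂ) ^ 2 * w) / 2), ?_, fun t ht => ?_⟩
  · have h1 : ContDiff ℝ 1 fun t : ℝ => 1 + (t : ℂ) ^ 2 * w :=
      contDiff_const.add ((Complex.ofRealCLM.contDiff.pow 2).mul contDiff_const)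
    refine ContDiffOn.cexp (ContDiffOn.div_const ?_ 2)
    intro t ht
    have h2 : ContDiffAt ℝ 1 Complex.log (1 + (t : ℂ) ^ 2 * w) :=
      (Complex.contDiffAt_log (hslit t ht)).restrict_scalars ℝ
    exact (h2.comp t h1.contDiffAt).contDiffWithinAt
  · have hne : 1 + (t : ℂ) ^ 2 * w ≠ 0 := Complex.slitPlane_ne_zero (hslit t ht)
    rw [← Complex.exp_nat_mul]
    conv_rhs => rw [← Complex.exp_log hne]
    congr 1
    push_cast
    ring

theorem eval_curvePoly (e : Fin (g + 1) ⊕ Fin g → ℂ) (x : ℂ) :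
    (curvePoly e).eval x = ∏ i, (x - e i) := by
  simp [curvePoly, eval_prod]

theorem exists_eq_sq (z : ℂ) : ∃ r : ℂ, z = r ^ 2 := by
  obtain ⟨r, hr⟩ := IsAlgClosed.exists_pow_nat_eq z two_pos
  exact ⟨r, hr.symm⟩

/-- If no other branch point lies between the branch point `e i` and the projection of the point
`P` to the plane, then the two can be joined. -/
theorem c1Joined_branch {P : ℂ × ℂ} (hP : P ∈ curve e) (i : Fin (g + 1) ⊕ Fin g)
    (h : ∀ k, k ≠ i → ∀ t ∈ Set.Icc (0 : ℝ) 1, e i + (t : ℂ) * (P.1 - e i) ≠ e k) :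
    C1Joined e (e i, 0) P := by
  have hu : ∀ k, k ≠ i → e i - e k ≠ 0 := fun k hk h0 => h k hk 0 ⟨le_rfl, zero_le_one⟩ (by
    rw [Complex.ofReal_zero, zero_mul, add_zero]; exact sub_eq_zero.1 h0)
  have hs : ∀ k, ∃ s : ℝ → ℂ, k ≠ i → ContDiffOn ℝ 1 s (Set.Icc 0 1) ∧
      ∀ t ∈ Set.Icc (0 : ℝ) 1, s t ^ 2 = e i + (t : ℂ) ^ 2 * (P.1 - e i) - e k := by
    intro k
    by_cases hk : k = i
    · exact ⟨0, fun h => absurd hk h⟩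
    obtain ⟨s, hs1, hs2⟩ := exists_contDiffOn_sqrt ((P.1 - e i) / (e i - e k)) (by
      intro t ht h0
      apply h k hk t ht
      have := hu k hk
      field_simp at h0
      linear_combination h0)
    -- The factor to be rooted is `(e i - e k)(1 + t² (P.1 - e i)/(e i - e k))`.
    obtain ⟨r, hr⟩ := exists_eq_sq (e i - e k)
    refine ⟨fun t => r * s t, fun _ => ⟨contDiffOn_const.mul hs1, fun t ht => ?_⟩⟩
    have := hu k hk
    rw [mul_pow, hs2 t ht, ← hr]
    field_simp
    ring
  choose s hs using hs
  let p : ℝ → ℂ := fun t => ∏ k ∈ Finset.univ.erase i, s k t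
  have hp1 : ContDiffOn ℝ 1 p (Set.Icc 0 1) :=
    contDiffOn_prod fun k hk => (hs k (Finset.ne_of_mem_erase hk)).1
  have hp2 : ∀ t ∈ Set.Icc (0 : ℝ) 1,
      p t ^ 2 = ∏ k ∈ Finset.univ.erase i, (e i + (t : ℂ) ^ 2 * (P.1 - e i) - e k) := by
    intro t ht
    rw [← Finset.prod_pow]
    exact Finset.prod_congr rfl fun k hk => (hs k (Finset.ne_of_mem_erase hk)).2 t ht
  obtain ⟨r, hr⟩ := exists_eq_sq (-(P.1 - e i))
  -- Moving `λ` quadratically in `t` gives the factor that vanishes at the branch point the smooth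
  -- root `t c`. The sign of `c` selects which of the two points over `P.1` is reached.
  have key : ∀ c : ℂ, c ^ 2 = -(P.1 - e i) → ∀ t ∈ Set.Icc (0 : ℝ) 1,
      (e i + (t : ℂ) ^ 2 * (P.1 - e i), (t : ℂ) * c * p t) ∈ curve e := by
    intro c hc t ht
    change ((t : ℂ) * c * p t) ^ 2 + (curvePoly e).eval (e i + (t : ℂ) ^ 2 * (P.1 - e i)) = 0
    rw [eval_curvePoly, ← Finset.mul_prod_erase Finset.univ _ (Finset.mem_univ i), mul_pow, mul_pow,
      hp2 t ht, hc]
    ring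
  have hjoin : ∀ c : ℂ, c ^ 2 = -(P.1 - e i) → C1Joined e (e i, 0) (P.1, c * p 1) := by
    intro c hc
    have := C1Joined.of_contDiffOn (e := e)
      (c := fun t : ℝ => (e i + (t : ℂ) ^ 2 * (P.1 - e i), (t : ℂ) * c * p t)) (by
        have h1 : ContDiff ℝ 1 fun t : ℝ => e i + (t : ℂ) ^ 2 * (P.1 - e i) :=
          contDiff_const.add ((Complex.ofRealCLM.contDiff.pow 2).mul contDiff_const)
        have h2 : ContDiff ℝ 1 fun t : ℝ => (t : ℂ) * c :=
          Complex.ofRealCLM.contDiff.mul contDiff_const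
        exact h1.contDiffOn.prodMk (h2.contDiffOn.mul hp1)) (key c hc)
    simpa using this
  have h1 := key r hr.symm 1 ⟨zero_le_one, le_rfl⟩
  have h2 : P.2 ^ 2 = (r * p 1) ^ 2 := by
    have h3 : ((1 : ℝ) * r * p 1) ^ 2 + (curvePoly e).eval (e i + ((1 : ℝ) : ℂ) ^ 2 * (P.1 - e i)) = 0 := h1
    have h4 : P.2 ^ 2 + (curvePoly e).eval P.1 = 0 := hP
    simp only [Complex.ofReal_one, one_pow, one_mul, add_sub_cancel] at h3
    linear_combination h4 - h3
  rcases sq_eq_sq_iff_eq_or_eq_neg.1 h2 with h5 | h5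
  · have := hjoin r hr.symm
    rwa [← h5] at this
  · have := hjoin (-r) (by rw [neg_sq, ← hr])
    rwa [neg_mul, ← h5] at this

/-- Take the branch point nearest to `P.1`: another one on the segment between them would be nearer
still. -/
theorem exists_c1Joined_branch (he : Function.Injective e) {P : ℂ × ℂ} (hP : P ∈ curve e) :
    ∃ i, C1Joined e (e i, 0) P := by
  obtain ⟨i, -, hi⟩ := Finset.exists_min_image Finset.univ (fun i => ‖P.1 - e i‖)
    ⟨Sum.inl 0, Finset.mem_univ _⟩
  refine ⟨i, c1Joined_branch hP i fun k hk t ht h => ?_⟩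
  have h1 : P.1 - e k = (1 - t : ℝ) • (P.1 - e i) := by
    rw [← h, Complex.real_smul]; push_cast; ring
  have h2 := hi k (Finset.mem_univ k)
  rw [h1, norm_smul, Real.norm_of_nonneg (by linarith [ht.2])] at h2
  rcases ht.1.eq_or_lt with h0 | h0
  · rw [← h0, Complex.ofReal_zero, zero_mul, add_zero] at h
    exact hk (he h).symm
  · have h3 : ‖P.1 - e i‖ = 0 := by nlinarith [norm_nonneg (P.1 - e i)]
    rw [norm_eq_zero] at h3
    rw [h3, mul_zero, add_zero] at h
    exact hk (he h).symm

/-- There is a point of the plane which does not lie on any line through two branch points. -/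
theorem exists_generic_point (e : Fin (g + 1) ⊕ Fin g → ℂ) :
    ∃ x : ℂ, ∀ i k, ∀ t : ℝ, e k ≠ e i → e i + (t : ℂ) * (x - e i) ≠ e k := by
  -- Proper affine subspaces are null sets, so finitely many of them do not cover the plane.
  have hnull : ∀ i k, MeasureTheory.volume (line[ℝ, e i, e k] : Set ℂ) = 0 := by
    intro i k
    refine MeasureTheory.Measure.addHaar_affineSubspace _ _ fun htop => ?_
    have h1 := finrank_vectorSpan_insert_le_set ℝ ({e k} : Set ℂ) (e i)
    have h2 : Module.finrank ℝ (line[ℝ, e i, e k]).direction = 2 := by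
      rw [htop, AffineSubspace.direction_top, finrank_top, Complex.finrank_real_complex]
    rw [direction_affineSpan] at h2
    rw [h2] at h1
    simp at h1
  have hU : MeasureTheory.volume (⋃ i, ⋃ k, (line[ℝ, e i, e k] : Set ℂ)) = 0 :=
    MeasureTheory.measure_iUnion_null fun i => MeasureTheory.measure_iUnion_null fun k => hnull i k
  obtain ⟨x, hx⟩ : ∃ x, x ∉ ⋃ i, ⋃ k, (line[ℝ, e i, e k] : Set ℂ) := by
    by_contra! hall
    rw [Set.eq_univ_of_forall hall] at hU
    simp at hU
  refine ⟨x, fun i k t hik h => hx ?_⟩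
  rw [Set.mem_iUnion]
  refine ⟨i, Set.mem_iUnion.2 ⟨k, ?_⟩⟩
  have ht : (t : ℂ) ≠ 0 := by
    rintro h0
    rw [h0, zero_mul, add_zero] at h
    exact hik h.symm
  have : x = AffineMap.lineMap (e i) (e k) t⁻¹ := by
    rw [AffineMap.lineMap_apply, ← h]
    simp only [vsub_eq_sub, vadd_eq_add, Complex.real_smul]
    push_cast
    field_simp
    ring
  rw [this]
  exact AffineMap.lineMap_mem_affineSpan_pair _ _ _

/-- Any two points of the curve can be joined by a `C¹` path. -/
theorem exists_isC1_path (he : Function.Injective e) (P Q : curve e) : ∃ γ : Path P Q, IsC1 γ := by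
  obtain ⟨x, hx⟩ := exists_generic_point e
  obtain ⟨y, hy⟩ := exists_eq_sq (-(curvePoly e).eval x)
  have hxy : (x, y) ∈ curve e := by
    change y ^ 2 + (curvePoly e).eval x = 0
    rw [← hy]; ring
  have hall : ∀ i, C1Joined e (e i, 0) (x, y) := fun i =>
    c1Joined_branch hxy i fun k hk t _ => hx i k t (he.ne hk)
  obtain ⟨i, hi⟩ := exists_c1Joined_branch he P.2
  obtain ⟨j, hj⟩ := exists_c1Joined_branch he Q.2
  exact (((hi.symm.trans (hall i)).trans (hall j).symm).trans hj).exists_path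

end Connected

/-! ### The Abel map into the Jacobian. -/

section Jacobian

variable {g : ℕ} {e : Fin (g + 1) ⊕ Fin g → ℂ} {P₀ : curve e}

/-- The polynomial `q` for which the normalized differential `ω_j` is `q(λ) dλ / (4 ξ)`. -/
def normPoly (B : CanonicalBasis e P₀) (j : Fin g) : ℂ[X] :=
  ∑ l : Fin g, C (normMatrix B j l) * X ^ (g - 1 - (l : ℕ))

theorem normalizedForm_eq_polyForm (B : CanonicalBasis e P₀) (j : Fin g) :
    normalizedForm B j = polyForm e (normPoly B j) := by
  funext P
  by_cases h : P.2 = 0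
  · simp only [normalizedForm, normPoly, holoForm, polyForm, h, eval_finsetSum, smul_smul,
      ← Finset.sum_smul, eval_mul, eval_C, eval_pow, eval_X, Finset.sum_div, ← Finset.sum_neg_distrib,
      ne_eq, not_true_eq_false, if_false]
    congr 1
    refine Finset.sum_congr rfl fun l _ => by ring
  · simp only [normalizedForm, normPoly, holoForm, polyForm, h, eval_finsetSum, smul_smul,
      ← Finset.sum_smul, eval_mul, eval_C, eval_pow, eval_X, Finset.sum_div, ne_eq,
      not_false_eq_true, if_true]
    congr 1
    refine Finset.sum_congr rfl fun l _ => by ring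

variable (he : Function.Injective e) (B : CanonicalBasis e P₀)

/-- The local primitives of the normalized differentials. -/
abbrev abelPrimitives : LocalPrimitives (curve e) (Fin g → ℂ) := curvePrimitives he (normPoly B)

theorem abelIntegral_eq_increment {P Q : curve e} {γ : Path P Q} (hγ : IsC1 γ) :
    abelIntegral B γ = (abelPrimitives he B).increment γ := by
  funext j
  rw [abelIntegral, normalizedForm_eq_polyForm, curveIntegral_eq_increment he (normPoly B) hγ j]

/-- The two passages along a linking path cancel, so a linked cycle has the same period as the cycle
itself; the spanning property of the basis does the rest. -/
theorem increment_mem_periodLattice (γ : Path P₀ P₀) :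
    (abelPrimitives he B).increment γ ∈ periodLattice B := by
  have h := (abelPrimitives he B).increment_mem_closure
    (fun i => ((B.link i).trans (B.cycle i)).trans (B.link i).symm) B.spanning γ
  have h2 : (fun i => (abelPrimitives he B).increment
      (((B.link i).trans (B.cycle i)).trans (B.link i).symm))
      = fun i => abelIntegral B (B.cycle i) := by
    funext i
    rw [abelIntegral_eq_increment he B (B.isC1 i), LocalPrimitives.increment_trans,
      LocalPrimitives.increment_trans, LocalPrimitives.increment_symm]
    abel
  rw [h2] at h
  exact h

/-- The Abel map `P ↦ ∫_{P₀}^P ω`. -/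
def abelMap (Q : curve e) : Jacobian B :=
  QuotientAddGroup.mk ((abelPrimitives he B).increment (exists_isC1_path he P₀ Q).choose)

/-- Two paths with the same ends differ by a loop at `P₀`, whose increment is a period. -/
theorem mk_increment {Q : curve e} (γ : Path P₀ Q) :
    (QuotientAddGroup.mk ((abelPrimitives he B).increment γ) : Jacobian B) = abelMap he B Q := by
  rw [abelMap, QuotientAddGroup.eq, ← LocalPrimitives.increment_symm, add_comm,
    ← LocalPrimitives.increment_trans]
  exact increment_mem_periodLattice he B _

theorem mk_abelIntegral {Q : curve e} {γ : Path P₀ Q} (hγ : IsC1 γ) :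
    (QuotientAddGroup.mk (abelIntegral B γ) : Jacobian B) = abelMap he B Q := by
  rw [abelIntegral_eq_increment he B hγ, mk_increment]

/-- Prolong a path to `P` by a short path inside a chart. Thus the local primitives lift the Abel
map to `ℂ^g`. -/
theorem eventually_abelMap_eq (P : curve e) : ∀ᶠ Q in 𝓝 P, abelMap he B Q = abelMap he B P
    + QuotientAddGroup.mk ((abelPrimitives he B).toFun P Q - (abelPrimitives he B).toFun P P) := by
  filter_upwards [eventually_exists_path he (normPoly B) P] with Q ⟨δ, hδ⟩
  rw [← hδ]
  conv_rhs => rw [abelMap]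
  rw [← QuotientAddGroup.mk_add, ← LocalPrimitives.increment_trans, mk_increment]

end Jacobian

/-! ### The Abel-Jacobi variable and its derivative. -/

section AbelJacobi

variable {g : ℕ} {lam : Fin (g + 1) → ℝ} {ν : Fin g → ℂ}
  {P₀ : curve (branchPoint lam ν)} (he : Function.Injective (branchPoint lam ν))
  (B : CanonicalBasis (branchPoint lam ν) P₀)

/-- This is well-definedness. The choice of paths does not matter by `mk_abelIntegral`, and the
order of the roots does not matter because the sum runs over the root multiset of `m`. -/
theorem isAbelJacobi_iff {z : Phase (g + 1)} {μ : Fin g → ℂ} {P : Fin g → curve (branchPoint lam ν)}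
    (hμ : IsEllipticVariables lam z μ)
    (hP : ∀ k, (P k : ℂ × ℂ) = (μ k, aeval (μ k) (nPoly lam z))) (x : Jacobian B) :
    IsAbelJacobi lam B z x ↔ x = ∑ k, abelMap he B (P k) := by
  constructor
  · rintro ⟨μ', P', γ, hμ', hP', hγ, rfl⟩
    classical
    -- The default value zero off the curve gives a function on all of `ℂ`, which can be summed over
    -- a multiset of complex numbers.
    let f : ℂ → Jacobian B := fun m =>
      if h : (m, aeval m (nPoly lam z)) ∈ curve (branchPoint lam ν) then abelMap he B ⟨_, h⟩ else 0
    have hf : ∀ (m : ℂ) (Q : curve (branchPoint lam ν)),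
        (Q : ℂ × ℂ) = (m, aeval m (nPoly lam z)) → abelMap he B Q = f m := by
      rintro m ⟨Q, hQ⟩ hQ'
      simp only at hQ'
      subst hQ'
      simp only [f, hQ, dif_pos]
    have hroots : ∀ {η : Fin g → ℂ}, IsEllipticVariables lam z η →
        Finset.univ.val.map η = ((mPoly lam z).map (algebraMap ℝ ℂ)).roots := by
      intro η hη
      rw [hη]
      have : ∏ k, (X - C (η k)) = ((Finset.univ.val.map η).map fun a => X - C a).prod := by
        rw [Multiset.map_map]; rfl
      rw [this, roots_multiset_prod_X_sub_C]
    have hsum : ∀ {η : Fin g → ℂ}, IsEllipticVariables lam z η →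
        ∑ k, f (η k) = (((mPoly lam z).map (algebraMap ℝ ℂ)).roots.map f).sum := by
      intro η hη
      rw [← hroots hη, Multiset.map_map]; rfl
    have h1 : (QuotientAddGroup.mk (∑ k, abelIntegral B (γ k)) : Jacobian B)
        = ∑ k, abelMap he B (P' k) := by
      rw [← QuotientAddGroup.mk'_apply, map_sum]
      exact Finset.sum_congr rfl fun k _ => mk_abelIntegral he B (hγ k)
    rw [h1, Finset.sum_congr rfl fun k _ => hf _ _ (hP' k),
      Finset.sum_congr rfl fun k _ => hf _ _ (hP k), hsum hμ', hsum hμ]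
  · rintro rfl
    choose γ hγ using fun k => exists_isC1_path he P₀ (P k)
    refine ⟨μ, P, γ, hμ, hP, hγ, ?_⟩
    rw [← QuotientAddGroup.mk'_apply, map_sum]
    exact Finset.sum_congr rfl fun k _ => (mk_abelIntegral he B (hγ k)).symm

/-- A sufficient condition for linearization: locally, the points `P(μ_k)` are differentiable
functions of time, and the sums of the values of the differentials are constant. -/
theorem isLinearized_of_hasDerivAt (he : Function.Injective (branchPoint lam ν))
    (B : CanonicalBasis (branchPoint lam ν) P₀) {I : Set ℝ} {z : ℝ → Phase (g + 1)} {rate : Fin g → ℂ}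
    (h : ∀ t ∈ I, ∃ (μ : ℝ → Fin g → ℂ) (D : Fin g → ℂ × ℂ),
      (∀ᶠ s in 𝓝 t, IsEllipticVariables lam (z s) (μ s) ∧
        ∀ k, (μ s k, aeval (μ s k) (nPoly lam (z s))) ∈ curve (branchPoint lam ν)) ∧
      (∀ k, HasDerivAt (fun s => (μ s k, aeval (μ s k) (nPoly lam (z s)))) (D k) t) ∧
      ∀ l, ∑ k, holoForm (branchPoint lam ν) l (μ t k, aeval (μ t k) (nPoly lam (z t))) (D k)
        = rate l) :
    IsLinearized lam B I z (fun j => ∑ l, normMatrix B j l * rate l) := by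
  classical
  let φ : ℝ → Jacobian B := fun t => if h : ∃ x, IsAbelJacobi lam B (z t) x then h.choose else 0
  have hφ : ∀ t x, IsAbelJacobi lam B (z t) x → IsAbelJacobi lam B (z t) (φ t) := by
    intro t x hx
    have : ∃ x, IsAbelJacobi lam B (z t) x := ⟨x, hx⟩
    simp only [φ, this, dif_pos]
    exact this.choose_spec
  have hφ' : ∀ {s : ℝ} {μ : Fin g → ℂ}, IsEllipticVariables lam (z s) μ →
      ∀ (hc : ∀ k, (μ k, aeval (μ k) (nPoly lam (z s))) ∈ curve (branchPoint lam ν)),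
      (∀ x, IsAbelJacobi lam B (z s) x ↔ x = φ s) ∧ φ s = ∑ k, abelMap he B ⟨_, hc k⟩ := by
    intro s μ hμ hc
    have hiff := isAbelJacobi_iff he B hμ (P := fun k => ⟨_, hc k⟩) fun k => rfl
    have h1 := (hiff _).1 (hφ s _ ((hiff _).2 rfl))
    exact ⟨fun x => by rw [h1]; exact hiff x, h1⟩
  refine ⟨φ, fun t ht => ?_, fun t ht => ?_⟩
  · obtain ⟨μ, D, h1, -, -⟩ := h t ht
    exact (hφ' h1.self_of_nhds.1 h1.self_of_nhds.2).1
  · obtain ⟨μ, D, h1, h2, h3⟩ := h t ht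
    let p : ℝ → Fin g → ℂ × ℂ := fun s k => (μ s k, aeval (μ s k) (nPoly lam (z s)))
    have hpt : ∀ k, p t k ∈ curve (branchPoint lam ν) := h1.self_of_nhds.2
    let F : Fin g → Fin g → ℂ × ℂ → ℂ := fun k =>
      ambientPrimitive he (normPoly B) ⟨p t k, hpt k⟩
    obtain ⟨c, hc⟩ := QuotientAddGroup.mk_surjective (φ t)
    -- The lift is a representative of the value at `t` plus the changes of the local primitives
    -- centred at the points `P(μ_k)` of time `t`.
    refine ⟨fun s j => c j + ∑ k, (F k j (p s k) - F k j (p t k)), ?_, ?_⟩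
    · have h4 : ∀ k, ∀ᶠ s in 𝓝 t, ∀ hs : p s k ∈ curve (branchPoint lam ν),
          abelMap he B ⟨p s k, hs⟩ = abelMap he B ⟨p t k, hpt k⟩
            + QuotientAddGroup.mk (fun j => F k j (p s k) - F k j (p t k)) := by
        intro k
        have h5 := eventually_abelMap_eq he B ⟨p t k, hpt k⟩
        rw [nhds_subtype_eq_comap, eventually_comap] at h5
        filter_upwards [((h2 k).continuousAt.tendsto).eventually h5] with s hs hs'
        exact hs ⟨p s k, hs'⟩ rfl
      filter_upwards [h1, eventually_all.2 h4] with s hs hs'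
      rw [(hφ' hs.1 hs.2).2, Finset.sum_congr rfl fun k _ => hs' k (hs.2 k),
        Finset.sum_add_distrib, ← (hφ' h1.self_of_nhds.1 h1.self_of_nhds.2).2, ← hc]
      rw [show (fun j => c j + ∑ k, (F k j (p s k) - F k j (p t k)))
        = c + ∑ k, fun j => (F k j (p s k) - F k j (p t k)) by
          funext j; simp [Finset.sum_apply], QuotientAddGroup.mk_add]
      congr 1
      rw [← QuotientAddGroup.mk'_apply, map_sum]
      rfl
    · rw [hasDerivAt_pi]
      intro j
      have h6 : ∀ k, HasDerivAt (fun s => F k j (p s k) - F k j (p t k))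
          (polyForm (branchPoint lam ν) (normPoly B j) (p t k) (D k)) t := by
        intro k
        refine HasDerivAt.sub_const _ ?_
        have h7 := (hasFDerivWithinAt_ambientPrimitive he (normPoly B) ⟨p t k, hpt k⟩
          j).restrictScalars ℝ
        exact h7.comp_hasDerivAt_of_eq t (h2 k) (h1.mono fun s hs => hs.2 k) rfl
      have h8 := (HasDerivAt.fun_sum fun k (_ : k ∈ Finset.univ) => h6 k).const_add (c j)
      convert h8 using 1
      rw [← normalizedForm_eq_polyForm]
      simp only [normalizedForm, _root_.sum_apply, _root_.smul_apply, smul_eq_mul]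
      rw [Finset.sum_comm]
      refine Finset.sum_congr rfl fun l _ => ?_
      rw [← Finset.mul_sum, ← h3 l]

end AbelJacobi

/-! ### Variation of the Lax matrix under the Dirac field of the generating function. -/

section FlowAlgebra

variable {N : ℕ} {A : Type*} [CommRing A]

/-- The linear functional `∑ s_j c_j`. -/
def wsum (s : Fin N → A) (c : Fin N → A) : A := ∑ j, c j * s j

/-- `∑_j c_j ∏_{l ≠ j} (y - λ_l)`. -/
def numValue (lam : Fin N → A) (y : A) (c : Fin N → A) : A :=
  ∑ j, c j * ∏ l ∈ Finset.univ.erase j, (y - lam l)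

/-- The `p`-component of the Dirac vector field of a covector `(α, β)` at `(p, q)`. -/
def diracP (p β : Fin N → A) (i : Fin N) : A := -β i + p i * ∑ j, p j * β j

/-- The `q`-component of the Dirac vector field of a covector `(α, β)` at `(p, q)`. -/
def diracQ (p q α β : Fin N → A) (i : Fin N) : A :=
  α i - q i * (∑ j, p j * β j) - p i * (∑ j, (p j * α j - q j * β j))

/-- The generating function `x det V_x`, as a function of `w = 1 / x` and `s_j = 1 / (1 - λ_j w)`. -/
def genFun (w : A) (s p q : Fin N → A) : A :=
  wsum s (p * p) + w * (wsum s (p * p) * wsum s (q * q) - wsum s (p * q) ^ 2)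

/-- The `p`-gradient of `genFun`. -/
def genGradP (w : A) (s p q : Fin N → A) (i : Fin N) : A :=
  2 * ((1 + w * wsum s (q * q)) * p i - w * wsum s (p * q) * q i) * s i

/-- The `q`-gradient of `genFun`. -/
def genGradQ (w : A) (s p q : Fin N → A) (i : Fin N) : A :=
  2 * w * (wsum s (p * p) * q i - wsum s (p * q) * p i) * s i

/-- A linear relation between coefficient vectors gives one between their values. -/
theorem wsum_lin (s : Fin N → A) (x y : A) (c d : Fin N → A) :
    wsum s (fun j => x * c j + y * d j) = x * wsum s c + y * wsum s d := by
  simp only [wsum, Finset.mul_sum, ← Finset.sum_add_distrib]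
  exact Finset.sum_congr rfl fun j _ => by ring

theorem numValue_lin (lam : Fin N → A) (t x y : A) (c d : Fin N → A) :
    numValue lam t (fun j => x * c j + y * d j) = x * numValue lam t c + y * numValue lam t d := by
  simp only [numValue, Finset.mul_sum, ← Finset.sum_add_distrib]
  exact Finset.sum_congr rfl fun j _ => by ring

/-- The field of a covector involves two multipliers. This one vanishes for `genFun`; the other one
is computed next. -/
theorem sum_mul_genGradQ (w : A) (s p q : Fin N → A) : ∑ j, p j * genGradQ w s p q j = 0 := by
  have h := wsum_lin s (2 * w * wsum s (p * p)) (-(2 * w * wsum s (p * q))) (p * q) (p * p)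
  calc _ = wsum s (fun j => 2 * w * wsum s (p * p) * (p * q) j
      + -(2 * w * wsum s (p * q)) * (p * p) j) :=
        Finset.sum_congr rfl fun j _ => by simp only [genGradQ, Pi.mul_apply]; ring
    _ = 0 := by rw [h]; ring

theorem sum_mul_genGradP_sub (w : A) (s p q : Fin N → A) :
    ∑ j, (p j * genGradP w s p q j - q j * genGradQ w s p q j) = 2 * wsum s (p * p) := by
  have h := wsum_lin s (2 * (1 + w * wsum s (q * q))) (-(2 * w * wsum s (p * p)))
    (p * p) (q * q)
  calc _ = wsum s (fun j => 2 * (1 + w * wsum s (q * q)) * (p * p) j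
      + -(2 * w * wsum s (p * p)) * (q * q) j) :=
        Finset.sum_congr rfl fun j _ => by
          simp only [genGradQ, genGradP, Pi.mul_apply]; ring
    _ = _ := by rw [h]; ring

theorem diracP_gen (w : A) (s p q : Fin N → A) (i : Fin N) :
    diracP p (genGradQ w s p q) i
      = 2 * w * (wsum s (p * q) * p i - wsum s (p * p) * q i) * s i := by
  rw [diracP, sum_mul_genGradQ, genGradQ]; ring

theorem diracQ_gen (w : A) (s p q : Fin N → A) (i : Fin N) :
    diracQ p q (genGradP w s p q) (genGradQ w s p q) i
      = 2 * ((1 + w * wsum s (q * q)) * p i - w * wsum s (p * q) * q i) * s i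
        - 2 * wsum s (p * p) * p i := by
  rw [diracQ, sum_mul_genGradQ, sum_mul_genGradP_sub, genGradP]; ring

/-- The partial fraction identity for `1 / ((1 - λ_j w) (y - λ_j))`. -/
theorem numValue_mul_weights {lam s : Fin N → A} {w : A} (hs : ∀ j, s j * (1 - lam j * w) = 1)
    (y : A) (c : Fin N → A) :
    (1 - y * w) * numValue lam y (fun j => c j * s j)
      = numValue lam y c - w * (∏ l, (y - lam l)) * wsum s c := by
  simp only [numValue, wsum, Finset.mul_sum, ← Finset.sum_sub_distrib]
  refine Finset.sum_congr rfl fun j _ => ?_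
  rw [← Finset.mul_prod_erase Finset.univ (fun l => y - lam l) (Finset.mem_univ j)]
  linear_combination (c j * ∏ l ∈ Finset.univ.erase j, (y - lam l)) * hs j

variable {lam s : Fin N → A} {w : A} (hs : ∀ j, s j * (1 - lam j * w) = 1)
  {p q P Q : Fin N → A} {u : A}
  (hP : ∀ i, -2 * u * P i = 2 * w * (wsum s (p * q) * p i - wsum s (p * p) * q i) * s i)
  (hQ : ∀ i, -2 * u * Q i = 2 * ((1 + w * wsum s (q * q)) * p i - w * wsum s (p * q) * q i) * s i
        - 2 * wsum s (p * p) * p i)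

/-- The variation of `m`. -/
theorem gen_variation_m (hs : ∀ j, s j * (1 - lam j * w) = 1)
    (hP : ∀ i, -2 * u * P i = 2 * w * (wsum s (p * q) * p i - wsum s (p * p) * q i) * s i) (y : A) :
    (1 - y * w) * (-2 * u * numValue lam y (fun j => 2 * p j * P j))
      = 4 * w * (-wsum s (p * p) * numValue lam y (p * q)
        + wsum s (p * q) * numValue lam y (p * p)) := by
  have h1 : -2 * u * numValue lam y (fun j => 2 * p j * P j)
      = numValue lam y (fun j => 4 * w * wsum s (p * q) * ((p * p) j * s j)
        + -(4 * w * wsum s (p * p)) * ((p * q) j * s j)) := by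
    simp only [numValue, Finset.mul_sum]
    refine Finset.sum_congr rfl fun j _ => ?_
    simp only [Pi.mul_apply]
    linear_combination (2 * p j * ∏ l ∈ Finset.univ.erase j, (y - lam l)) * hP j
  rw [h1, numValue_lin]
  linear_combination 4 * w * wsum s (p * q) * numValue_mul_weights hs y (p * p)
    - 4 * w * wsum s (p * p) * numValue_mul_weights hs y (p * q)

/-- The variation of `-n`. -/
theorem gen_variation_n (hs : ∀ j, s j * (1 - lam j * w) = 1)
    (hP : ∀ i, -2 * u * P i = 2 * w * (wsum s (p * q) * p i - wsum s (p * p) * q i) * s i)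
    (hQ : ∀ i, -2 * u * Q i = 2 * ((1 + w * wsum s (q * q)) * p i - w * wsum s (p * q) * q i) * s i
        - 2 * wsum s (p * p) * p i) (y : A) :
    (1 - y * w) * (-2 * u * numValue lam y (fun j => P j * q j + p j * Q j))
      = -2 * w * wsum s (p * p) * (∏ l, (y - lam l) + numValue lam y (q * q))
        + 2 * (1 + w * wsum s (q * q) - (1 - y * w) * wsum s (p * p))
          * numValue lam y (p * p) := by
  have h1 : -2 * u * numValue lam y (fun j => P j * q j + p j * Q j)
      = numValue lam y (fun j => 1 * (2 * (1 + w * wsum s (q * q)) * ((p * p) j * s j)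
        + -(2 * w * wsum s (p * p)) * ((q * q) j * s j))
        + -(2 * wsum s (p * p)) * (p * p) j) := by
    simp only [numValue, Finset.mul_sum]
    refine Finset.sum_congr rfl fun j _ => ?_
    simp only [Pi.mul_apply]
    linear_combination (q j * ∏ l ∈ Finset.univ.erase j, (y - lam l)) * hP j
      + (p j * ∏ l ∈ Finset.univ.erase j, (y - lam l)) * hQ j
  rw [h1, numValue_lin, numValue_lin]
  linear_combination 2 * (1 + w * wsum s (q * q)) * numValue_mul_weights hs y (p * p)
    - 2 * w * wsum s (p * p) * numValue_mul_weights hs y (q * q)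

/-- The variation of `l`. -/
theorem gen_variation_l (hs : ∀ j, s j * (1 - lam j * w) = 1)
    (hQ : ∀ i, -2 * u * Q i = 2 * ((1 + w * wsum s (q * q)) * p i - w * wsum s (p * q) * q i) * s i
        - 2 * wsum s (p * p) * p i) (y : A) :
    (1 - y * w) * (-2 * u * numValue lam y (fun j => 2 * q j * Q j))
      = 4 * (1 + w * wsum s (q * q) - (1 - y * w) * wsum s (p * p)) * numValue lam y (p * q)
        - 4 * w * wsum s (p * q) * (∏ l, (y - lam l) + numValue lam y (q * q)) := by
  have h1 : -2 * u * numValue lam y (fun j => 2 * q j * Q j)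
      = numValue lam y (fun j => 1 * (4 * (1 + w * wsum s (q * q)) * ((p * q) j * s j)
        + -(4 * w * wsum s (p * q)) * ((q * q) j * s j))
        + -(4 * wsum s (p * p)) * (p * q) j) := by
    simp only [numValue, Finset.mul_sum]
    refine Finset.sum_congr rfl fun j _ => ?_
    simp only [Pi.mul_apply]
    linear_combination (2 * q j * ∏ l ∈ Finset.univ.erase j, (y - lam l)) * hQ j
  rw [h1, numValue_lin, numValue_lin]
  linear_combination 4 * (1 + w * wsum s (q * q)) * numValue_mul_weights hs y (p * q)
    - 4 * w * wsum s (p * q) * numValue_mul_weights hs y (q * q)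

/-- The variation of the spectral polynomial vanishes. -/
theorem gen_variation_spectral (hs : ∀ j, s j * (1 - lam j * w) = 1)
    (hP : ∀ i, -2 * u * P i = 2 * w * (wsum s (p * q) * p i - wsum s (p * p) * q i) * s i)
    (hQ : ∀ i, -2 * u * Q i = 2 * ((1 + w * wsum s (q * q)) * p i - w * wsum s (p * q) * q i) * s i
        - 2 * wsum s (p * p) * p i) (y : A) (hy : IsUnit (1 - y * w)) (hu : IsUnit (-2 * u)) :
    -2 * numValue lam y (p * q) * numValue lam y (fun j => P j * q j + p j * Q j)
      + numValue lam y (p * p) * numValue lam y (fun j => 2 * q j * Q j)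
      + (∏ l, (y - lam l) + numValue lam y (q * q)) * numValue lam y (fun j => 2 * p j * P j)
      = 0 := by
  have h1 := gen_variation_m hs hP y
  have h2 := gen_variation_n hs hP hQ y
  have h3 := gen_variation_l hs hQ y
  -- The variations are known only after multiplication by these units; their combination then
  -- cancels identically.
  refine (hy.mul hu).mul_left_cancel ?_
  linear_combination (-2 * numValue lam y (p * q)) * h2 + numValue lam y (p * p) * h3
    + (∏ l, (y - lam l) + numValue lam y (q * q)) * h1

end FlowAlgebra

/-! ### Reversed polynomials and Lagrange interpolation. -/

section Homogenization

variable {N : ℕ}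

/-- Transfers identities in `λ` to identities in `w = 1/λ`. -/
theorem eq_of_eval_inv {K : Type*} [Field K] [Infinite K] {f h : K[X]}
    (H : ∀ x : K, x ≠ 0 → f.eval x⁻¹ = h.eval x⁻¹) : f = h := by
  refine eq_of_infinite_eval_eq f h (Set.Infinite.mono (s := {x | x ≠ 0}) (fun x hx => ?_) ?_)
  · have := H x⁻¹ (inv_ne_zero hx)
    rwa [inv_inv] at this
  · exact (Set.finite_singleton (0 : K)).infinite_compl

/-- The reversed numerator `∑_j c_j ∏_{l ≠ j} (1 - λ_l X)`. -/
def revNumerator (lam c : Fin N → ℝ) : ℝ[X] :=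
  ∑ j, C (c j) * ∏ l ∈ Finset.univ.erase j, (1 - C (lam l) * X)

theorem eval_revNumerator_inv {g : ℕ} (lam c : Fin (g + 1) → ℝ) {x : ℝ} (hx : x ≠ 0) :
    x ^ g * (revNumerator lam c).eval x⁻¹ = (numerator lam c).eval x := by
  simp only [revNumerator, numerator, eval_finsetSum, eval_mul, eval_C, eval_prod, eval_sub, eval_X,
    eval_one, Finset.mul_sum]
  refine Finset.sum_congr rfl fun j _ => ?_
  have h1 : x ^ g = ∏ l ∈ Finset.univ.erase j, x := by simp
  rw [h1, mul_left_comm, ← Finset.prod_mul_distrib]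
  congr 1
  refine Finset.prod_congr rfl fun l _ => ?_
  field_simp

theorem revNumerator_eq_prod {g : ℕ} {lam c : Fin (g + 1) → ℝ} {μ : Fin g → ℝ}
    (h : numerator lam c = ∏ k, (X - C (μ k))) : revNumerator lam c = ∏ k, (1 - C (μ k) * X) := by
  refine eq_of_eval_inv fun x hx => ?_
  have h1 := eval_revNumerator_inv lam c hx
  rw [h] at h1
  refine mul_left_cancel₀ (pow_ne_zero g hx) (h1.trans ?_)
  have h2 : x ^ g = ∏ k : Fin g, x := by simp
  simp only [eval_prod, eval_sub, eval_mul, eval_C, eval_X, eval_one]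
  rw [h2, ← Finset.prod_mul_distrib]
  refine Finset.prod_congr rfl fun l _ => ?_
  field_simp

/-- Lagrange interpolation of `X ^ d`, in reversed form. -/
theorem sum_lagrange_rev {g : ℕ} {μ : Fin g → ℝ} (hμ : Function.Injective μ) {d : ℕ} (hd : d < g) :
    ∑ k, C (μ k ^ d / ∏ l ∈ Finset.univ.erase k, (μ k - μ l))
      * ∏ l ∈ Finset.univ.erase k, (1 - C (μ l) * X) = X ^ (g - 1 - d) := by
  refine eq_of_eval_inv fun x hx => ?_
  -- As its degree is less than `g`, the monomial `X ^ d` equals its interpolant at the `μ_k`.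
  -- Dividing the value at `x` by `x ^ (g - 1)` gives the reversed identity.
  have h1 := Lagrange.eq_interpolate (s := Finset.univ) (v := μ) (f := (X ^ d : ℝ[X]))
    hμ.injOn (by rw [degree_X_pow]; simpa using hd)
  have h2 := congrArg (Polynomial.eval x) h1
  rw [Lagrange.interpolate_apply] at h2
  simp only [eval_finsetSum, eval_mul, eval_C, eval_pow, eval_X, eval_prod, Lagrange.basis,
    Lagrange.basisDivisor, eval_sub, eval_one] at h2 ⊢
  refine mul_left_cancel₀ (pow_ne_zero (g - 1) hx) ?_
  have h3 : x ^ (g - 1) * x⁻¹ ^ (g - 1 - d) = x ^ d := by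
    have : g - 1 = d + (g - 1 - d) := by omega
    rw [inv_pow]
    conv_lhs => arg 1; rw [this]
    rw [pow_add]
    field_simp
  rw [h3, h2, Finset.mul_sum]
  refine Finset.sum_congr rfl fun k _ => ?_
  rw [Finset.prod_mul_distrib, div_eq_mul_inv, ← Finset.prod_inv_distrib]
  have h4 : x ^ (g - 1) = ∏ l ∈ Finset.univ.erase k, x := by simp
  have h5 : ∏ l ∈ Finset.univ.erase k, (x - μ l)
      = x ^ (g - 1) * ∏ l ∈ Finset.univ.erase k, (1 - μ l * x⁻¹) := by
    rw [h4, ← Finset.prod_mul_distrib]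
    refine Finset.prod_congr rfl fun l _ => ?_
    field_simp
  rw [h5]
  ring

end Homogenization

/-! ### The Dirac vector field on the tangent bundle of the sphere. -/

section DiracField

variable {N : ℕ}

theorem hasFDerivAt_coordP (z : Phase N) (j : Fin N) : HasFDerivAt (fun y : Phase N => y.1 j)
    ((ContinuousLinearMap.proj (R := ℝ) (φ := fun _ : Fin N => ℝ) j).comp
      (ContinuousLinearMap.fst ℝ (Fin N → ℝ) (Fin N → ℝ))) z :=
  ((ContinuousLinearMap.proj (R := ℝ) (φ := fun _ : Fin N => ℝ) j).comp
      (ContinuousLinearMap.fst ℝ (Fin N → ℝ) (Fin N → ℝ))).hasFDerivAt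

theorem hasFDerivAt_coordQ (z : Phase N) (j : Fin N) : HasFDerivAt (fun y : Phase N => y.2 j)
    ((ContinuousLinearMap.proj (R := ℝ) (φ := fun _ : Fin N => ℝ) j).comp
      (ContinuousLinearMap.snd ℝ (Fin N → ℝ) (Fin N → ℝ))) z :=
  ((ContinuousLinearMap.proj (R := ℝ) (φ := fun _ : Fin N => ℝ) j).comp
      (ContinuousLinearMap.snd ℝ (Fin N → ℝ) (Fin N → ℝ))).hasFDerivAt

theorem partialP_coordP (z : Phase N) (i j : Fin N) :
    partialP (fun y : Phase N => y.1 j) z i = if j = i then 1 else 0 := by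
  have h := hasFDerivAt_coordP z j
  simp [partialP, h.fderiv, Pi.single_apply]

theorem partialQ_coordP (z : Phase N) (i j : Fin N) :
    partialQ (fun y : Phase N => y.1 j) z i = 0 := by
  have h := hasFDerivAt_coordP z j
  simp [partialQ, h.fderiv]

theorem partialP_coordQ (z : Phase N) (i j : Fin N) :
    partialP (fun y : Phase N => y.2 j) z i = 0 := by
  have h := hasFDerivAt_coordQ z j
  simp [partialP, h.fderiv]

theorem partialQ_coordQ (z : Phase N) (i j : Fin N) :
    partialQ (fun y : Phase N => y.2 j) z i = if j = i then 1 else 0 := by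
  have h := hasFDerivAt_coordQ z j
  simp [partialQ, h.fderiv, Pi.single_apply]

theorem lineDeriv_of_hasFDerivAt {f : Phase N → ℝ} {z v : Phase N} {c : ℝ}
    (hf : DifferentiableAt ℝ f z) (h : HasDerivAt (fun t : ℝ => f (z + t • v)) c 0) :
    fderiv ℝ f z v = c := by
  rw [← hf.lineDeriv_eq_fderiv]
  exact h.deriv

theorem differentiable_constraintF : Differentiable ℝ (constraintF (N := N)) := by
  unfold constraintF dotProduct
  fun_prop

theorem differentiable_constraintG : Differentiable ℝ (constraintG (N := N)) := by
  unfold constraintG dotProduct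
  fun_prop

theorem hasDerivAt_line (z v : Phase N) (j : Fin N) :
    HasDerivAt (fun t : ℝ => (z + t • v).1 j) (v.1 j) 0 ∧
    HasDerivAt (fun t : ℝ => (z + t • v).2 j) (v.2 j) 0 := by
  constructor
  · simpa using ((hasDerivAt_id (0 : ℝ)).mul_const (v.1 j)).const_add (z.1 j)
  · simpa using ((hasDerivAt_id (0 : ℝ)).mul_const (v.2 j)).const_add (z.2 j)

theorem fderiv_constraintF (z v : Phase N) :
    fderiv ℝ constraintF z v = ∑ j, (v.1 j * z.2 j + z.1 j * v.2 j) := by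
  refine lineDeriv_of_hasFDerivAt (differentiable_constraintF z) ?_
  have := HasDerivAt.fun_sum fun j (_ : j ∈ Finset.univ) =>
    (hasDerivAt_line z v j).1.mul (hasDerivAt_line z v j).2
  simpa [constraintF, dotProduct] using this

theorem fderiv_constraintG (z v : Phase N) :
    fderiv ℝ constraintG z v = ∑ j, (v.1 j * z.1 j + z.1 j * v.1 j) := by
  refine lineDeriv_of_hasFDerivAt (differentiable_constraintG z) ?_
  have := (HasDerivAt.fun_sum fun j (_ : j ∈ Finset.univ) =>
    (hasDerivAt_line z v j).1.mul (hasDerivAt_line z v j).1).sub_const 1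
  simpa [constraintG, dotProduct] using this

theorem partialP_constraintF (z : Phase N) (i : Fin N) : partialP constraintF z i = z.2 i := by
  simp [partialP, fderiv_constraintF, Pi.single_apply]

theorem partialQ_constraintF (z : Phase N) (i : Fin N) : partialQ constraintF z i = z.1 i := by
  simp [partialQ, fderiv_constraintF, Pi.single_apply]

theorem partialP_constraintG (z : Phase N) (i : Fin N) :
    partialP constraintG z i = 2 * z.1 i := by
  simp [partialP, fderiv_constraintG, Pi.single_apply, Finset.sum_add_distrib]; ring

theorem partialQ_constraintG (z : Phase N) (i : Fin N) : partialQ constraintG z i = 0 := by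
  simp [partialQ, fderiv_constraintG]

theorem sum_sq_of_mem {z : Phase N} (hz : z ∈ tangentSphere N) : ∑ j, z.1 j * z.1 j = 1 := by
  have := hz.2
  simp only [constraintG, dotProduct] at this
  linarith

/-- In general `{F, G} = 2⟨p, p⟩`; its value on the sphere makes the Dirac correction polynomial. -/
theorem poisson_constraints {z : Phase N} (hz : z ∈ tangentSphere N) :
    poisson constraintF constraintG z = 2 := by
  simp only [poisson, partialP_constraintF, partialQ_constraintF, partialP_constraintG,
    partialQ_constraintG]
  have h := congrArg (2 * ·) (sum_sq_of_mem hz)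
  simp only [Finset.mul_sum, mul_one] at h
  refine Eq.trans (Finset.sum_congr rfl fun j _ => ?_) h
  ring

/-- The Dirac vector field in terms of the gradient of the Hamiltonian. -/
theorem dirac_coordP {z : Phase N} (hz : z ∈ tangentSphere N) (H : Phase N → ℝ) (i : Fin N) :
    dirac (fun y => y.1 i) H z = diracP z.1 (partialQ H z) i := by
  have h1 : poisson (fun y => y.1 i) H z = -partialQ H z i := by
    simp [poisson, partialP_coordP, partialQ_coordP]
  have h2 : poisson (fun y => y.1 i) constraintF z = -z.1 i := by
    simp [poisson, partialP_coordP, partialQ_coordP, partialQ_constraintF]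
  have h3 : poisson (fun y => y.1 i) constraintG z = 0 := by
    simp [poisson, partialP_coordP, partialQ_coordP, partialQ_constraintG]
  have h4 : poisson constraintG H z = -2 * ∑ j, z.1 j * partialQ H z j := by
    simp only [poisson, partialP_constraintG, partialQ_constraintG, Finset.mul_sum]
    exact Finset.sum_congr rfl fun j _ => by ring
  rw [dirac, h1, h2, h3, h4, poisson_constraints hz, diracP]
  ring

theorem dirac_coordQ {z : Phase N} (hz : z ∈ tangentSphere N) (H : Phase N → ℝ) (i : Fin N) :
    dirac (fun y => y.2 i) H z = diracQ z.1 z.2 (partialP H z) (partialQ H z) i := by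
  have h1 : poisson (fun y => y.2 i) H z = partialP H z i := by
    simp [poisson, partialP_coordQ, partialQ_coordQ]
  have h2 : poisson (fun y => y.2 i) constraintF z = z.2 i := by
    simp [poisson, partialP_coordQ, partialQ_coordQ, partialP_constraintF]
  have h3 : poisson (fun y => y.2 i) constraintG z = 2 * z.1 i := by
    simp [poisson, partialP_coordQ, partialQ_coordQ, partialP_constraintG]
  have h4 : poisson constraintG H z = -2 * ∑ j, z.1 j * partialQ H z j := by
    simp only [poisson, partialP_constraintG, partialQ_constraintG, Finset.mul_sum]
    exact Finset.sum_congr rfl fun j _ => by ring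
  have h5 : poisson constraintF H z = ∑ j, (z.1 j * partialP H z j - z.2 j * partialQ H z j) := by
    simp only [poisson, partialP_constraintF, partialQ_constraintF]
  rw [dirac, h1, h2, h3, h4, h5, poisson_constraints hz, diracQ]
  ring

end DiracField

/-! ### Linearity of the Dirac field and its blindness to the constraints. -/

section DiracLinear

variable {N : ℕ} {A : Type*} [CommRing A]

theorem diracP_const_mul (p β : Fin N → A) (c : A) (i : Fin N) :
    diracP p (fun j => c * β j) i = c * diracP p β i := by
  have h : ∑ j, p j * (c * β j) = c * ∑ j, p j * β j := by
    rw [Finset.mul_sum]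
    exact Finset.sum_congr rfl fun j _ => by ring
  rw [diracP, diracP, h]; ring

theorem diracQ_const_mul (p q α β : Fin N → A) (c : A) (i : Fin N) :
    diracQ p q (fun j => c * α j) (fun j => c * β j) i = c * diracQ p q α β i := by
  have h : ∑ j, p j * (c * β j) = c * ∑ j, p j * β j := by
    rw [Finset.mul_sum]
    exact Finset.sum_congr rfl fun j _ => by ring
  have h' : ∑ j, (p j * (c * α j) - q j * (c * β j)) = c * ∑ j, (p j * α j - q j * β j) := by
    rw [Finset.mul_sum]
    exact Finset.sum_congr rfl fun j _ => by ring
  rw [diracQ, diracQ, h, h']; ring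

/-- Adding multiples of the differentials of the constraints does not change the vector field. -/
theorem diracP_add_constraints {p : Fin N → A} (hp : ∑ j, p j * p j = 1) (β : Fin N → A) (b : A)
    (i : Fin N) : diracP p (fun j => β j + b * p j) i = diracP p β i := by
  have h : ∑ j, p j * (β j + b * p j) = ∑ j, p j * β j + b := by
    conv_rhs => rw [← mul_one b, ← hp, Finset.mul_sum, ← Finset.sum_add_distrib]
    exact Finset.sum_congr rfl fun j _ => by ring
  rw [diracP, diracP, h]; ring

theorem diracQ_add_constraints {p : Fin N → A} (hp : ∑ j, p j * p j = 1) (q α β : Fin N → A)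
    (a b : A) (i : Fin N) :
    diracQ p q (fun j => α j + (a * (2 * p j) + b * q j)) (fun j => β j + b * p j) i
      = diracQ p q α β i := by
  have h : ∑ j, p j * (β j + b * p j) = ∑ j, p j * β j + b := by
    conv_rhs => rw [← mul_one b, ← hp, Finset.mul_sum, ← Finset.sum_add_distrib]
    exact Finset.sum_congr rfl fun j _ => by ring
  have h' : ∑ j, (p j * (α j + (a * (2 * p j) + b * q j)) - q j * (β j + b * p j))
      = ∑ j, (p j * α j - q j * β j) + 2 * a := by
    conv_rhs => rw [← mul_one (2 * a), ← hp, Finset.mul_sum, ← Finset.sum_add_distrib]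
    exact Finset.sum_congr rfl fun j _ => by ring
  rw [diracQ, diracQ, h, h']; ring

end DiracLinear

/-! ### The gradient of the generating function, real and formal. -/

section GenFunDerivative

variable {N : ℕ} {A : Type*} [CommRing A]

/-- A notion of derivative, at a fixed time, of `A`-valued curves. -/
structure IsCurveDerivation (D : (ℝ → A) → A → Prop) : Prop where
  const : ∀ a, D (fun _ => a) 0
  add : ∀ {f g : ℝ → A} {f' g' : A}, D f f' → D g g' → D (fun t => f t + g t) (f' + g')
  mul : ∀ {f g : ℝ → A} {f' g' : A}, D f f' → D g g' →
    D (fun t => f t * g t) (f' * g 0 + f 0 * g')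

variable {D : (ℝ → A) → A → Prop} (hD : IsCurveDerivation D)

theorem IsCurveDerivation.sum {D : (ℝ → A) → A → Prop} (hD : IsCurveDerivation D) {ι : Type*}
    (S : Finset ι) {f : ι → ℝ → A} {f' : ι → A}
    (h : ∀ i, D (f i) (f' i)) : D (fun t => ∑ i ∈ S, f i t) (∑ i ∈ S, f' i) := by
  classical
  induction S using Finset.induction_on with
  | empty => simpa using hD.const 0
  | insert i S hi ih => simpa [Finset.sum_insert hi] using hD.add (h i) ih

theorem IsCurveDerivation.const_mul {D : (ℝ → A) → A → Prop} (hD : IsCurveDerivation D) (a : A)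
    {f : ℝ → A} {f' : A} (h : D f f') : D (fun t => a * f t) (a * f') := by
  simpa using hD.mul (hD.const a) h

theorem IsCurveDerivation.wsum {D : (ℝ → A) → A → Prop} (hD : IsCurveDerivation D) (s : Fin N → A)
    {u v : ℝ → Fin N → A} {u' v' : Fin N → A} (hu : ∀ j, D (fun t => u t j) (u' j))
    (hv : ∀ j, D (fun t => v t j) (v' j)) :
    D (fun t => wsum s (u t * v t)) (wsum s (u' * v 0) + wsum s (u 0 * v')) := by
  have := hD.sum Finset.univ fun j => hD.const_mul (s j) (hD.mul (hu j) (hv j))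
  convert this using 1
  · funext t
    exact Finset.sum_congr rfl fun j _ => by simp only [Pi.mul_apply]; ring
  · simp only [NeumannKdV.wsum, ← Finset.sum_add_distrib]
    exact Finset.sum_congr rfl fun j _ => by simp only [Pi.mul_apply]; ring

/-- Only the sum and product rules enter, so one computation covers both ordinary derivatives and
coefficientwise derivatives of power series. -/
theorem IsCurveDerivation.genFun {D : (ℝ → A) → A → Prop} (hD : IsCurveDerivation D) (w : A)
    (s : Fin N → A) {p q : ℝ → Fin N → A} {p' q' : Fin N → A} (hp : ∀ j, D (fun t => p t j) (p' j))
    (hq : ∀ j, D (fun t => q t j) (q' j)) :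
    D (fun t => genFun w s (p t) (q t))
      (∑ j, (p' j * genGradP w s (p 0) (q 0) j + q' j * genGradQ w s (p 0) (q 0) j)) := by
  have hpp := hD.wsum s hp hp
  have hqq := hD.wsum s hq hq
  have hpq := hD.wsum s hp hq
  have h := hD.add hpp (hD.const_mul w (hD.add (hD.mul hpp hqq)
    (hD.const_mul (-1) (hD.mul hpq hpq))))
  convert h using 1
  · funext t; simp only [NeumannKdV.genFun]; ring
  · have h1 := wsum_lin s (2 * (1 + w * NeumannKdV.wsum s (q 0 * q 0)))
      (-(2 * w * NeumannKdV.wsum s (p 0 * q 0))) (p' * p 0) (p' * q 0)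
    have h2 := wsum_lin s (2 * w * NeumannKdV.wsum s (p 0 * p 0))
      (-(2 * w * NeumannKdV.wsum s (p 0 * q 0))) (q' * q 0) (p 0 * q')
    rw [mul_comm (p 0) p', mul_comm (q 0) q'] at *
    rw [Finset.sum_add_distrib]
    have h3 : ∑ j, p' j * genGradP w s (p 0) (q 0) j = NeumannKdV.wsum s (fun j =>
        2 * (1 + w * NeumannKdV.wsum s (q 0 * q 0)) * (p' * p 0) j
          + -(2 * w * NeumannKdV.wsum s (p 0 * q 0)) * (p' * q 0) j) :=
      Finset.sum_congr rfl fun j _ => by simp only [genGradP, Pi.mul_apply]; ring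
    have h4 : ∑ j, q' j * genGradQ w s (p 0) (q 0) j = NeumannKdV.wsum s (fun j =>
        2 * w * NeumannKdV.wsum s (p 0 * p 0) * (q' * q 0) j
          + -(2 * w * NeumannKdV.wsum s (p 0 * q 0)) * (p 0 * q') j) :=
      Finset.sum_congr rfl fun j _ => by simp only [genGradQ, Pi.mul_apply]; ring
    rw [h3, h4, h1, h2]
    ring

theorem isCurveDerivation_hasDerivAt :
    IsCurveDerivation fun (f : ℝ → ℝ) f' => HasDerivAt f f' 0 where
  const := hasDerivAt_const 0
  add := fun hf hg => hf.add hg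
  mul := fun hf hg => hf.mul hg

/-- The coefficientwise derivative at time zero of a curve of power series. -/
def HasFormalDeriv (f : ℝ → PowerSeries ℝ) (f' : PowerSeries ℝ) : Prop :=
  ∀ k, HasDerivAt (fun t => PowerSeries.coeff k (f t)) (PowerSeries.coeff k f') 0

theorem isCurveDerivation_hasFormalDeriv : IsCurveDerivation HasFormalDeriv where
  const := fun a k => by simpa using hasDerivAt_const 0 (PowerSeries.coeff k a)
  add := fun hf hg k => by
    simp only [map_add]
    exact (hf k).add (hg k)
  mul := fun hf hg k => by
    have := HasDerivAt.fun_sum fun (ab : ℕ × ℕ) (_ : ab ∈ Finset.HasAntidiagonal.antidiagonal k) =>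
      (hf ab.1).mul (hg ab.2)
    simpa [PowerSeries.coeff_mul, Finset.sum_add_distrib] using this

end GenFunDerivative

/-! ### The vector field of `1 - √f`. -/

section RealFlow

variable {N : ℕ}

theorem differentiable_genFun (w : ℝ) (s : Fin N → ℝ) :
    Differentiable ℝ fun z : Phase N => genFun w s z.1 z.2 := by
  unfold genFun wsum
  simp only [Pi.mul_apply]
  fun_prop

theorem fderiv_genFun (w : ℝ) (s : Fin N → ℝ) (z v : Phase N) :
    fderiv ℝ (fun z : Phase N => genFun w s z.1 z.2) z v
      = ∑ j, (v.1 j * genGradP w s z.1 z.2 j + v.2 j * genGradQ w s z.1 z.2 j) := by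
  refine lineDeriv_of_hasFDerivAt (differentiable_genFun w s z) ?_
  have := isCurveDerivation_hasDerivAt.genFun w s (p := fun t => (z + t • v).1)
    (q := fun t => (z + t • v).2) (fun j => (hasDerivAt_line z v j).1)
    (fun j => (hasDerivAt_line z v j).2)
  simpa using this

/-- Here `s_j = x / (x - λ_j)`, so `x Q_x(u, v)` is the weighted sum of the products `u_j v_j`. -/
theorem genFun_eq_det {lam : Fin N → ℝ} {x : ℝ} (hx : x ≠ 0) (hlam : ∀ j, x ≠ lam j)
    (z : Phase N) :
    x * (laxMatrix lam x z).det = genFun x⁻¹ (fun j => (1 - lam j * x⁻¹)⁻¹) z.1 z.2 := by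
  have h : ∀ u v : Fin N → ℝ, wsum (fun j => (1 - lam j * x⁻¹)⁻¹) (u * v)
      = x * resolventForm lam x u v := by
    intro u v
    rw [wsum, resolventForm, Finset.mul_sum]
    refine Finset.sum_congr rfl fun j _ => ?_
    have h1 : x - lam j ≠ 0 := sub_ne_zero.2 (hlam j)
    have h2 : 1 - lam j * x⁻¹ = (x - lam j) / x := by field_simp
    rw [h2, inv_div, Pi.mul_apply]
    ring
  rw [genFun, h, h, h, laxMatrix, Matrix.det_fin_two_of]
  field_simp
  ring

theorem generatingHamiltonian_eq {lam : Fin N → ℝ} {x : ℝ} (hx : x ≠ 0) (hlam : ∀ j, x ≠ lam j) :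
    generatingHamiltonian lam x
      = fun z => 1 - √(genFun x⁻¹ (fun j => (1 - lam j * x⁻¹)⁻¹) z.1 z.2) := by
  funext z
  rw [generatingHamiltonian, genFun_eq_det hx hlam]

/-- The vector field of `1 - √f`, where `f` is a generating function, at a point with `f > 0`. -/
theorem dirac_one_sub_sqrt {w : ℝ} {s : Fin N → ℝ} {z : Phase N} (hz : z ∈ tangentSphere N)
    (hpos : 0 < genFun w s z.1 z.2) (i : Fin N) :
    (-2 * √(genFun w s z.1 z.2) * dirac (fun y => y.1 i) (fun z => 1 - √(genFun w s z.1 z.2)) z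
      = diracP z.1 (genGradQ w s z.1 z.2) i) ∧
    (-2 * √(genFun w s z.1 z.2) * dirac (fun y => y.2 i) (fun z => 1 - √(genFun w s z.1 z.2)) z
      = diracQ z.1 z.2 (genGradP w s z.1 z.2) (genGradQ w s z.1 z.2) i) := by
  have hd : HasFDerivAt (fun z : Phase N => 1 - √(genFun w s z.1 z.2)) _ z :=
    (((differentiable_genFun w s z).hasFDerivAt).sqrt hpos.ne').const_sub 1
  set r := √(genFun w s z.1 z.2) with hr
  have hr0 : r ≠ 0 := (Real.sqrt_pos.2 hpos).ne'
  have h1 : ∀ j, genGradP w s z.1 z.2 j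
      = -2 * r * partialP (fun z : Phase N => 1 - √(genFun w s z.1 z.2)) z j := by
    intro j
    rw [partialP, hd.fderiv]
    simp only [_root_.neg_apply, _root_.smul_apply, fderiv_genFun, smul_eq_mul]
    simp [Pi.single_apply]
    field_simp
  have h2 : ∀ j, genGradQ w s z.1 z.2 j
      = -2 * r * partialQ (fun z : Phase N => 1 - √(genFun w s z.1 z.2)) z j := by
    intro j
    rw [partialQ, hd.fderiv]
    simp only [_root_.neg_apply, _root_.smul_apply, fderiv_genFun, smul_eq_mul]
    simp [Pi.single_apply]
    field_simp
  rw [dirac_coordP hz, dirac_coordQ hz, funext h1, funext h2, diracP_const_mul, diracQ_const_mul]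
  exact ⟨rfl, rfl⟩

/-- At a point with `f ≤ 0`, the vector field of `1 - √f` is zero. -/
theorem dirac_one_sub_sqrt_of_nonpos {w : ℝ} {s : Fin N → ℝ} {z : Phase N}
    (hz : z ∈ tangentSphere N) (hneg : genFun w s z.1 z.2 ≤ 0) (i : Fin N) :
    dirac (fun y => y.1 i) (fun z => 1 - √(genFun w s z.1 z.2)) z = 0 ∧
    dirac (fun y => y.2 i) (fun z => 1 - √(genFun w s z.1 z.2)) z = 0 := by
  -- Here `√f = 0`, so `1 - √f` attains its maximum. Its `fderiv` is then zero, also where the root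
  -- is not differentiable, since zero is the default value.
  have hmax : IsLocalMax (fun z : Phase N => 1 - √(genFun w s z.1 z.2)) z := by
    refine Eventually.of_forall fun y => ?_
    simp only [Real.sqrt_eq_zero_of_nonpos hneg]
    linarith [Real.sqrt_nonneg (genFun w s y.1 y.2)]
  have h0 := hmax.fderiv_eq_zero
  have h1 : ∀ j, partialP (fun z : Phase N => 1 - √(genFun w s z.1 z.2)) z j = 0 := fun j => by
    rw [partialP, h0]; rfl
  have h2 : ∀ j, partialQ (fun z : Phase N => 1 - √(genFun w s z.1 z.2)) z j = 0 := fun j => by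
    rw [partialQ, h0]; rfl
  rw [dirac_coordP hz, dirac_coordQ hz, diracP, diracQ]
  simp [h1, h2]

end RealFlow

/-! ### The formal flow: generating series of the integrals and Hamiltonians. -/

section FormalFlow

variable {N : ℕ}

/-- The power series `1 / (1 - λ_j w)`. -/
def formalWeight (lam : Fin N → ℝ) (j : Fin N) : PowerSeries ℝ := PowerSeries.mk fun k => lam j ^ k

theorem formalWeight_mul (lam : Fin N → ℝ) (j : Fin N) :
    formalWeight lam j * (1 - PowerSeries.C (lam j) * PowerSeries.X) = 1 := by
  ext k
  rw [mul_sub, mul_one, ← mul_assoc, map_sub]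
  cases k with
  | zero => simp [formalWeight]
  | succ k =>
    rw [PowerSeries.coeff_succ_mul_X, PowerSeries.coeff_mul_C]
    simp [formalWeight, PowerSeries.coeff_one, pow_succ]

/-- A real vector as a vector of constant power series. -/
def constVec (u : Fin N → ℝ) (j : Fin N) : PowerSeries ℝ := PowerSeries.C (u j)

theorem coeff_wsum_formalWeight (lam u v : Fin N → ℝ) (k : ℕ) :
    PowerSeries.coeff k (wsum (formalWeight lam) (constVec u * constVec v)) = moment lam k u v := by
  rw [wsum, map_sum, moment]
  refine Finset.sum_congr rfl fun j _ => ?_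
  rw [Pi.mul_apply, constVec, constVec, ← map_mul, PowerSeries.coeff_C_mul, formalWeight,
    PowerSeries.coeff_mk]
  ring

/-- The generating series of the integrals of motion. -/
def formalGen (lam : Fin N → ℝ) (z : Phase N) : PowerSeries ℝ :=
  genFun PowerSeries.X (formalWeight lam) (constVec z.1) (constVec z.2)

/-- The coefficient of `⟨p, p⟩ - 1` in the difference between `F_k` and the generating series. -/
def corrG (lam : Fin N → ℝ) (z : Phase N) : PowerSeries ℝ :=
  -1 - PowerSeries.C (moment lam 0 z.2 z.2) * PowerSeries.X
    - PowerSeries.C (moment lam 1 z.2 z.2) * PowerSeries.X ^ 2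

/-- The coefficient of `⟨p, q⟩` in the difference between `F_k` and the generating series. -/
def corrF (lam : Fin N → ℝ) (z : Phase N) : PowerSeries ℝ :=
  PowerSeries.C (moment lam 0 z.1 z.2) * PowerSeries.X
    + PowerSeries.C (2 * moment lam 1 z.1 z.2) * PowerSeries.X ^ 2

theorem coeff_formalGen_zero (lam : Fin N → ℝ) (z : Phase N) :
    PowerSeries.coeff 0 (formalGen lam z) = moment lam 0 z.1 z.1 := by
  rw [formalGen, genFun, map_add, PowerSeries.coeff_zero_X_mul, add_zero, coeff_wsum_formalWeight]

theorem coeff_formalGen_succ (lam : Fin N → ℝ) (z : Phase N) (k : ℕ) :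
    PowerSeries.coeff (k + 1) (formalGen lam z) = moment lam (k + 1) z.1 z.1
      + ∑ j ∈ Finset.range (k + 1), (moment lam j z.1 z.1 * moment lam (k - j) z.2 z.2
        - moment lam (k - j) z.1 z.2 * moment lam j z.1 z.2) := by
  rw [formalGen, genFun, map_add, PowerSeries.coeff_succ_X_mul, coeff_wsum_formalWeight, map_sub,
    sq, PowerSeries.coeff_mul, PowerSeries.coeff_mul, ← Finset.sum_sub_distrib]
  simp only [coeff_wsum_formalWeight]
  rw [Finset.Nat.sum_antidiagonal_eq_sum_range_succ (fun a b => moment lam a z.1 z.1 *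
    moment lam b z.2 z.2 - moment lam a z.1 z.2 * moment lam b z.1 z.2)]
  congr 1
  refine Finset.sum_congr rfl fun j _ => by ring

/-- The generating series of the `F_k`, on the whole phase space. -/
theorem mk_forwardIntegral (lam : Fin N → ℝ) (z : Phase N) :
    PowerSeries.mk (fun k => forwardIntegral lam k z) = formalGen lam z
      + PowerSeries.C (constraintG z) * corrG lam z + PowerSeries.C (constraintF z) * corrF lam z := by
  have hG : constraintG z = moment lam 0 z.1 z.1 - 1 := by
    simp [constraintG, moment, dotProduct]
  have hF : constraintF z = moment lam 0 z.1 z.2 := by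
    simp [constraintF, moment, dotProduct]
  ext k
  rw [PowerSeries.coeff_mk, map_add, map_add, PowerSeries.coeff_C_mul, PowerSeries.coeff_C_mul, hG,
    hF]
  -- The formulas for `F_0`, `F_1`, `F_2` are simplified by `⟨p, p⟩ = 1` and `⟨p, q⟩ = 0`. So
  -- corrections occur only up to `w²`, and from index three on the coefficients agree exactly.
  match k with
  | 0 =>
    rw [coeff_formalGen_zero]
    simp [forwardIntegral, corrG, corrF]
  | 1 =>
    rw [coeff_formalGen_succ]
    simp [forwardIntegral, corrG, corrF, PowerSeries.coeff_one, PowerSeries.coeff_X_pow,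
      PowerSeries.coeff_C_mul, -map_mul]
    ring
  | 2 =>
    rw [coeff_formalGen_succ]
    simp [forwardIntegral, corrG, corrF, PowerSeries.coeff_one, PowerSeries.coeff_X_pow,
      PowerSeries.coeff_C_mul, Finset.sum_range_succ, -map_mul]
    ring
  | k + 3 =>
    rw [coeff_formalGen_succ]
    simp [forwardIntegral, corrG, corrF, PowerSeries.coeff_one, PowerSeries.coeff_X_pow,
      PowerSeries.coeff_C_mul, -map_mul]

/-- The generating series of the Hamiltonians. -/
def hamSeries (lam : Fin N → ℝ) (z : Phase N) : PowerSeries ℝ :=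
  PowerSeries.mk fun k => hamiltonian lam k z

/-- The recursion for `H_k` is the coefficient of `w^k` in this identity, solved for the linear
term. -/
theorem sq_one_sub_hamSeries (lam : Fin N → ℝ) (z : Phase N) :
    (1 - hamSeries lam z) * (1 - hamSeries lam z)
      = PowerSeries.mk fun k => forwardIntegral lam k z := by
  have h1 : (1 - hamSeries lam z) * (1 - hamSeries lam z)
      = 1 - hamSeries lam z - hamSeries lam z + hamSeries lam z * hamSeries lam z := by ring
  rw [h1]
  ext k
  rw [map_add, map_sub, map_sub, PowerSeries.coeff_mul, PowerSeries.coeff_mk]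
  simp only [hamSeries, PowerSeries.coeff_mk, PowerSeries.coeff_one]
  rw [Finset.Nat.sum_antidiagonal_eq_sum_range_succ
    (fun a b => hamiltonian lam a z * hamiltonian lam b z)]
  cases k with
  | zero => simp [hamiltonian_zero, forwardIntegral]
  | succ k =>
    have := hamiltonian_succ lam k z
    simp only [Nat.succ_eq_add_one, Nat.add_eq_zero_iff, one_ne_zero, and_false, if_false]
    linarith

theorem differentiable_moment (lam : Fin N → ℝ) (k : ℕ) :
    (Differentiable ℝ fun z : Phase N => moment lam k z.1 z.1) ∧
    (Differentiable ℝ fun z : Phase N => moment lam k z.1 z.2) ∧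
    (Differentiable ℝ fun z : Phase N => moment lam k z.2 z.2) := by
  unfold moment
  refine ⟨?_, ?_, ?_⟩ <;> fun_prop

theorem differentiable_forwardIntegral (lam : Fin N → ℝ) (k : ℕ) :
    Differentiable ℝ (forwardIntegral lam k) := by
  have hpp := fun k => (differentiable_moment lam k).1
  have hpq := fun k => (differentiable_moment lam k).2.1
  have hqq := fun k => (differentiable_moment lam k).2.2
  match k with
  | 0 => exact differentiable_const 1
  | 1 => exact (hpp 1).add (hqq 0)
  | 2 => exact ((hpp 2).add ((hpp 1).mul (hqq 0))).add (hqq 1)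
  | k + 3 =>
    exact (hpp (k + 3)).add (Differentiable.fun_sum fun j _ =>
      ((hpp j).mul (hqq (k + 2 - j))).sub ((hpq (k + 2 - j)).mul (hpq j)))

theorem differentiable_hamiltonian (lam : Fin N → ℝ) (k : ℕ) :
    Differentiable ℝ (hamiltonian lam k) := by
  induction k using Nat.strong_induction_on with
  | _ k ih =>
    match k with
    | 0 =>
      have : hamiltonian (N := N) lam 0 = fun _ => 0 := funext (hamiltonian_zero lam)
      rw [this]
      exact differentiable_const 0
    | k + 1 =>
      have : hamiltonian lam (k + 1) = fun z => -(1 / 2) * forwardIntegral lam (k + 1) z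
          + 1 / 2 * ∑ j : Fin k, hamiltonian lam (j + 1) z * hamiltonian lam (k - j) z := by
        funext z
        rw [hamiltonian]
      rw [this]
      refine ((differentiable_forwardIntegral lam (k + 1)).const_mul _).add
        (Differentiable.const_mul (Differentiable.fun_sum fun j _ => ?_) _)
      exact (ih (j + 1) (by omega)).mul (ih (k - j) (by omega))

theorem HasFormalDeriv.unique {f : ℝ → PowerSeries ℝ} {a b : PowerSeries ℝ}
    (ha : HasFormalDeriv f a) (hb : HasFormalDeriv f b) : a = b :=
  PowerSeries.ext fun k => (ha k).unique (hb k)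

theorem HasFormalDeriv.C {f : ℝ → ℝ} {f' : ℝ} (h : HasDerivAt f f' 0) :
    HasFormalDeriv (fun t => PowerSeries.C (f t)) (PowerSeries.C f') := by
  intro k
  simp only [PowerSeries.coeff_C]
  split_ifs
  · exact h
  · exact hasDerivAt_const _ _

theorem HasDerivAt.of_differentiable_line {f : Phase N → ℝ} (hf : Differentiable ℝ f)
    (z v : Phase N) : HasDerivAt (fun t : ℝ => f (z + t • v)) (fderiv ℝ f z v) 0 := by
  have := (hf z).lineDifferentiableAt (v := v)
  have h2 := this.hasLineDerivAt
  rw [(hf z).lineDeriv_eq_fderiv] at h2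
  exact h2

/-- The derivatives of the Hamiltonians in a fixed direction, in terms of those of the generating
function. -/
theorem hamSeries_deriv {lam : Fin N → ℝ} {z : Phase N} (hz : z ∈ tangentSphere N) (v : Phase N) :
    -2 * (1 - hamSeries lam z) * (PowerSeries.mk fun k => fderiv ℝ (hamiltonian lam k) z v)
      = ∑ j, (PowerSeries.C (v.1 j) * genGradP PowerSeries.X (formalWeight lam) (constVec z.1)
            (constVec z.2) j
          + PowerSeries.C (v.2 j) * genGradQ PowerSeries.X (formalWeight lam) (constVec z.1)
            (constVec z.2) j)
        + PowerSeries.C (fderiv ℝ constraintG z v) * corrG lam z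
        + PowerSeries.C (fderiv ℝ constraintF z v) * corrF lam z := by
  have hD := isCurveDerivation_hasFormalDeriv
  have h1 : HasFormalDeriv (fun t => hamSeries lam (z + t • v))
      (PowerSeries.mk fun k => fderiv ℝ (hamiltonian lam k) z v) := by
    intro k
    simp only [hamSeries, PowerSeries.coeff_mk]
    exact HasDerivAt.of_differentiable_line (differentiable_hamiltonian lam k) z v
  have h2 := hD.add (hD.const 1) (hD.const_mul (-1) h1)
  have h3 := hD.mul h2 h2
  have hm := fun k => differentiable_moment lam k
  have hline := fun (f : Phase N → ℝ) (hf : Differentiable ℝ f) =>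
    HasFormalDeriv.C (HasDerivAt.of_differentiable_line hf z v)
  -- Existence suffices here and for `corrF`: the product rule multiplies these derivatives by
  -- constraints that vanish at `z`.
  have hcG : ∃ c, HasFormalDeriv (fun t => corrG lam (z + t • v)) c := by
    have := hD.add (hD.const (-1))
      (hD.add (hD.const_mul (-PowerSeries.X) (hline _ (hm 0).2.2))
        (hD.const_mul (-PowerSeries.X ^ 2) (hline _ (hm 1).2.2)))
    refine ⟨_, Eq.mp (congrArg₂ _ ?_ rfl) this⟩
    funext t
    rw [corrG]; ring
  have hcF : ∃ c, HasFormalDeriv (fun t => corrF lam (z + t • v)) c := by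
    have := hD.add (hD.const_mul PowerSeries.X (hline _ (hm 0).2.1))
        (hD.const_mul (PowerSeries.X ^ 2) (hline _ ((hm 1).2.1.const_mul 2)))
    refine ⟨_, Eq.mp (congrArg₂ _ ?_ rfl) this⟩
    funext t
    rw [corrF]; ring
  obtain ⟨cG, hcG⟩ := hcG
  obtain ⟨cF, hcF⟩ := hcF
  have h4 : HasFormalDeriv (fun t => formalGen lam (z + t • v)) _ :=
    hD.genFun PowerSeries.X (formalWeight lam) (p := fun t => constVec (z + t • v).1)
      (q := fun t => constVec (z + t • v).2) (fun j => HasFormalDeriv.C (hasDerivAt_line z v j).1)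
      (fun j => HasFormalDeriv.C (hasDerivAt_line z v j).2)
  have h5 := hD.add (hD.add h4 (hD.mul (hline _ differentiable_constraintG) hcG))
    (hD.mul (hline _ differentiable_constraintF) hcF)
  have h6 : (fun t : ℝ => formalGen lam (z + t • v)
        + PowerSeries.C (constraintG (z + t • v)) * corrG lam (z + t • v)
        + PowerSeries.C (constraintF (z + t • v)) * corrF lam (z + t • v))
      = fun t : ℝ => (1 + -1 * hamSeries lam (z + t • v)) * (1 + -1 * hamSeries lam (z + t • v)) := by
    funext t
    rw [← mk_forwardIntegral, ← sq_one_sub_hamSeries]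
    ring
  rw [h6] at h5
  have h7 := h3.unique h5
  simp only [zero_smul, add_zero, hz.1, hz.2, map_zero, zero_mul] at h7
  rw [← h7]
  ring

/-- The generating series of the Dirac vector fields of the Hamiltonians. -/
theorem formal_flow {lam : Fin N → ℝ} {z : Phase N} (hz : z ∈ tangentSphere N) (i : Fin N) :
    (-2 * (1 - hamSeries lam z) * (PowerSeries.mk fun k => dirac (fun y => y.1 i) (hamiltonian lam k) z)
      = diracP (constVec z.1) (genGradQ PowerSeries.X (formalWeight lam) (constVec z.1)
            (constVec z.2)) i) ∧
    (-2 * (1 - hamSeries lam z) * (PowerSeries.mk fun k => dirac (fun y => y.2 i) (hamiltonian lam k) z)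
      = diracQ (constVec z.1) (constVec z.2)
        (genGradP PowerSeries.X (formalWeight lam) (constVec z.1) (constVec z.2))
        (genGradQ PowerSeries.X (formalWeight lam) (constVec z.1) (constVec z.2)) i) := by
  have hpp : ∑ j, constVec z.1 j * constVec z.1 j = 1 := by
    have := congrArg (PowerSeries.C (R := ℝ)) (sum_sq_of_mem hz)
    simpa [constVec] using this
  have hP : ∀ j, -2 * (1 - hamSeries lam z)
      * (PowerSeries.mk fun k => partialP (hamiltonian lam k) z j)
      = genGradP PowerSeries.X (formalWeight lam) (constVec z.1) (constVec z.2) j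
        + (corrG lam z * (2 * constVec z.1 j) + corrF lam z * constVec z.2 j) := by
    intro j
    have := hamSeries_deriv (lam := lam) hz (Pi.single j 1, 0)
    have hG := partialP_constraintG z j
    have hF := partialP_constraintF z j
    rw [partialP] at hG hF
    rw [hG, hF] at this
    simp only [partialP]
    rw [this]
    have h2 : PowerSeries.C (R := ℝ) 2 = 2 := map_ofNat _ 2
    simp [Pi.single_apply, constVec, apply_ite (PowerSeries.C (R := ℝ)), ite_mul, h2]
    ring
  have hQ : ∀ j, -2 * (1 - hamSeries lam z)
      * (PowerSeries.mk fun k => partialQ (hamiltonian lam k) z j)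
      = genGradQ PowerSeries.X (formalWeight lam) (constVec z.1) (constVec z.2) j
        + corrF lam z * constVec z.1 j := by
    intro j
    have := hamSeries_deriv (lam := lam) hz (0, Pi.single j 1)
    have hG := partialQ_constraintG z j
    have hF := partialQ_constraintF z j
    rw [partialQ] at hG hF
    rw [hG, hF] at this
    simp only [partialQ]
    rw [this]
    simp [Pi.single_apply, constVec, apply_ite (PowerSeries.C (R := ℝ)), ite_mul]
    ring
  constructor
  -- The gradient of `genFun` and `-2u` times that of the series differ by multiples of the
  -- differentials of the constraints, which the Dirac field does not see.
  · rw [← diracP_add_constraints hpp _ (corrF lam z), ← funext hQ, diracP_const_mul]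
    congr 1
    ext k
    simp [dirac_coordP hz, diracP, constVec, PowerSeries.coeff_C_mul]
  · rw [← diracQ_add_constraints hpp _ _ _ (corrG lam z) (corrF lam z), ← funext hQ, ← funext hP,
      diracQ_const_mul]
    congr 1
    ext k
    simp [dirac_coordQ hz, diracQ, constVec, PowerSeries.coeff_C_mul]

theorem sq_one_sub_hamSeries_of_mem {lam : Fin N → ℝ} {z : Phase N} (hz : z ∈ tangentSphere N) :
    (1 - hamSeries lam z) ^ 2 = formalGen lam z := by
  rw [sq, sq_one_sub_hamSeries, mk_forwardIntegral, hz.1, hz.2]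
  simp

theorem isUnit_one_sub_hamSeries (lam : Fin N → ℝ) (z : Phase N) :
    IsUnit (1 - hamSeries lam z) := by
  rw [PowerSeries.isUnit_iff_constantCoeff]
  have : PowerSeries.constantCoeff (hamSeries lam z) = 0 := by
    rw [← PowerSeries.coeff_zero_eq_constantCoeff_apply, hamSeries, PowerSeries.coeff_mk,
      hamiltonian_zero]
  rw [map_sub, map_one, this, sub_zero]
  exact isUnit_one

end FormalFlow

/-! ### The spectral polynomial and the level set. -/

section SpectralPolynomial

variable {N : ℕ}

/-- `-a V²¹`, where `a = ∏ (X - λ_j)`. -/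
def lPoly (lam : Fin N → ℝ) (z : Phase N) : ℝ[X] :=
  ∏ j, (X - C (lam j)) + numerator lam fun j => z.2 j * z.2 j

/-- `a² det V`. -/
def spectralPoly (lam : Fin N → ℝ) (z : Phase N) : ℝ[X] :=
  mPoly lam z * lPoly lam z - nPoly lam z ^ 2

theorem eval_numerator_eq (lam c : Fin N → ℝ) (y : ℝ) :
    (numerator lam c).eval y = numValue lam y c := by
  simp [numerator, numValue, eval_finsetSum, eval_prod]

theorem eval_mPoly_eq (lam : Fin N → ℝ) (z : Phase N) (y : ℝ) :
    (mPoly lam z).eval y = numValue lam y (z.1 * z.1) := eval_numerator_eq _ _ _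

theorem eval_nPoly_eq (lam : Fin N → ℝ) (z : Phase N) (y : ℝ) :
    (nPoly lam z).eval y = -numValue lam y (z.1 * z.2) := by
  rw [nPoly, eval_numerator_eq]
  simp [numValue]

theorem eval_lPoly_eq (lam : Fin N → ℝ) (z : Phase N) (y : ℝ) :
    (lPoly lam z).eval y = ∏ j, (y - lam j) + numValue lam y (z.2 * z.2) := by
  rw [lPoly, eval_add, eval_numerator_eq]
  simp [eval_prod]
  rfl

theorem eval_spectralPoly_eq (lam : Fin N → ℝ) (z : Phase N) {x : ℝ} (hx : ∀ j, x ≠ lam j) :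
    (spectralPoly lam z).eval x = (∏ j, (x - lam j)) ^ 2 * (laxMatrix lam x z).det := by
  have h : (lPoly lam z).eval x = -((∏ j, (x - lam j)) * laxMatrix lam x z 1 0) := by
    rw [lPoly, eval_add, eval_numerator lam _ x hx]
    simp [eval_prod, laxMatrix, resolventForm]
    ring
  rw [spectralPoly, eval_sub, eval_mul, eval_pow, eval_mPoly lam z x hx, eval_nPoly lam z x hx, h,
    Matrix.det_fin_two]
  simp [laxMatrix]
  ring

theorem eq_of_eval_ofReal {S : Set ℝ} (hS : S.Infinite) {f h : ℂ[X]}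
    (H : ∀ x ∈ S, f.eval (x : ℂ) = h.eval (x : ℂ)) : f = h := by
  refine eq_of_infinite_eval_eq f h
    ((hS.image Complex.ofReal_injective.injOn).mono ?_)
  rintro _ ⟨x, hx, rfl⟩
  exact H x hx

theorem eval_map_ofReal (f : ℝ[X]) (x : ℝ) :
    (f.map (algebraMap ℝ ℂ)).eval (x : ℂ) = ((f.eval x : ℝ) : ℂ) := by
  rw [show (x : ℂ) = algebraMap ℝ ℂ x from rfl, eval_map_apply]
  rfl

theorem prod_branchPoint {g : ℕ} {M : Type*} [CommMonoid M] (lam : Fin (g + 1) → ℝ)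
    (ν : Fin g → ℂ) (f : ℂ → M) :
    ∏ i, f (branchPoint lam ν i) = (∏ j, f (lam j)) * ∏ k, f (ν k) := by
  rw [Fintype.prod_sum_type]
  rfl

/-- On the level set, `a² det V` is the polynomial of the spectral curve. -/
theorem OnLevelSet.map_spectralPoly {g : ℕ} {lam : Fin (g + 1) → ℝ} {ν : Fin g → ℂ}
    {z : Phase (g + 1)} (h : OnLevelSet lam ν z) :
    (spectralPoly lam z).map (algebraMap ℝ ℂ) = curvePoly (branchPoint lam ν) := by
  refine eq_of_eval_ofReal (S := (Set.range lam)ᶜ) (Set.finite_range lam).infinite_compl ?_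
  intro x hx
  have hx' : ∀ j, x ≠ lam j := fun j hj => hx ⟨j, hj.symm⟩
  rw [eval_map_ofReal, eval_spectralPoly_eq lam z hx', eval_curvePoly,
    prod_branchPoint lam ν fun e => (x : ℂ) - e]
  push_cast
  rw [h x hx']
  have hne : ∏ j, ((x : ℂ) - lam j) ≠ 0 := Finset.prod_ne_zero_iff.2 fun j _ => by
    rw [sub_ne_zero]
    exact_mod_cast hx' j
  field_simp

/-- The reversed polynomial of `spectralPoly`. -/
def revSpectralPoly (lam : Fin N → ℝ) (z : Phase N) : ℝ[X] :=
  revNumerator lam (z.1 * z.1) * (∏ j, (1 - C (lam j) * X) + X * revNumerator lam (z.2 * z.2))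
    - X * revNumerator lam (z.1 * z.2) ^ 2

theorem eval_revSpectralPoly_inv {g : ℕ} (lam : Fin (g + 1) → ℝ) (z : Phase (g + 1)) {x : ℝ}
    (hx : x ≠ 0) :
    x ^ (2 * g + 1) * (revSpectralPoly lam z).eval x⁻¹ = (spectralPoly lam z).eval x := by
  have h0 := eval_revNumerator_inv lam (z.1 * z.1) hx
  have h1 := eval_revNumerator_inv lam (z.2 * z.2) hx
  have h2 := eval_revNumerator_inv lam (z.1 * z.2) hx
  rw [eval_numerator_eq] at h0 h1 h2
  have h3 : x ^ (g + 1) * ∏ j, (1 - lam j * x⁻¹) = ∏ j, (x - lam j) := by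
    have : x ^ (g + 1) = ∏ j : Fin (g + 1), x := by simp
    rw [this, ← Finset.prod_mul_distrib]
    exact Finset.prod_congr rfl fun j _ => by field_simp
  rw [spectralPoly, eval_sub, eval_mul, eval_pow, eval_mPoly_eq, eval_nPoly_eq, eval_lPoly_eq, ← h0,
    ← h1, ← h2, ← h3, revSpectralPoly]
  simp only [eval_sub, eval_mul, eval_add, eval_prod, eval_one, eval_C, eval_X, eval_pow]
  field_simp
  ring

/-- The exponent `2g + 1` of the reversal is the number of branch points, so each factor `X - e_i`
becomes `1 - e_i X`. -/
theorem map_revSpectralPoly {g : ℕ} {lam : Fin (g + 1) → ℝ} {ν : Fin g → ℂ} {z : Phase (g + 1)}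
    (h : (spectralPoly lam z).map (algebraMap ℝ ℂ) = curvePoly (branchPoint lam ν)) :
    (revSpectralPoly lam z).map (algebraMap ℝ ℂ) = ∏ i, (1 - C (branchPoint lam ν i) * X) := by
  refine eq_of_eval_ofReal (S := {0}ᶜ) (Set.finite_singleton (0 : ℝ)).infinite_compl ?_
  intro y hy
  have hy0 : y ≠ 0 := hy
  have hx : y⁻¹ ≠ 0 := inv_ne_zero hy0
  have hyC : (y : ℂ) ≠ 0 := by exact_mod_cast hy0
  have h1 := eval_revSpectralPoly_inv lam z hx
  rw [inv_inv] at h1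
  have h2 := congrArg (Polynomial.eval ((y⁻¹ : ℝ) : ℂ)) h
  rw [eval_map_ofReal, ← h1, eval_curvePoly] at h2
  rw [eval_map_ofReal]
  simp only [eval_prod, eval_sub, eval_one, eval_mul, eval_C, eval_X]
  have h3 : ((y⁻¹ : ℝ) : ℂ) ^ (2 * g + 1) = ∏ i : Fin (g + 1) ⊕ Fin g, ((y⁻¹ : ℝ) : ℂ) := by
    simp; ring
  push_cast at h2 h3
  rw [h3] at h2
  refine mul_left_cancel₀ (Finset.prod_ne_zero_iff.2 fun _ _ => inv_ne_zero hyC) (h2.trans ?_)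
  rw [← Finset.prod_mul_distrib]
  refine Finset.prod_congr rfl fun i _ => ?_
  field_simp

theorem wsum_mul_prod {A : Type*} [CommRing A] [Algebra ℝ A] {lam : Fin N → ℝ} {w : A}
    {s : Fin N → A} (hs : ∀ j, s j * (1 - algebraMap ℝ A (lam j) * w) = 1) (c : Fin N → ℝ) :
    wsum s (fun j => algebraMap ℝ A (c j)) * ∏ j, (1 - algebraMap ℝ A (lam j) * w)
      = aeval w (revNumerator lam c) := by
  simp only [wsum, revNumerator, map_sum, map_mul, map_prod, map_sub, map_one, aeval_C, aeval_X,
    Finset.sum_mul]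
  refine Finset.sum_congr rfl fun j _ => ?_
  rw [← Finset.mul_prod_erase Finset.univ (fun l => 1 - algebraMap ℝ A (lam l) * w)
    (Finset.mem_univ j)]
  linear_combination (algebraMap ℝ A (c j) * ∏ l ∈ Finset.univ.erase j,
    (1 - algebraMap ℝ A (lam l) * w)) * hs j

/-- Clears the denominators `1 - λ_j w`. The algebra `A` is arbitrary, so that `w` may be a number
or the formal variable. -/
theorem genFun_mul_prod_sq {A : Type*} [CommRing A] [Algebra ℝ A] {lam : Fin N → ℝ} {w : A}
    {s : Fin N → A} (hs : ∀ j, s j * (1 - algebraMap ℝ A (lam j) * w) = 1) (z : Phase N) :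
    genFun w s (fun j => algebraMap ℝ A (z.1 j)) (fun j => algebraMap ℝ A (z.2 j))
        * (∏ j, (1 - algebraMap ℝ A (lam j) * w)) ^ 2 = aeval w (revSpectralPoly lam z) := by
  have h : ∀ u v : Fin N → ℝ, wsum s ((fun j => algebraMap ℝ A (u j)) * fun j => algebraMap ℝ A (v j))
      * ∏ j, (1 - algebraMap ℝ A (lam j) * w) = aeval w (revNumerator lam (u * v)) := by
    intro u v
    rw [← wsum_mul_prod hs]
    congr 2
    funext j
    simp
  rw [revSpectralPoly]
  simp only [map_sub, map_mul, map_add, map_prod, map_one, aeval_C, aeval_X, map_pow]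
  rw [← h, ← h, ← h, genFun]
  ring

end SpectralPolynomial

/-! ### Algebraic flows: conservation law and motion of the elliptic variables. -/

section AlgebraicFlow

variable {N : ℕ}

/-- A velocity vector `v` at the point `z` of the phase space which is the image, under a linear
functional, of the vector field of `1 - u`, where `u` is a square root of the generating function. -/
structure GenFlow (lam : Fin N → ℝ) (z v : Phase N) (A : Type*) [CommRing A] [Algebra ℝ A] where
  w : A
  s : Fin N → A
  u : A
  P : Fin N → A
  Q : Fin N → A
  L : A →ₗ[ℝ] ℝ
  weight : ∀ j, s j * (1 - algebraMap ℝ A (lam j) * w) = 1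
  fieldP : ∀ i, -2 * u * P i = diracP (fun j => algebraMap ℝ A (z.1 j))
    (genGradQ w s (fun j => algebraMap ℝ A (z.1 j)) (fun j => algebraMap ℝ A (z.2 j))) i
  fieldQ : ∀ i, -2 * u * Q i = diracQ (fun j => algebraMap ℝ A (z.1 j))
    (fun j => algebraMap ℝ A (z.2 j))
    (genGradP w s (fun j => algebraMap ℝ A (z.1 j)) (fun j => algebraMap ℝ A (z.2 j)))
    (genGradQ w s (fun j => algebraMap ℝ A (z.1 j)) (fun j => algebraMap ℝ A (z.2 j))) i
  isUnit : IsUnit u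
  sq : u ^ 2 = genFun w s (fun j => algebraMap ℝ A (z.1 j)) (fun j => algebraMap ℝ A (z.2 j))
  imageP : ∀ i, L (P i) = v.1 i
  imageQ : ∀ i, L (Q i) = v.2 i

variable {lam : Fin N → ℝ} {z v : Phase N} {A : Type*} [CommRing A] [Algebra ℝ A]

theorem map_algebraMap_mul (L : A →ₗ[ℝ] ℝ) (c : ℝ) (a : A) : L (algebraMap ℝ A c * a) = c * L a := by
  rw [← Algebra.smul_def, map_smul, smul_eq_mul]

theorem algebraMap_numValue (y : ℝ) (c : Fin N → ℝ) :
    numValue (fun j => algebraMap ℝ A (lam j)) (algebraMap ℝ A y) (fun j => algebraMap ℝ A (c j))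
      = algebraMap ℝ A (numValue lam y c) := by
  simp [numValue]

theorem algebraMap_numValue_mul (y : ℝ) (c d : Fin N → ℝ) :
    numValue (fun j => algebraMap ℝ A (lam j)) (algebraMap ℝ A y)
      ((fun j => algebraMap ℝ A (c j)) * fun j => algebraMap ℝ A (d j))
      = algebraMap ℝ A (numValue lam y (c * d)) := by
  rw [← algebraMap_numValue]
  congr 1
  funext j
  simp

theorem map_numValue (L : A →ₗ[ℝ] ℝ) (y : ℝ) (c : Fin N → ℝ) (a : Fin N → A) :
    L (numValue (fun j => algebraMap ℝ A (lam j)) (algebraMap ℝ A y)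
      (fun j => algebraMap ℝ A (c j) * a j)) = numValue lam y (fun j => c j * L (a j)) := by
  simp only [numValue, map_sum, ← map_sub, ← map_prod]
  refine Finset.sum_congr rfl fun j _ => ?_
  rw [mul_assoc, mul_comm (a j), ← mul_assoc, ← map_mul, map_algebraMap_mul]
  ring

/-- The variation of the value of `m` at `y`. -/
def varM (lam : Fin N → ℝ) (z v : Phase N) (y : ℝ) : ℝ :=
  numValue lam y fun j => 2 * z.1 j * v.1 j

/-- The variation of the value of `n` at `y`. -/
def varN (lam : Fin N → ℝ) (z v : Phase N) (y : ℝ) : ℝ :=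
  -numValue lam y fun j => v.1 j * z.2 j + z.1 j * v.2 j

/-- The variation of the value of `l` at `y`. -/
def varL (lam : Fin N → ℝ) (z v : Phase N) (y : ℝ) : ℝ :=
  numValue lam y fun j => 2 * z.2 j * v.2 j

namespace GenFlow

variable (Φ : GenFlow lam z v A)

/-- The vector `p` with coefficients in `A`. -/
abbrev p (_ : GenFlow lam z v A) (j : Fin N) : A := algebraMap ℝ A (z.1 j)

/-- The vector `q` with coefficients in `A`. -/
abbrev q (_ : GenFlow lam z v A) (j : Fin N) : A := algebraMap ℝ A (z.2 j)

theorem fieldP_eq (i : Fin N) : -2 * Φ.u * Φ.P i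
    = 2 * Φ.w * (wsum Φ.s (Φ.p * Φ.q) * Φ.p i - wsum Φ.s (Φ.p * Φ.p) * Φ.q i) * Φ.s i :=
  (Φ.fieldP i).trans (diracP_gen _ _ _ _ _)

theorem fieldQ_eq (i : Fin N) : -2 * Φ.u * Φ.Q i
    = 2 * ((1 + Φ.w * wsum Φ.s (Φ.q * Φ.q)) * Φ.p i - Φ.w * wsum Φ.s (Φ.p * Φ.q) * Φ.q i) * Φ.s i
        - 2 * wsum Φ.s (Φ.p * Φ.p) * Φ.p i :=
  (Φ.fieldQ i).trans (diracQ_gen _ _ _ _ _)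

theorem map_varM (y : ℝ) :
    Φ.L (numValue (fun j => algebraMap ℝ A (lam j)) (algebraMap ℝ A y)
      (fun j => 2 * algebraMap ℝ A (z.1 j) * Φ.P j)) = varM lam z v y := by
  have := map_numValue (lam := lam) Φ.L y (fun j => 2 * z.1 j) Φ.P
  simp only [map_mul, map_ofNat, Φ.imageP] at this
  exact this

theorem map_varL (y : ℝ) :
    Φ.L (numValue (fun j => algebraMap ℝ A (lam j)) (algebraMap ℝ A y)
      (fun j => 2 * algebraMap ℝ A (z.2 j) * Φ.Q j)) = varL lam z v y := by
  have := map_numValue (lam := lam) Φ.L y (fun j => 2 * z.2 j) Φ.Q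
  simp only [map_mul, map_ofNat, Φ.imageQ] at this
  exact this

theorem map_varN (y : ℝ) :
    Φ.L (numValue (fun j => algebraMap ℝ A (lam j)) (algebraMap ℝ A y)
      (fun j => Φ.P j * algebraMap ℝ A (z.2 j) + algebraMap ℝ A (z.1 j) * Φ.Q j))
      = -varN lam z v y := by
  have h1 := map_numValue (lam := lam) Φ.L y z.2 Φ.P
  have h2 := map_numValue (lam := lam) Φ.L y z.1 Φ.Q
  simp only [Φ.imageQ, Φ.imageP] at h1 h2
  have h3 := numValue_lin (fun j => algebraMap ℝ A (lam j)) (algebraMap ℝ A y) 1 1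
    (fun j => algebraMap ℝ A (z.2 j) * Φ.P j) (fun j => algebraMap ℝ A (z.1 j) * Φ.Q j)
  have h4 := numValue_lin lam y 1 1 (fun j => z.2 j * v.1 j) (fun j => z.1 j * v.2 j)
  simp only [one_mul] at h3 h4
  rw [varN, neg_neg]
  simp only [mul_comm (Φ.P _), mul_comm (v.1 _)]
  rw [h3, map_add, h1, h2, h4]

theorem isUnit_neg_two_mul : IsUnit (-2 * Φ.u) := by
  have h2 : IsUnit (algebraMap ℝ A (-2)) := (isUnit_iff_ne_zero.2 (by norm_num)).map _
  simp only [map_neg, map_ofNat] at h2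
  exact h2.mul Φ.isUnit

/-- The spectral polynomial is infinitesimally conserved. -/
theorem spectral_conserved (y : ℝ) (hy : IsUnit (1 - algebraMap ℝ A y * Φ.w)) :
    (mPoly lam z).eval y * varL lam z v y + (lPoly lam z).eval y * varM lam z v y
      - 2 * (nPoly lam z).eval y * varN lam z v y = 0 := by
  have h := gen_variation_spectral Φ.weight Φ.fieldP_eq Φ.fieldQ_eq (algebraMap ℝ A y) hy
    Φ.isUnit_neg_two_mul
  have h1 : ∏ l, (algebraMap ℝ A y - algebraMap ℝ A (lam l)) = algebraMap ℝ A (∏ l, (y - lam l)) := by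
    simp
  have h2 : (-2 : A) = algebraMap ℝ A (-2) := by rw [map_neg, map_ofNat]
  rw [h1, algebraMap_numValue_mul, algebraMap_numValue_mul, algebraMap_numValue_mul, h2, ← map_mul,
    ← map_add] at h
  have h3 := congrArg Φ.L h
  rw [map_add, map_add, map_algebraMap_mul, map_algebraMap_mul, map_algebraMap_mul, map_zero,
    Φ.map_varM, Φ.map_varN, Φ.map_varL] at h3
  rw [eval_mPoly_eq, eval_lPoly_eq, eval_nPoly_eq]
  linear_combination h3

/-- The factor of proportionality in the motion of an elliptic variable. -/
def kappa (y : ℝ) : A :=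
  Φ.w * wsum Φ.s ((fun j => algebraMap ℝ A (z.1 j)) * fun j => algebraMap ℝ A (z.1 j))
    * Ring.inverse (2 * Φ.u) * Ring.inverse (1 - algebraMap ℝ A y * Φ.w)

theorem isUnit_two_mul : IsUnit (2 * Φ.u) := by
  have := Φ.isUnit_neg_two_mul.neg
  rwa [neg_mul, neg_neg] at this

/-- At a root of `m` a single term of the variation survives. Division by the units leaves a real
multiple of `kappa`, the same factor as in `varN_eq`, and `L` passes through the real coefficient.
-/
theorem varM_eq {y : ℝ} (hy : IsUnit (1 - algebraMap ℝ A y * Φ.w)) (hm : (mPoly lam z).eval y = 0) :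
    varM lam z v y = -4 * Φ.L (Φ.kappa y) * (nPoly lam z).eval y := by
  have h := gen_variation_m Φ.weight Φ.fieldP_eq (algebraMap ℝ A y)
  rw [eval_mPoly_eq] at hm
  rw [algebraMap_numValue_mul, algebraMap_numValue_mul, hm, map_zero, mul_zero, add_zero] at h
  have h1 : numValue (fun j => algebraMap ℝ A (lam j)) (algebraMap ℝ A y)
      (fun j => 2 * algebraMap ℝ A (z.1 j) * Φ.P j)
      = algebraMap ℝ A (4 * numValue lam y (z.1 * z.2)) * Φ.kappa y := by
    refine (hy.mul Φ.isUnit_two_mul).mul_left_cancel ?_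
    rw [kappa, map_mul, map_ofNat]
    have e1 := Ring.mul_inverse_cancel _ hy
    have e2 := Ring.mul_inverse_cancel _ Φ.isUnit_two_mul
    set W := wsum Φ.s ((fun j => algebraMap ℝ A (z.1 j)) * fun j => algebraMap ℝ A (z.1 j))
    set I1 := Ring.inverse (1 - algebraMap ℝ A y * Φ.w)
    set I2 := Ring.inverse (2 * Φ.u)
    set n := algebraMap ℝ A (numValue lam y (z.1 * z.2))
    linear_combination -h - 4 * n * Φ.w * W * e1
      - 4 * n * Φ.w * W * (1 - algebraMap ℝ A y * Φ.w) * I1 * e2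
  have h2 := congrArg Φ.L h1
  rw [Φ.map_varM, map_algebraMap_mul] at h2
  rw [h2, eval_nPoly_eq]
  ring

theorem varN_eq {y : ℝ} (hy : IsUnit (1 - algebraMap ℝ A y * Φ.w)) (hm : (mPoly lam z).eval y = 0) :
    varN lam z v y = -2 * Φ.L (Φ.kappa y) * (lPoly lam z).eval y := by
  have h := gen_variation_n Φ.weight Φ.fieldP_eq Φ.fieldQ_eq (algebraMap ℝ A y)
  have h0 : ∏ l, (algebraMap ℝ A y - algebraMap ℝ A (lam l)) = algebraMap ℝ A (∏ l, (y - lam l)) := by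
    simp
  rw [eval_mPoly_eq] at hm
  rw [algebraMap_numValue_mul, algebraMap_numValue_mul, hm, map_zero, mul_zero, add_zero, h0,
    ← map_add, ← eval_lPoly_eq] at h
  have h1 : numValue (fun j => algebraMap ℝ A (lam j)) (algebraMap ℝ A y)
      (fun j => Φ.P j * algebraMap ℝ A (z.2 j) + algebraMap ℝ A (z.1 j) * Φ.Q j)
      = algebraMap ℝ A (2 * (lPoly lam z).eval y) * Φ.kappa y := by
    refine (hy.mul Φ.isUnit_two_mul).mul_left_cancel ?_
    rw [kappa, map_mul, map_ofNat]
    have e1 := Ring.mul_inverse_cancel _ hy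
    have e2 := Ring.mul_inverse_cancel _ Φ.isUnit_two_mul
    set W := wsum Φ.s ((fun j => algebraMap ℝ A (z.1 j)) * fun j => algebraMap ℝ A (z.1 j))
    set I1 := Ring.inverse (1 - algebraMap ℝ A y * Φ.w)
    set I2 := Ring.inverse (2 * Φ.u)
    set n := algebraMap ℝ A ((lPoly lam z).eval y)
    linear_combination -h - 2 * n * Φ.w * W * e1
      - 2 * n * Φ.w * W * (1 - algebraMap ℝ A y * Φ.w) * I1 * e2
  have h2 := congrArg Φ.L h1
  rw [Φ.map_varN, map_algebraMap_mul] at h2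
  linarith

theorem sq_mul_prod : (Φ.u * ∏ j, (1 - algebraMap ℝ A (lam j) * Φ.w)) ^ 2
    = aeval Φ.w (revSpectralPoly lam z) := by
  rw [mul_pow, Φ.sq, genFun_mul_prod_sq Φ.weight]

end GenFlow

/-- The sum over the elliptic variables, by Lagrange interpolation. -/
theorem GenFlow.sum_kappa {g : ℕ} {lam : Fin (g + 1) → ℝ} {z v : Phase (g + 1)}
    (Φ : GenFlow lam z v A) {μ : Fin g → ℝ} (hμ : Function.Injective μ)
    (hm : mPoly lam z = ∏ k, (X - C (μ k)))
    (hunit : ∀ k, IsUnit (1 - algebraMap ℝ A (μ k) * Φ.w)) (i : Fin g) :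
    2 * (Φ.u * ∏ j, (1 - algebraMap ℝ A (lam j) * Φ.w))
      * ∑ k, algebraMap ℝ A (μ k ^ (g - 1 - (i : ℕ)) / ∏ l ∈ Finset.univ.erase k, (μ k - μ l))
        * Φ.kappa (μ k) = Φ.w ^ ((i : ℕ) + 1) := by
  -- The monomial of degree `g - 1 - i` reverses to the power `i`; since `i < g`, no subtraction is
  -- truncated.
  have h1 := congrArg (aeval Φ.w) (sum_lagrange_rev hμ (d := g - 1 - (i : ℕ)) (by omega))
  simp only [map_sum, map_mul, map_prod, map_sub, map_one, aeval_C, aeval_X, map_pow] at h1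
  have h2 := wsum_mul_prod Φ.weight (z.1 * z.1)
  rw [show revNumerator lam (z.1 * z.1) = _ from revNumerator_eq_prod hm] at h2
  simp only [map_mul, map_prod, map_sub, map_one, aeval_C, aeval_X, Pi.mul_apply] at h2
  rw [show g - 1 - (g - 1 - (i : ℕ)) = i by omega] at h1
  rw [pow_succ', ← h1, Finset.mul_sum, Finset.mul_sum]
  refine Finset.sum_congr rfl fun k _ => ?_
  rw [kappa]
  have e1 := Ring.mul_inverse_cancel _ (hunit k)
  have e2 := Ring.mul_inverse_cancel _ Φ.isUnit_two_mul
  -- Reversing `m = ∏ (X - μ_l)` exposes the factor `1 - μ_k w`, which cancels the denominator of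
  -- `kappa` and leaves the Lagrange product over `l ≠ k`.
  have h3 : wsum Φ.s ((fun j => algebraMap ℝ A (z.1 j)) * fun j => algebraMap ℝ A (z.1 j))
      * ∏ j, (1 - algebraMap ℝ A (lam j) * Φ.w) = (1 - algebraMap ℝ A (μ k) * Φ.w)
        * ∏ l ∈ Finset.univ.erase k, (1 - algebraMap ℝ A (μ l) * Φ.w) := by
    rw [Finset.mul_prod_erase Finset.univ (fun l => 1 - algebraMap ℝ A (μ l) * Φ.w)
      (Finset.mem_univ k), ← h2]
    rfl
  set c := algebraMap ℝ A (μ k ^ (g - 1 - (i : ℕ)) / ∏ l ∈ Finset.univ.erase k, (μ k - μ l))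
  set W := wsum Φ.s ((fun j => algebraMap ℝ A (z.1 j)) * fun j => algebraMap ℝ A (z.1 j))
  set I1 := Ring.inverse (1 - algebraMap ℝ A (μ k) * Φ.w)
  set I2 := Ring.inverse (2 * Φ.u)
  set T := ∏ j, (1 - algebraMap ℝ A (lam j) * Φ.w)
  set M := ∏ l ∈ Finset.univ.erase k, (1 - algebraMap ℝ A (μ l) * Φ.w)
  linear_combination (c * Φ.w * I1 * (2 * Φ.u) * I2) * h3 + (c * Φ.w * M * (2 * Φ.u) * I2) * e1
    + c * Φ.w * M * e2

end AlgebraicFlow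

/-! ### The elliptic variables are real and simple. -/

section Roots

variable {g : ℕ} {lam : Fin (g + 1) → ℝ} {ν : Fin g → ℂ} {z : Phase (g + 1)}

theorem natDegree_prod_erase (lam : Fin (g + 1) → ℝ) (j : Fin (g + 1)) :
    (∏ l ∈ Finset.univ.erase j, (X - C (lam l)) : ℝ[X]).natDegree = g := by
  rw [natDegree_prod_of_monic _ _ fun l _ => monic_X_sub_C (lam l)]
  simp

theorem monic_mPoly (hz : z ∈ tangentSphere (g + 1)) :
    (mPoly lam z).Monic ∧ (mPoly lam z).natDegree = g := by
  have hdeg : (mPoly lam z).natDegree ≤ g := by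
    rw [mPoly, numerator]
    refine natDegree_sum_le_of_forall_le _ _ fun j _ => ?_
    exact (natDegree_C_mul_le _ _).trans (natDegree_prod_erase lam j).le
  have hcoeff : (mPoly lam z).coeff g = 1 := by
    rw [mPoly, numerator, finsetSum_coeff, ← sum_sq_of_mem hz]
    refine Finset.sum_congr rfl fun j _ => ?_
    rw [coeff_C_mul]
    have h := (monic_prod_X_sub_C (fun l => lam l) (Finset.univ.erase j)).coeff_natDegree
    rw [natDegree_prod_erase] at h
    rw [h, mul_one]
  exact ⟨monic_of_natDegree_le_of_coeff_eq_one g hdeg hcoeff,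
    le_antisymm hdeg (le_natDegree_of_ne_zero (by rw [hcoeff]; exact one_ne_zero))⟩

theorem exists_ne_zero_of_mem (hz : z ∈ tangentSphere (g + 1)) : ∃ j, z.1 j ≠ 0 := by
  by_contra! h
  have := sum_sq_of_mem hz
  simp [h] at this

/-- The roots of `m` are real. -/
theorem im_eq_zero_of_mPoly_root (hz : z ∈ tangentSphere (g + 1)) {c : ℂ}
    (hc : ((mPoly lam z).map (algebraMap ℝ ℂ)).eval c = 0) : c.im = 0 := by
  by_contra him
  have hne : ∀ j, c - lam j ≠ 0 := by
    intro j h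
    apply him
    rw [sub_eq_zero.1 h, Complex.ofReal_im]
  have h1 : ((mPoly lam z).map (algebraMap ℝ ℂ)).eval c
      = (∏ l, (c - lam l)) * ∑ j, ((z.1 j * z.1 j : ℝ) : ℂ) * (c - lam j)⁻¹ := by
    simp only [mPoly, numerator, Polynomial.map_sum, Polynomial.map_mul, map_C, Polynomial.map_prod,
      Polynomial.map_sub, map_X, eval_finsetSum, eval_mul, eval_C, eval_prod, eval_sub, eval_X,
      Finset.mul_sum]
    refine Finset.sum_congr rfl fun j _ => ?_
    rw [← Finset.mul_prod_erase Finset.univ (fun l => c - (lam l : ℂ)) (Finset.mem_univ j)]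
    have := hne j
    simp only [Complex.coe_algebraMap]
    field_simp
  rw [h1, mul_eq_zero] at hc
  rcases hc with hc | hc
  · rw [Finset.prod_eq_zero_iff] at hc
    obtain ⟨j, -, hj⟩ := hc
    exact hne j hj
  · have h2 := congrArg Complex.im hc
    rw [Complex.im_sum, Complex.zero_im] at h2
    -- The imaginary part of `∑ p_j² / (c - λ_j)` is `-Im c` times a sum of nonnegative terms, one
    -- of which is positive.
    have h3 : ∀ j, (((z.1 j * z.1 j : ℝ) : ℂ) * (c - lam j)⁻¹).im
        = -c.im * (z.1 j * z.1 j / Complex.normSq (c - lam j)) := by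
      intro j
      rw [Complex.im_ofReal_mul, Complex.inv_im, Complex.sub_im, Complex.ofReal_im]
      ring
    rw [Finset.sum_congr rfl fun j _ => h3 j, ← Finset.mul_sum] at h2
    rcases mul_eq_zero.1 h2 with h4 | h4
    · exact him (neg_eq_zero.1 h4)
    · obtain ⟨i, hi⟩ := exists_ne_zero_of_mem hz
      have hpos : ∀ j, 0 < Complex.normSq (c - lam j) := fun j => Complex.normSq_pos.2 (hne j)
      have h5 := (Finset.sum_eq_zero_iff_of_nonneg fun j _ =>
        div_nonneg (mul_self_nonneg (z.1 j)) (hpos j).le).1 h4 i (Finset.mem_univ i)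
      rcases div_eq_zero_iff.1 h5 with h6 | h6
      · exact hi (mul_self_eq_zero.1 h6)
      · exact (hpos i).ne' h6

theorem eval_curvePoly_ofReal
    (hR : (spectralPoly lam z).map (algebraMap ℝ ℂ) = curvePoly (branchPoint lam ν)) (y : ℝ) :
    (curvePoly (branchPoint lam ν)).eval (y : ℂ) = ((spectralPoly lam z).eval y : ℝ) := by
  rw [← hR, eval_map_ofReal]

theorem eval_derivative_curvePoly_ofReal
    (hR : (spectralPoly lam z).map (algebraMap ℝ ℂ) = curvePoly (branchPoint lam ν)) (y : ℝ) :
    (curvePoly (branchPoint lam ν)).derivative.eval (y : ℂ)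
      = ((spectralPoly lam z).derivative.eval y : ℝ) := by
  rw [← hR, derivative_map, eval_map_ofReal]

theorem aeval_ofReal (f : ℝ[X]) (y : ℝ) : aeval (y : ℂ) f = ((f.eval y : ℝ) : ℂ) := by
  rw [aeval_def, ← eval_map, eval_map_ofReal]

/-- Where `m` vanishes, `R = m l - n²` reduces to `-n²`. -/
theorem mem_curve_of_root
    (hR : (spectralPoly lam z).map (algebraMap ℝ ℂ) = curvePoly (branchPoint lam ν)) {y : ℝ}
    (hy : (mPoly lam z).eval y = 0) :
    ((y : ℂ), aeval (y : ℂ) (nPoly lam z)) ∈ curve (branchPoint lam ν) := by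
  change (aeval (y : ℂ) (nPoly lam z)) ^ 2 + (curvePoly (branchPoint lam ν)).eval (y : ℂ) = 0
  rw [eval_curvePoly_ofReal hR, aeval_ofReal, spectralPoly, eval_sub, eval_mul, hy, eval_pow]
  push_cast
  ring

/-- At a common zero of `m` and `n`, the derivative of the spectral polynomial is `m' l`. -/
theorem derivative_mul_lPoly_ne_zero (he : Function.Injective (branchPoint lam ν))
    (hR : (spectralPoly lam z).map (algebraMap ℝ ℂ) = curvePoly (branchPoint lam ν)) {y : ℝ}
    (hm : (mPoly lam z).eval y = 0) (hn : (nPoly lam z).eval y = 0) :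
    (spectralPoly lam z).derivative.eval y = (mPoly lam z).derivative.eval y * (lPoly lam z).eval y ∧
    (mPoly lam z).derivative.eval y * (lPoly lam z).eval y ≠ 0 := by
  have h1 : (spectralPoly lam z).derivative.eval y
      = (mPoly lam z).derivative.eval y * (lPoly lam z).eval y := by
    rw [spectralPoly, derivative_sub, derivative_mul, derivative_pow]
    simp [hm, hn]
  refine ⟨h1, ?_⟩
  rw [← h1]
  have h2 := curvePoly_derivative_ne_zero he (x := (y : ℂ)) (by
    rw [eval_curvePoly_ofReal hR, spectralPoly, eval_sub, eval_mul, hm, eval_pow, hn]; simp)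
  rw [eval_derivative_curvePoly_ofReal hR] at h2
  exact_mod_cast h2

/-- The roots of `m` are simple. -/
theorem derivative_mPoly_ne_zero (hz : z ∈ tangentSphere (g + 1))
    (he : Function.Injective (branchPoint lam ν))
    (hR : (spectralPoly lam z).map (algebraMap ℝ ℂ) = curvePoly (branchPoint lam ν)) {y : ℝ}
    (hm : (mPoly lam z).eval y = 0) : (mPoly lam z).derivative.eval y ≠ 0 := by
  -- At `λ_i`, the vanishing of `R` and `m` forces `n = 0`, and smoothness of the curve gives `m' l
  -- = R' ≠ 0`. Elsewhere the root is a zero of `∑ p_j² / (x - λ_j)`, whose derivative is strictly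
  -- negative.
  by_cases hy : ∃ i, y = lam i
  · obtain ⟨i, rfl⟩ := hy
    have h1 : (spectralPoly lam z).eval (lam i) = 0 := by
      have h2 := eval_curvePoly_ofReal hR (lam i)
      rw [eval_curvePoly, Finset.prod_eq_zero (Finset.mem_univ (Sum.inl i))
        (by simp [branchPoint])] at h2
      exact_mod_cast h2.symm
    have hn : (nPoly lam z).eval (lam i) = 0 := by
      rw [spectralPoly, eval_sub, eval_mul, hm, eval_pow] at h1
      have : (nPoly lam z).eval (lam i) ^ 2 = 0 := by linarith
      exact pow_eq_zero_iff two_ne_zero |>.1 this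
    exact left_ne_zero_of_mul (derivative_mul_lPoly_ne_zero he hR hm hn).2
  · push Not at hy
    have hev : ∀ᶠ x in 𝓝 y, ∀ j, x ≠ lam j := eventually_all.2 fun j => eventually_ne_nhds (hy j)
    have h1 : (fun x => (mPoly lam z).eval x) =ᶠ[𝓝 y]
        fun x => (∏ l, (X - C (lam l)) : ℝ[X]).eval x * ∑ j, z.1 j * z.1 j * (x - lam j)⁻¹ := by
      filter_upwards [hev] with x hx
      rw [mPoly, eval_numerator lam _ x hx]
      simp [eval_prod, div_eq_mul_inv]
    have h2 : HasDerivAt (fun x => ∑ j, z.1 j * z.1 j * (x - lam j)⁻¹)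
        (∑ j, z.1 j * z.1 j * (-1 / (y - lam j) ^ 2)) y := by
      refine HasDerivAt.fun_sum fun j _ => HasDerivAt.const_mul _ ?_
      exact ((hasDerivAt_id y).sub_const (lam j)).inv (sub_ne_zero.2 (hy j))
    have h3 := (((∏ l, (X - C (lam l)) : ℝ[X]).hasDerivAt y).mul h2).congr_of_eventuallyEq h1
    have h4 := ((mPoly lam z).hasDerivAt y).unique h3
    have h5 := h1.self_of_nhds
    simp only [hm] at h5
    have h6 : (∏ l, (X - C (lam l)) : ℝ[X]).eval y ≠ 0 := by
      rw [eval_prod]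
      exact Finset.prod_ne_zero_iff.2 fun l _ => by simpa [sub_eq_zero] using hy l
    have h7 : ∑ j, z.1 j * z.1 j * (y - lam j)⁻¹ = 0 :=
      (mul_eq_zero.1 h5.symm).resolve_left h6
    rw [h4, h7, mul_zero, zero_add]
    refine mul_ne_zero h6 (ne_of_lt ?_)
    obtain ⟨i, hi⟩ := exists_ne_zero_of_mem hz
    have h8 : ∀ j, z.1 j * z.1 j * (-1 / (y - lam j) ^ 2) ≤ 0 := fun j =>
      mul_nonpos_of_nonneg_of_nonpos (mul_self_nonneg _)
        (div_nonpos_of_nonpos_of_nonneg (by norm_num) (sq_nonneg _))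
    refine Finset.sum_neg' (fun j _ => h8 j) ⟨i, Finset.mem_univ i, ?_⟩
    refine mul_neg_of_pos_of_neg (mul_self_pos.2 hi) (div_neg_of_neg_of_pos (by norm_num) ?_)
    have := sub_ne_zero.2 (hy i)
    positivity

/-- The polynomial `m` has `g` distinct real roots. -/
theorem exists_roots (hz : z ∈ tangentSphere (g + 1)) (he : Function.Injective (branchPoint lam ν))
    (hR : (spectralPoly lam z).map (algebraMap ℝ ℂ) = curvePoly (branchPoint lam ν)) :
    ∃ μ : Fin g → ℝ, Function.Injective μ ∧ mPoly lam z = ∏ k, (X - C (μ k)) := by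
  set M := (mPoly lam z).map (algebraMap ℝ ℂ) with hM
  obtain ⟨hmon, hdeg⟩ := monic_mPoly (lam := lam) hz
  have hMmon : M.Monic := hmon.map _
  have hMdeg : M.natDegree = g := by rw [hM, natDegree_map, hdeg]
  have hreal : ∀ c ∈ M.roots, c = (c.re : ℂ) := by
    intro c hc
    have := im_eq_zero_of_mPoly_root hz (mem_roots hMmon.ne_zero |>.1 hc)
    exact Complex.ext rfl (by simp [this])
  have hnodup : M.roots.Nodup := by
    rw [Multiset.nodup_iff_count_le_one]
    intro c
    rw [count_roots]
    by_contra hgt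
    rw [not_le, one_lt_rootMultiplicity_iff_isRoot hMmon.ne_zero] at hgt
    have hc := hreal c ((mem_roots hMmon.ne_zero).2 hgt.1)
    rw [hc] at hgt
    have h1 := hgt.1
    have h2 := hgt.2
    rw [IsRoot, eval_map_ofReal] at h1
    rw [IsRoot, hM, derivative_map, eval_map_ofReal] at h2
    exact derivative_mPoly_ne_zero hz he hR (by exact_mod_cast h1) (by exact_mod_cast h2)
  have hcard : M.roots.card = g := by
    rw [← hMdeg]
    exact splits_iff_card_roots.1 (IsAlgClosed.splits M)
  have hcard' : M.roots.toFinset.card = g := by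
    rw [Multiset.toFinset_card_of_nodup hnodup, hcard]
  let E : Fin g ≃ M.roots.toFinset := (Finset.equivFinOfCardEq hcard').symm
  have hE : ∀ k, (E k : ℂ) = ((E k : ℂ).re : ℂ) := fun k =>
    hreal _ (Multiset.mem_toFinset.1 (E k).2)
  refine ⟨fun k => (E k : ℂ).re, fun k l hkl => ?_, ?_⟩
  · have h1 : (E k : ℂ) = E l := by rw [hE k, hE l]; exact congrArg _ hkl
    exact E.injective (Subtype.ext h1)
  · refine Polynomial.map_injective (algebraMap ℝ ℂ) (algebraMap ℝ ℂ).injective ?_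
    have h1 : (M.roots.map fun a => X - C a).prod = ∏ a ∈ M.roots.toFinset, (X - C a) := by
      rw [Finset.prod_multiset_map_count]
      refine Finset.prod_congr rfl fun a ha => ?_
      rw [Multiset.count_eq_one_of_mem hnodup (Multiset.mem_toFinset.1 ha), pow_one]
    refine (prod_multiset_X_sub_C_of_monic_of_roots_card_eq hMmon
      (hcard.trans hMdeg.symm)).symm.trans ?_
    rw [h1, Polynomial.map_prod, ← Finset.prod_coe_sort, ← E.prod_comp]
    refine Finset.prod_congr rfl fun k _ => ?_
    rw [hE k]
    simp

theorem eval_derivative_prod {μ : Fin g → ℝ} (k : Fin g) :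
    (∏ k, (X - C (μ k))).derivative.eval (μ k) = ∏ l ∈ Finset.univ.erase k, (μ k - μ l) := by
  have h := Lagrange.eval_nodal_derivative_eval_node_eq (s := Finset.univ) (v := μ)
    (Finset.mem_univ k)
  rw [Lagrange.nodal, Lagrange.nodal, eval_prod] at h
  simpa using h

/-- A monic polynomial of degree `g` with `g` distinct roots. -/
theorem eq_prod_of_roots {f : ℝ[X]} (hf : f.Monic) (hdeg : f.natDegree = g) {μ : Fin g → ℝ}
    (hμ : Function.Injective μ) (h : ∀ k, f.eval (μ k) = 0) : f = ∏ k, (X - C (μ k)) := by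
  have hdvd : ∏ k, (X - C (μ k)) ∣ f :=
    Finset.prod_dvd_of_coprime (fun k _ l _ hkl => pairwise_coprime_X_sub_C hμ hkl)
      fun k _ => dvd_iff_isRoot.2 (h k)
  refine (eq_of_monic_of_dvd_of_natDegree_le (monic_prod_X_sub_C μ Finset.univ) hf hdvd ?_)
  rw [hdeg, natDegree_prod_of_monic _ _ fun l _ => monic_X_sub_C _]
  simp

end Roots

/-! ### Differentiable motion of the roots and isospectrality. -/

section RootMotion

variable {g : ℕ} {lam : Fin (g + 1) → ℝ} {ν : Fin g → ℂ}

theorem hasDerivAt_eval_numerator {N : ℕ} {lam : Fin N → ℝ} {c : ℝ → Fin N → ℝ} {c' : Fin N → ℝ}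
    {y : ℝ → ℝ} {d t : ℝ} (hc : ∀ j, HasDerivAt (fun s => c s j) (c' j) t) (hy : HasDerivAt y d t) :
    HasDerivAt (fun s => (numerator lam (c s)).eval (y s))
      (numValue lam (y t) c' + (numerator lam (c t)).derivative.eval (y t) * d) t := by
  have h : ∀ j, HasDerivAt
      (fun s => c s j * (∏ l ∈ Finset.univ.erase j, (X - C (lam l)) : ℝ[X]).eval (y s))
      (c' j * (∏ l ∈ Finset.univ.erase j, (X - C (lam l)) : ℝ[X]).eval (y t) + c t j *
        ((∏ l ∈ Finset.univ.erase j, (X - C (lam l)) : ℝ[X]).derivative.eval (y t) * d)) t :=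
    fun j => (hc j).mul ((Polynomial.hasDerivAt _ (y t)).comp t hy)
  have h2 := HasDerivAt.fun_sum (u := Finset.univ) fun j _ => h j
  refine (h2.congr_deriv ?_).congr_of_eventuallyEq (Eventually.of_forall fun s => ?_)
  · rw [numerator, derivative_sum, eval_finsetSum, Finset.sum_add_distrib, Finset.sum_mul, numValue]
    congr 1
    · simp [eval_prod]
    · refine Finset.sum_congr rfl fun j _ => ?_
      rw [derivative_C_mul, eval_C_mul, mul_assoc]
  · simp [numerator, eval_finsetSum]

theorem hasDerivAt_eval_mPoly {N : ℕ} {lam : Fin N → ℝ} {z : ℝ → Phase N} {v : Phase N}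
    {y : ℝ → ℝ} {d t : ℝ} (hp : ∀ j, HasDerivAt (fun s => (z s).1 j) (v.1 j) t)
    (hy : HasDerivAt y d t) :
    HasDerivAt (fun s => (mPoly lam (z s)).eval (y s))
      (varM lam (z t) v (y t) + (mPoly lam (z t)).derivative.eval (y t) * d) t := by
  refine hasDerivAt_eval_numerator (fun j => ?_) hy
  exact ((hp j).mul (hp j)).congr_deriv (by ring)

theorem hasDerivAt_eval_nPoly {N : ℕ} {lam : Fin N → ℝ} {z : ℝ → Phase N} {v : Phase N}
    {y : ℝ → ℝ} {d t : ℝ} (hp : ∀ j, HasDerivAt (fun s => (z s).1 j) (v.1 j) t)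
    (hq : ∀ j, HasDerivAt (fun s => (z s).2 j) (v.2 j) t) (hy : HasDerivAt y d t) :
    HasDerivAt (fun s => (nPoly lam (z s)).eval (y s))
      (varN lam (z t) v (y t) + (nPoly lam (z t)).derivative.eval (y t) * d) t := by
  refine (hasDerivAt_eval_numerator (c' := fun j => -(v.1 j * (z t).2 j + (z t).1 j * v.2 j))
    (fun j => ((hp j).mul (hq j)).neg) hy).congr_deriv ?_
  congr 1
  simp only [varN, numValue, neg_mul, Finset.sum_neg_distrib]

theorem hasDerivAt_eval_lPoly {N : ℕ} {lam : Fin N → ℝ} {z : ℝ → Phase N} {v : Phase N}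
    {t : ℝ} (y : ℝ) (hq : ∀ j, HasDerivAt (fun s => (z s).2 j) (v.2 j) t) :
    HasDerivAt (fun s => (lPoly lam (z s)).eval y) (varL lam (z t) v y) t := by
  have h := hasDerivAt_eval_numerator (lam := lam) (c := fun s j => (z s).2 j * (z s).2 j)
    (c' := fun j => 2 * (z t).2 j * v.2 j)
    (fun j => ((hq j).mul (hq j)).congr_deriv (by ring)) (hasDerivAt_const t y)
  rw [mul_zero, add_zero] at h
  simp only [lPoly, eval_add]
  exact h.const_add _

theorem contDiff_eval_mPoly (lam : Fin (g + 1) → ℝ) :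
    ContDiff ℝ 1 fun w : Phase (g + 1) × ℝ => (mPoly lam w.1).eval w.2 := by
  simp only [eval_mPoly_eq, numValue, Pi.mul_apply]
  refine ContDiff.sum fun j _ => ContDiff.mul (by fun_prop) (contDiff_prod fun l _ => by fun_prop)

/-- A simple root of `m` moves differentiably. -/
theorem exists_root_function {z : Phase (g + 1)} {y : ℝ} (hy : (mPoly lam z).eval y = 0)
    (hy' : (mPoly lam z).derivative.eval y ≠ 0) :
    ∃ ψ : Phase (g + 1) → ℝ, ψ z = y ∧ DifferentiableAt ℝ ψ z ∧
      ∀ᶠ x in 𝓝 z, (mPoly lam x).eval (ψ x) = 0 := by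
  have hf := contDiff_eval_mPoly lam
  have h1 : fderiv ℝ (fun w : Phase (g + 1) × ℝ => (mPoly lam w.1).eval w.2) (z, y) (0, 1)
      = (mPoly lam z).derivative.eval y := by
    have h2 : HasDerivAt (fun s : ℝ => ((z, s) : Phase (g + 1) × ℝ)) (0, 1) y :=
      (hasDerivAt_const y z).prodMk (hasDerivAt_id y)
    have h3 := ((hf.differentiable one_ne_zero) (z, y)).hasFDerivAt.comp_hasDerivAt y h2
    exact h3.unique ((mPoly lam z).hasDerivAt y)
  obtain ⟨ψ, h0, h2, -⟩ := exists_implicit hf (by rw [h1]; exact hy')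
  refine ⟨ψ, h0, h2.self_of_nhds.1, h2.mono fun x hx => ?_⟩
  rw [hx.2]
  exact hy

/-- If `n ≠ 0`, the root has velocity `4κn/m'`, and the factor `4n` cancels the denominator `4ξ`. If
`n = 0`, the root is momentarily at rest and the form is evaluated on `dξ`; there `dξ = -2κl` and
`R' = m' l` give the same value. -/
theorem holoForm_rootMotion {z v : Phase (g + 1)} (hz : z ∈ tangentSphere (g + 1))
    (he : Function.Injective (branchPoint lam ν))
    (hR : (spectralPoly lam z).map (algebraMap ℝ ℂ) = curvePoly (branchPoint lam ν)) {y d κ : ℝ}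
    (hy : (mPoly lam z).eval y = 0)
    (hd : varM lam z v y + (mPoly lam z).derivative.eval y * d = 0)
    (hM : varM lam z v y = -4 * κ * (nPoly lam z).eval y)
    (hN : varN lam z v y = -2 * κ * (lPoly lam z).eval y) (l : Fin g) :
    holoForm (branchPoint lam ν) l ((y : ℂ), (((nPoly lam z).eval y : ℝ) : ℂ))
      ((d : ℂ), ((varN lam z v y + (nPoly lam z).derivative.eval y * d : ℝ) : ℂ))
      = ((y ^ (g - 1 - (l : ℕ)) / (mPoly lam z).derivative.eval y * κ : ℝ) : ℂ) := by
  have hm' := derivative_mPoly_ne_zero hz he hR hy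
  rw [holoForm]
  by_cases hn : (nPoly lam z).eval y = 0
  · obtain ⟨h1, h2⟩ := derivative_mul_lPoly_ne_zero he hR hy hn
    have hl := right_ne_zero_of_mul h2
    have hd0 : d = 0 := by
      rw [hM, hn, mul_zero, zero_add] at hd
      exact (mul_eq_zero.1 hd).resolve_left hm'
    rw [if_neg (by simp [hn])]
    simp only [_root_.smul_apply, ContinuousLinearMap.coe_snd', smul_eq_mul]
    rw [eval_derivative_curvePoly_ofReal hR, h1, hd0, hN]
    have hlC : (((lPoly lam z).eval y : ℝ) : ℂ) ≠ 0 := by exact_mod_cast hl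
    have hmC : (((mPoly lam z).derivative.eval y : ℝ) : ℂ) ≠ 0 := by exact_mod_cast hm'
    push_cast
    field_simp
    ring
  · have hnC : (((nPoly lam z).eval y : ℝ) : ℂ) ≠ 0 := by exact_mod_cast hn
    have hmC : (((mPoly lam z).derivative.eval y : ℝ) : ℂ) ≠ 0 := by exact_mod_cast hm'
    rw [if_pos hnC]
    simp only [_root_.smul_apply, ContinuousLinearMap.coe_fst', smul_eq_mul]
    have hd1 : d = 4 * κ * (nPoly lam z).eval y / (mPoly lam z).derivative.eval y := by
      rw [eq_div_iff hm']
      linarith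
    rw [hd1]
    push_cast
    field_simp

/-- The Abel-Jacobi variable along an isospectral curve in the phase space. -/
theorem isLinearized_of_rootMotion (he : Function.Injective (branchPoint lam ν))
    {P₀ : curve (branchPoint lam ν)} (B : CanonicalBasis (branchPoint lam ν) P₀) {I : Set ℝ}
    (hI : IsOpen I) {z v : ℝ → Phase (g + 1)} (hz : ∀ t ∈ I, z t ∈ tangentSphere (g + 1))
    (hv : ∀ t ∈ I, ∀ j, HasDerivAt (fun s => (z s).1 j) ((v t).1 j) t ∧
      HasDerivAt (fun s => (z s).2 j) ((v t).2 j) t)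
    (hR : ∀ t ∈ I, (spectralPoly lam (z t)).map (algebraMap ℝ ℂ) = curvePoly (branchPoint lam ν))
    {rate : Fin g → ℂ}
    (h : ∀ t ∈ I, ∀ μ : Fin g → ℝ, Function.Injective μ → mPoly lam (z t) = ∏ k, (X - C (μ k)) →
      ∃ κ : Fin g → ℝ, (∀ k, varM lam (z t) (v t) (μ k) = -4 * κ k * (nPoly lam (z t)).eval (μ k) ∧
        varN lam (z t) (v t) (μ k) = -2 * κ k * (lPoly lam (z t)).eval (μ k)) ∧
        ∀ i : Fin g, ((∑ k, μ k ^ (g - 1 - (i : ℕ)) / (∏ l ∈ Finset.univ.erase k, (μ k - μ l)) * κ k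
          : ℝ) : ℂ) = rate i) :
    IsLinearized lam B I z fun j => ∑ l, normMatrix B j l * rate l := by
  refine isLinearized_of_hasDerivAt he B fun t ht => ?_
  obtain ⟨μ, hμ, hmμ⟩ := exists_roots (hz t ht) he (hR t ht)
  obtain ⟨κ, hκ, hrate⟩ := h t ht μ hμ hmμ
  have hroot : ∀ k, (mPoly lam (z t)).eval (μ k) = 0 := by
    intro k
    rw [hmμ, eval_prod]
    exact Finset.prod_eq_zero (Finset.mem_univ k) (by simp)
  have hm' := fun k => derivative_mPoly_ne_zero (hz t ht) he (hR t ht) (hroot k)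
  choose ψ hψ0 hψ1 hψ2 using fun k => exists_root_function (hroot k) (hm' k)
  have hzd : HasDerivAt z (v t) t :=
    (hasDerivAt_pi.2 fun j => (hv t ht j).1).prodMk (hasDerivAt_pi.2 fun j => (hv t ht j).2)
  have hcont : Tendsto z (𝓝 t) (𝓝 (z t)) := hzd.continuousAt
  have hψd : ∀ k, HasDerivAt (fun s => ψ k (z s)) (fderiv ℝ (ψ k) (z t) (v t)) t :=
    fun k => (hψ1 k).hasFDerivAt.comp_hasDerivAt t hzd
  set d : Fin g → ℝ := fun k => fderiv ℝ (ψ k) (z t) (v t)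
  have hev : ∀ᶠ s in 𝓝 t, ∀ k, (mPoly lam (z s)).eval (ψ k (z s)) = 0 :=
    eventually_all.2 fun k => hcont.eventually (hψ2 k)
  -- The `g` continued roots stay distinct for nearby times, so they exhaust the roots of the monic
  -- polynomial `m` of degree `g`.
  have hinj : ∀ᶠ s in 𝓝 t, Function.Injective fun k => ψ k (z s) := by
    have : ∀ k l, k ≠ l → ∀ᶠ s in 𝓝 t, ψ k (z s) ≠ ψ l (z s) := by
      intro k l hkl
      have h1 := ((hψd k).continuousAt.ne_iff_eventually_ne (hψd l).continuousAt).1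
        (by rw [hψ0, hψ0]; exact hμ.ne hkl)
      exact h1
    have h2 : ∀ᶠ s in 𝓝 t, ∀ k l, k ≠ l → ψ k (z s) ≠ ψ l (z s) :=
      eventually_all.2 fun k => eventually_all.2 fun l => eventually_imp_distrib_left.2 (this k l)
    filter_upwards [h2] with s hs k l hkl
    by_contra hne
    exact hs k l hne hkl
  have hd : ∀ k, varM lam (z t) (v t) (μ k) + (mPoly lam (z t)).derivative.eval (μ k) * d k = 0 := by
    intro k
    have h1 := hasDerivAt_eval_mPoly (lam := lam) (fun j => (hv t ht j).1) (hψd k)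
    rw [hψ0] at h1
    exact h1.unique ((hasDerivAt_const t (0 : ℝ)).congr_of_eventuallyEq (hev.mono fun s hs => hs k))
  refine ⟨fun s k => (ψ k (z s) : ℂ), fun k => ((d k : ℂ), ((varN lam (z t) (v t) (μ k)
    + (nPoly lam (z t)).derivative.eval (μ k) * d k : ℝ) : ℂ)), ?_, fun k => ?_, fun l => ?_⟩
  · filter_upwards [hev, hinj, hI.mem_nhds ht] with s h1 h2 h3
    refine ⟨?_, fun k => mem_curve_of_root (hR s h3) (h1 k)⟩
    have h4 := monic_mPoly (lam := lam) (hz s h3)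
    rw [IsEllipticVariables, eq_prod_of_roots h4.1 h4.2 h2 h1, Polynomial.map_prod]
    simp
  · have h1 := hasDerivAt_eval_nPoly (lam := lam) (fun j => (hv t ht j).1) (fun j => (hv t ht j).2)
      (hψd k)
    rw [hψ0] at h1
    simp only [aeval_ofReal]
    exact (hψd k).ofReal_comp.prodMk h1.ofReal_comp
  · rw [← hrate l, Complex.ofReal_sum]
    refine Finset.sum_congr rfl fun k _ => ?_
    simp only [hψ0, aeval_ofReal]
    rw [holoForm_rootMotion (hz t ht) he (hR t ht) (hroot k) (hd k) (hκ k).1 (hκ k).2]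
    congr 3
    rw [hmμ, eval_derivative_prod]

/-- A curve along which the spectral polynomial is infinitesimally conserved is isospectral. -/
theorem isospectral {I : Set ℝ} (hI : IsOpen I) (hI' : IsPreconnected I) {t₀ : ℝ} (ht₀ : t₀ ∈ I)
    {z v : ℝ → Phase (g + 1)}
    (hv : ∀ t ∈ I, ∀ j, HasDerivAt (fun s => (z s).1 j) ((v t).1 j) t ∧
      HasDerivAt (fun s => (z s).2 j) ((v t).2 j) t) {S : Set ℝ} (hS : S.Finite)
    (h : ∀ t ∈ I, ∀ y ∉ S, (mPoly lam (z t)).eval y * varL lam (z t) (v t) y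
      + (lPoly lam (z t)).eval y * varM lam (z t) (v t) y
      - 2 * (nPoly lam (z t)).eval y * varN lam (z t) (v t) y = 0) {t : ℝ} (ht : t ∈ I) :
    spectralPoly lam (z t) = spectralPoly lam (z t₀) := by
  refine eq_of_infinite_eval_eq _ _ (hS.infinite_compl.mono fun y hy => ?_)
  have hd : ∀ s ∈ I, HasDerivAt (fun r => (spectralPoly lam (z r)).eval y) 0 s := by
    intro s hs
    have h1 := hasDerivAt_eval_mPoly (lam := lam) (fun j => (hv s hs j).1) (hasDerivAt_const s y)
    have h2 := hasDerivAt_eval_nPoly (lam := lam) (fun j => (hv s hs j).1) (fun j => (hv s hs j).2)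
      (hasDerivAt_const s y)
    have h3 := hasDerivAt_eval_lPoly (lam := lam) y fun j => (hv s hs j).2
    simp only [mul_zero, add_zero] at h1 h2
    have h4 := (h1.mul h3).sub (h2.pow 2)
    simp only [spectralPoly, eval_sub, eval_mul, eval_pow]
    refine h4.congr_deriv ?_
    have := h s hs y hy
    push_cast
    linear_combination this
  exact hI.is_const_of_deriv_eq_zero hI' (fun s hs => (hd s hs).differentiableAt.differentiableWithinAt)
    (fun s hs => (hd s hs).deriv) ht ht₀

end RootMotion

/-! ### Convergence and sign of the inverse square root series. -/

section Convergence

/-- The power series `f` converges absolutely at `w`, with sum `s`. -/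
def ConvergesTo (f : PowerSeries ℂ) (w s : ℂ) : Prop :=
  (Summable fun n => ‖PowerSeries.coeff n f * w ^ n‖) ∧
    HasSum (fun n => PowerSeries.coeff n f * w ^ n) s

theorem ConvergesTo.unique {f : PowerSeries ℂ} {w s t : ℂ} (hs : ConvergesTo f w s)
    (ht : ConvergesTo f w t) : s = t := hs.2.unique ht.2

theorem ConvergesTo.of_finite {f : PowerSeries ℂ} {w s : ℂ} {S : Finset ℕ}
    (hf : ∀ n ∉ S, PowerSeries.coeff n f = 0) (hs : ∑ n ∈ S, PowerSeries.coeff n f * w ^ n = s) :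
    ConvergesTo f w s := by
  refine ⟨summable_of_ne_finset_zero (s := S) fun n hn => by simp [hf n hn], ?_⟩
  rw [← hs]
  exact hasSum_sum_of_ne_finset_zero fun n hn => by simp [hf n hn]

theorem ConvergesTo.one (w : ℂ) : ConvergesTo 1 w 1 :=
  .of_finite (S := {0}) (fun n hn => by
    rw [PowerSeries.coeff_one, if_neg (by simpa using hn)]) (by simp)

theorem ConvergesTo.C (c w : ℂ) : ConvergesTo (PowerSeries.C c) w c :=
  .of_finite (S := {0}) (fun n hn => by
    rw [PowerSeries.coeff_C, if_neg (by simpa using hn)]) (by simp)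

theorem ConvergesTo.X (w : ℂ) : ConvergesTo PowerSeries.X w w :=
  .of_finite (S := {1}) (fun n hn => by
    rw [PowerSeries.coeff_X, if_neg (by simpa using hn)]) (by simp)

theorem ConvergesTo.sub {f h : PowerSeries ℂ} {w s t : ℂ} (hf : ConvergesTo f w s)
    (hh : ConvergesTo h w t) : ConvergesTo (f - h) w (s - t) := by
  refine ⟨(hf.1.add hh.1).of_nonneg_of_le (fun _ => norm_nonneg _) fun n => ?_, ?_⟩
  · rw [map_sub, sub_mul]
    exact norm_sub_le _ _
  · simp only [map_sub, sub_mul]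
    exact hf.2.sub hh.2

theorem ConvergesTo.mul {f h : PowerSeries ℂ} {w s t : ℂ} (hf : ConvergesTo f w s)
    (hh : ConvergesTo h w t) : ConvergesTo (f * h) w (s * t) := by
  have h1 : (fun n => PowerSeries.coeff n (f * h) * w ^ n) = fun n =>
      ∑ kl ∈ Finset.HasAntidiagonal.antidiagonal n,
        (PowerSeries.coeff kl.1 f * w ^ kl.1) * (PowerSeries.coeff kl.2 h * w ^ kl.2) := by
    funext n
    rw [PowerSeries.coeff_mul, Finset.sum_mul]
    refine Finset.sum_congr rfl fun kl hkl => ?_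
    rw [← Finset.HasAntidiagonal.mem_antidiagonal.1 hkl, pow_add]
    ring
  have h2 := summable_norm_sum_mul_antidiagonal_of_summable_norm hf.1 hh.1
  have h3 := tsum_mul_tsum_eq_tsum_sum_antidiagonal_of_summable_norm hf.1 hh.1
  rw [ConvergesTo, h1]
  refine ⟨?_, ?_⟩
  · simpa only [← congrFun h1] using h2
  · rw [hf.2.tsum_eq, hh.2.tsum_eq] at h3
    rw [h3]
    exact h2.of_norm.hasSum

theorem ConvergesTo.pow {f : PowerSeries ℂ} {w s : ℂ} (hf : ConvergesTo f w s) (n : ℕ) :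
    ConvergesTo (f ^ n) w (s ^ n) := by
  induction n with
  | zero => simpa using ConvergesTo.one w
  | succ n ih => simpa only [pow_succ] using ih.mul hf

theorem ConvergesTo.prod {ι : Type*} (S : Finset ι) {f : ι → PowerSeries ℂ} {w : ℂ} {s : ι → ℂ}
    (hf : ∀ i ∈ S, ConvergesTo (f i) w (s i)) : ConvergesTo (∏ i ∈ S, f i) w (∏ i ∈ S, s i) := by
  classical
  induction S using Finset.induction_on with
  | empty => simpa using ConvergesTo.one w
  | insert i S hi ih =>
    rw [Finset.prod_insert hi, Finset.prod_insert hi]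
    exact (hf i (Finset.mem_insert_self i S)).mul
      (ih fun j hj => hf j (Finset.mem_insert_of_mem hj))

theorem ConvergesTo.rescale {f : PowerSeries ℂ} {a w s : ℂ} (hf : ConvergesTo f (a * w) s) :
    ConvergesTo (PowerSeries.rescale a f) w s := by
  have h : (fun n => PowerSeries.coeff n (PowerSeries.rescale a f) * w ^ n)
      = fun n => PowerSeries.coeff n f * (a * w) ^ n := by
    funext n
    rw [PowerSeries.coeff_rescale, mul_pow]
    ring
  rw [ConvergesTo, h]
  exact ⟨by simpa only [← congrFun h] using hf.1, hf.2⟩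

theorem exists_convergesTo_binomialSeries (a : ℂ) {w : ℂ} (hw : ‖w‖ < 1) :
    ∃ s, ConvergesTo (PowerSeries.binomialSeries ℂ a) w s := by
  have h1 : ((‖w‖₊ : NNReal) : ENNReal) < (_root_.binomialSeries ℂ a).radius :=
    lt_of_lt_of_le (by exact_mod_cast hw) binomialSeries_radius_ge_one
  have h2 := (_root_.binomialSeries ℂ a).summable_norm_mul_pow h1
  have h3 : Summable fun n => ‖PowerSeries.coeff n (PowerSeries.binomialSeries ℂ a) * w ^ n‖ := by
    refine h2.congr fun n => ?_
    rw [_root_.binomialSeries, FormalMultilinearSeries.ofScalars_norm, norm_mul, norm_pow]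
    simp
  exact ⟨_, h3, h3.of_norm.hasSum⟩

theorem exists_convergesTo_invSqrtSeries {g : ℕ} (e : Fin (g + 1) ⊕ Fin g → ℂ) {w : ℂ}
    (hw : ∀ i, ‖e i * w‖ < 1) : ∃ s, ConvergesTo (invSqrtSeries e) w s := by
  choose s hs using fun i => exists_convergesTo_binomialSeries (-(1 / 2)) (w := -e i * w)
    (by rw [neg_mul, norm_neg]; exact hw i)
  exact ⟨_, ConvergesTo.prod Finset.univ fun i _ => (hs i).rescale⟩

theorem ConvergesTo.sq_mul_prod {g : ℕ} {e : Fin (g + 1) ⊕ Fin g → ℂ} {w s : ℂ}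
    (hs : ConvergesTo (invSqrtSeries e) w s) : s ^ 2 * ∏ i, (1 - e i * w) = 1 := by
  have h := (hs.pow 2).mul (ConvergesTo.prod Finset.univ fun i _ =>
    (ConvergesTo.one w).sub ((ConvergesTo.C (e i) w).mul (ConvergesTo.X w)))
  rw [(invSqrtSeries_spec e).2] at h
  exact h.unique (.one w)

/-- The terms at `t = 1` are a summable majorant on `[0, 1]`. -/
theorem ConvergesTo.continuousOn_tsum {f : PowerSeries ℂ} {w s : ℂ} (hs : ConvergesTo f w s) :
    ContinuousOn (fun t : ℝ => ∑' n, PowerSeries.coeff n f * (t * w) ^ n) (Set.Icc 0 1) := by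
  refine _root_.continuousOn_tsum (fun n => ?_) hs.1 fun n t ht => ?_
  · fun_prop
  · rw [mul_pow, norm_mul, norm_mul, norm_mul]
    refine mul_le_mul_of_nonneg_left ?_ (norm_nonneg _)
    refine mul_le_of_le_one_left (norm_nonneg _) ?_
    rw [norm_pow, Complex.norm_real, Real.norm_of_nonneg ht.1]
    exact pow_le_one₀ ht.1 ht.2

/-- If the product `∏ (1 - e_i y)` is a real polynomial `f`, the series of its inverse square root
takes positive values on the real axis, inside the disc of convergence. -/
theorem sqrt_mul_eq_one {g : ℕ} {e : Fin (g + 1) ⊕ Fin g → ℂ} {f : ℝ[X]}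
    (hf : f.map (algebraMap ℝ ℂ) = ∏ i, (1 - Polynomial.C (e i) * Polynomial.X)) {w : ℝ} {s : ℂ}
    (hw : ∀ i, ‖e i * w‖ < 1) (hs : ConvergesTo (invSqrtSeries e) w s) :
    0 < f.eval w ∧ (√(f.eval w) : ℂ) * s = 1 := by
  have heval : ∀ y : ℝ, ((f.eval y : ℝ) : ℂ) = ∏ i, (1 - e i * y) := by
    intro y
    rw [← eval_map_ofReal, hf]
    simp [eval_prod]
  have hsmall : ∀ t ∈ Set.Icc (0 : ℝ) 1, ∀ i, ‖e i * ((t : ℂ) * w)‖ < 1 := by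
    intro t ht i
    refine lt_of_le_of_lt ?_ (hw i)
    rw [mul_left_comm, norm_mul, Complex.norm_real, Real.norm_of_nonneg ht.1]
    exact mul_le_of_le_one_left (norm_nonneg _) ht.2
  have hne : ∀ t ∈ Set.Icc (0 : ℝ) 1, f.eval (t * w) ≠ 0 := by
    intro t ht h0
    have h1 := heval (t * w)
    rw [h0, Complex.ofReal_zero, eq_comm, Finset.prod_eq_zero_iff] at h1
    obtain ⟨i, -, hi⟩ := h1
    have h2 := hsmall t ht i
    rw [sub_eq_zero] at hi
    push_cast at hi
    rw [← hi, norm_one] at h2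
    exact lt_irrefl _ h2
  have hcont : Continuous fun t : ℝ => f.eval (t * w) := by fun_prop
  have h0 : f.eval (0 * w) = 1 := by
    have := heval 0
    simp only [Complex.ofReal_zero, mul_zero, sub_zero, Finset.prod_const_one] at this
    rw [zero_mul]
    exact_mod_cast this
  -- Start from `f(0) = 1` and use that `f` has no zero on the segment.
  have hpos : ∀ t ∈ Set.Icc (0 : ℝ) 1, 0 < f.eval (t * w) := by
    intro t ht
    by_contra hle
    obtain ⟨r, hr, hr0⟩ := intermediate_value_Icc' ht.1 hcont.continuousOn
      (show (0 : ℝ) ∈ Set.Icc (f.eval (t * w)) (f.eval (0 * w)) from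
        ⟨not_lt.1 hle, by rw [h0]; exact zero_le_one⟩)
    exact hne r ⟨hr.1, hr.2.trans ht.2⟩ hr0
  set σ : ℝ → ℂ := fun t => ∑' n, PowerSeries.coeff n (invSqrtSeries e) * (t * w) ^ n
  have hσ : ∀ t ∈ Set.Icc (0 : ℝ) 1, ConvergesTo (invSqrtSeries e) (t * w) (σ t) := by
    intro t ht
    obtain ⟨r, hr⟩ := exists_convergesTo_invSqrtSeries e (hsmall t ht)
    rwa [show σ t = r from hr.2.tsum_eq]
  -- The product `√f · σ` is continuous with square one, so it is constantly `1` or constantly `-1`;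
  -- its value at `t = 0` decides.
  have hsq : Set.EqOn ((fun t => (√(f.eval (t * w)) : ℂ) * σ t) ^ 2) 1 (Set.Icc (0 : ℝ) 1) := by
    intro t ht
    have h1 := (hσ t ht).sq_mul_prod
    have h2 := heval (t * w)
    push_cast at h2
    rw [← h2] at h1
    simp only [Pi.pow_apply, Pi.one_apply]
    rw [mul_pow, ← Complex.ofReal_pow, Real.sq_sqrt (hpos t ht).le, mul_comm]
    exact h1
  have hcσ : ContinuousOn (fun t => (√(f.eval (t * w)) : ℂ) * σ t) (Set.Icc (0 : ℝ) 1) :=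
    (Complex.continuous_ofReal.comp (Real.continuous_sqrt.comp hcont)).continuousOn.mul
      hs.continuousOn_tsum
  have hone : (1 : ℝ) ∈ Set.Icc (0 : ℝ) 1 := ⟨zero_le_one, le_rfl⟩
  have hzero : (0 : ℝ) ∈ Set.Icc (0 : ℝ) 1 := ⟨le_rfl, zero_le_one⟩
  have h1s : σ 1 = s := by
    have := hσ 1 hone
    rw [Complex.ofReal_one, one_mul] at this
    exact this.unique hs
  refine ⟨by simpa using hpos 1 hone, ?_⟩
  rcases isPreconnected_Icc.eq_one_or_eq_neg_one_of_sq_eq hcσ hsq with h | h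
  · simpa [h1s] using h hone
  · exfalso
    have h2 := h hzero
    have h3 : σ 0 = 1 := by
      have h4 := hσ 0 hzero
      rw [Complex.ofReal_zero, zero_mul] at h4
      refine h4.unique ⟨?_, ?_⟩
      · exact h4.1
      · have := hasSum_single (f := fun n => PowerSeries.coeff n (invSqrtSeries e) * (0 : ℂ) ^ n) 0
          fun n hn => by simp [hn]
        simpa [(invSqrtSeries_spec e).1] using this
    simp only [h3, h0, Real.sqrt_one, Complex.ofReal_one, mul_one, Pi.neg_apply, Pi.one_apply] at h2
    norm_num at h2

end Convergence

/-! ### Linearization of the forward flows. -/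

section Linearization

variable {g : ℕ} {lam : Fin (g + 1) → ℝ} {ν : Fin g → ℂ}

/-- The motion of the elliptic variables for the image of an algebraic flow. -/
theorem GenFlow.exists_kappa {A : Type*} [CommRing A] [Algebra ℝ A] {z v : Phase (g + 1)}
    (Φ : GenFlow lam z v A) {μ : Fin g → ℝ} (hμ : Function.Injective μ)
    (hm : mPoly lam z = ∏ k, (X - C (μ k)))
    (hunit : ∀ k, IsUnit (1 - algebraMap ℝ A (μ k) * Φ.w)) {rate : Fin g → ℂ}
    (hrate : ∀ (i : Fin g) (a : A), 2 * (Φ.u * ∏ j, (1 - algebraMap ℝ A (lam j) * Φ.w)) * a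
      = Φ.w ^ ((i : ℕ) + 1) → (Φ.L a : ℂ) = rate i) :
    ∃ κ : Fin g → ℝ, (∀ k, varM lam z v (μ k) = -4 * κ k * (nPoly lam z).eval (μ k) ∧
      varN lam z v (μ k) = -2 * κ k * (lPoly lam z).eval (μ k)) ∧
      ∀ i : Fin g, ((∑ k, μ k ^ (g - 1 - (i : ℕ)) / (∏ l ∈ Finset.univ.erase k, (μ k - μ l)) * κ k
        : ℝ) : ℂ) = rate i := by
  have hroot : ∀ k, (mPoly lam z).eval (μ k) = 0 := by
    intro k
    rw [hm, eval_prod]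
    exact Finset.prod_eq_zero (Finset.mem_univ k) (by simp)
  refine ⟨fun k => Φ.L (Φ.kappa (μ k)), fun k =>
    ⟨Φ.varM_eq (hunit k) (hroot k), Φ.varN_eq (hunit k) (hroot k)⟩, fun i => ?_⟩
  rw [← hrate i _ (Φ.sum_kappa hμ hm hunit i), map_sum]
  simp only [map_algebraMap_mul]

/-- The velocity vector of the flow of `H` at `z`. -/
def diracField {N : ℕ} (H : Phase N → ℝ) (z : Phase N) : Phase N :=
  (fun i => dirac (fun y => y.1 i) H z, fun i => dirac (fun y => y.2 i) H z)

/-- The flow of the Hamiltonian `H_{k + 1}` as a coefficient of the formal flow. -/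
def formalGenFlow {N : ℕ} (lam : Fin N → ℝ) {z : Phase N} (hz : z ∈ tangentSphere N) (k : ℕ) :
    GenFlow lam z (diracField (hamiltonian lam k) z) (PowerSeries ℝ) where
  w := PowerSeries.X
  s := formalWeight lam
  u := 1 - hamSeries lam z
  P := fun i => PowerSeries.mk fun k => dirac (fun y => y.1 i) (hamiltonian lam k) z
  Q := fun i => PowerSeries.mk fun k => dirac (fun y => y.2 i) (hamiltonian lam k) z
  L := PowerSeries.coeff k
  weight := formalWeight_mul lam
  fieldP := fun i => (formal_flow hz i).1
  fieldQ := fun i => (formal_flow hz i).2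
  isUnit := isUnit_one_sub_hamSeries lam z
  sq := sq_one_sub_hamSeries_of_mem hz
  imageP := fun _ => PowerSeries.coeff_mk k _
  imageQ := fun _ => PowerSeries.coeff_mk k _

/-- The square root of the spectral polynomial, as a formal power series. -/
theorem formal_sqrt_mul {z : Phase (g + 1)} (hz : z ∈ tangentSphere (g + 1))
    (hR : (spectralPoly lam z).map (algebraMap ℝ ℂ) = curvePoly (branchPoint lam ν)) :
    PowerSeries.map (algebraMap ℝ ℂ) ((1 - hamSeries lam z)
        * ∏ j, (1 - PowerSeries.C (lam j) * PowerSeries.X))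
      * invSqrtSeries (branchPoint lam ν) = 1 := by
  set U := (1 - hamSeries lam z) * ∏ j, (1 - PowerSeries.C (lam j) * PowerSeries.X) with hU
  -- The index `0` of the flow is immaterial: only `u` and `w` enter this identity.
  have h1 : U ^ 2 = aeval PowerSeries.X (revSpectralPoly lam z) :=
    (formalGenFlow lam hz 0).sq_mul_prod
  have h2 : PowerSeries.map (algebraMap ℝ ℂ) U ^ 2
      = ∏ i, (1 - PowerSeries.C (branchPoint lam ν i) * PowerSeries.X) := by
    rw [← map_pow, h1, map_aeval_eq_aeval_map (φ := algebraMap ℝ ℂ) (by ext x; simp),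
      map_revSpectralPoly hR, PowerSeries.map_X]
    simp
  have h3 : (PowerSeries.map (algebraMap ℝ ℂ) U * invSqrtSeries (branchPoint lam ν)) ^ 2 = 1 := by
    rw [mul_pow, h2, mul_comm]
    exact (invSqrtSeries_spec _).2
  -- Complex power series have no zero divisors; the constant term, which is one, excludes the root
  -- `-1`.
  rcases mul_self_eq_one_iff.1 ((sq _).symm.trans h3) with h | h
  · exact h
  · exfalso
    have h4 := congrArg PowerSeries.constantCoeff h
    have h5 : PowerSeries.constantCoeff (PowerSeries.map (algebraMap ℝ ℂ) (hamSeries lam z)) = 0 := by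
      rw [← PowerSeries.coeff_zero_eq_constantCoeff_apply, PowerSeries.coeff_map, hamSeries,
        PowerSeries.coeff_mk, hamiltonian_zero, map_zero]
    rw [map_mul, (invSqrtSeries_spec _).1, hU] at h4
    simp [h5] at h4
    norm_num at h4

/-- Over `ℝ⟦w⟧` every `1 - y w` is a unit, so both the conservation law and the root motion hold
without exceptional values of `y`. -/
theorem isLinearized_of_isSolution_hamiltonian (he : Function.Injective (branchPoint lam ν))
    {P₀ : curve (branchPoint lam ν)} (B : CanonicalBasis (branchPoint lam ν) P₀) (k : ℕ) {I : Set ℝ}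
    {z : ℝ → Phase (g + 1)} {t₀ : ℝ} (hI : IsOpen I) (hI' : IsPreconnected I) (ht₀ : t₀ ∈ I)
    (hsol : IsSolution (hamiltonian lam (k + 1)) I z) (hlevel : OnLevelSet lam ν (z t₀)) :
    IsLinearized lam B I z (frequency B k) := by
  have hunit : ∀ y : ℝ, IsUnit (1 - PowerSeries.C y * PowerSeries.X : PowerSeries ℝ) := by
    intro y
    rw [PowerSeries.isUnit_iff_constantCoeff]
    simp
  have hR : ∀ t ∈ I, (spectralPoly lam (z t)).map (algebraMap ℝ ℂ)
      = curvePoly (branchPoint lam ν) := by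
    intro t ht
    rw [isospectral hI hI' ht₀ (v := fun t => diracField (hamiltonian lam (k + 1)) (z t))
      (fun t ht => (hsol t ht).2) Set.finite_empty (fun t ht y _ =>
        (formalGenFlow lam (hsol t ht).1 (k + 1)).spectral_conserved y (hunit y)) ht]
    exact hlevel.map_spectralPoly
  have hfreq : frequency B k = fun j => ∑ l : Fin g, normMatrix B j l
      * (1 / 2 * if (l : ℕ) ≤ k then lambdaBar (branchPoint lam ν) (k - l) else 0) := by
    funext j
    simp only [frequency, Pi.smul_apply, Finset.sum_apply, smul_eq_mul, Finset.mul_sum]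
    exact Finset.sum_congr rfl fun l _ => by ring
  rw [hfreq]
  refine isLinearized_of_rootMotion he B hI (fun t ht => (hsol t ht).1)
    (v := fun t => diracField (hamiltonian lam (k + 1)) (z t)) (fun t ht => (hsol t ht).2) hR
    fun t ht μ hμ hm => ?_
  refine (formalGenFlow lam (hsol t ht).1 (k + 1)).exists_kappa hμ hm (fun i => hunit (μ i))
    fun i a ha => ?_
  have ha' : 2 * ((1 - hamSeries lam (z t))
      * ∏ j, (1 - PowerSeries.C (lam j) * PowerSeries.X)) * a = PowerSeries.X ^ ((i : ℕ) + 1) := ha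
  have h1 := congrArg (PowerSeries.map (algebraMap ℝ ℂ)) ha'
  have h2 := formal_sqrt_mul (hsol t ht).1 (hR t ht)
  have h3 : PowerSeries.C (2 : ℂ) * PowerSeries.map (algebraMap ℝ ℂ) a
      = invSqrtSeries (branchPoint lam ν) * PowerSeries.X ^ ((i : ℕ) + 1) := by
    rw [map_mul, map_mul, map_ofNat, map_pow, PowerSeries.map_X] at h1
    rw [← h1, map_ofNat]
    linear_combination (-2 * PowerSeries.map (algebraMap ℝ ℂ) a) * h2
  -- The flow of `H_{k+1}` reads off the coefficient `k + 1`; the shift by `i + 1` leaves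
  -- `Λ̄_{k-i}`, or zero if `i > k`.
  have h5 := congrArg (PowerSeries.coeff (k + 1)) h3
  rw [PowerSeries.coeff_C_mul, PowerSeries.coeff_map, PowerSeries.coeff_mul_X_pow'] at h5
  have h6 : (((formalGenFlow lam (hsol t ht).1 (k + 1)).L a : ℝ) : ℂ)
      = algebraMap ℝ ℂ (PowerSeries.coeff (k + 1) a) := rfl
  rw [h6, ← mul_right_inj' (two_ne_zero (α := ℂ)), h5]
  simp only [add_le_add_iff_right, Nat.add_sub_add_right, lambdaBar]
  ring

end Linearization

/-! ### Linearization of the generating flow and the sum of its Hamiltonians. -/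

section GeneratingFlow

variable {g : ℕ} {lam : Fin (g + 1) → ℝ} {ν : Fin g → ℂ}

/-- The flow of `1 - √f`, where `f` is the generating function, as an algebraic flow over `ℝ`. -/
def realGenFlow {N : ℕ} {lam : Fin N → ℝ} {w : ℝ} {s : Fin N → ℝ}
    (hs : ∀ j, s j * (1 - lam j * w) = 1) {z : Phase N} (hz : z ∈ tangentSphere N)
    (hpos : 0 < genFun w s z.1 z.2) :
    GenFlow lam z (diracField (fun z => 1 - √(genFun w s z.1 z.2)) z) ℝ where
  w := w
  s := s
  u := √(genFun w s z.1 z.2)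
  P := fun i => dirac (fun y => y.1 i) (fun z => 1 - √(genFun w s z.1 z.2)) z
  Q := fun i => dirac (fun y => y.2 i) (fun z => 1 - √(genFun w s z.1 z.2)) z
  L := LinearMap.id
  weight := hs
  fieldP := fun i => (dirac_one_sub_sqrt hz hpos i).1
  fieldQ := fun i => (dirac_one_sub_sqrt hz hpos i).2
  isUnit := isUnit_iff_ne_zero.2 (Real.sqrt_pos.2 hpos).ne'
  sq := Real.sq_sqrt hpos.le
  imageP := fun _ => rfl
  imageQ := fun _ => rfl

/-- On the level set the generating function is positive, and its square root is given by the series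
of the frequencies. -/
theorem genFun_of_level {z : Phase (g + 1)}
    (hR : (spectralPoly lam z).map (algebraMap ℝ ℂ) = curvePoly (branchPoint lam ν)) {w : ℝ} {σ : ℂ}
    (hw : ∀ i, ‖branchPoint lam ν i * w‖ < 1)
    (hσ : ConvergesTo (invSqrtSeries (branchPoint lam ν)) w σ) (hlam : ∀ j, 0 < 1 - lam j * w) :
    0 < genFun w (fun j => (1 - lam j * w)⁻¹) z.1 z.2 ∧
    ((√(genFun w (fun j => (1 - lam j * w)⁻¹) z.1 z.2) * ∏ j, (1 - lam j * w) : ℝ) : ℂ) * σ = 1 := by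
  have h1 := genFun_mul_prod_sq (A := ℝ) (lam := lam) (w := w) (s := fun j => (1 - lam j * w)⁻¹)
    (fun j => inv_mul_cancel₀ (hlam j).ne') z
  obtain ⟨h2, h3⟩ := sqrt_mul_eq_one (map_revSpectralPoly hR) hw hσ
  have hprod : 0 < ∏ j, (1 - lam j * w) := Finset.prod_pos fun j _ => hlam j
  simp only [Algebra.algebraMap_self, RingHom.id_apply, coe_aeval_eq_eval] at h1
  change genFun w (fun j => (1 - lam j * w)⁻¹) z.1 z.2 * (∏ j, (1 - lam j * w)) ^ 2 = _ at h1
  rw [← h1] at h2 h3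
  refine ⟨pos_of_mul_pos_left h2 (sq_nonneg _), ?_⟩
  rwa [Real.sqrt_mul' _ (sq_nonneg _), Real.sqrt_sq hprod.le] at h3

/-- On the level set, the generating Hamiltonian is the sum of the series of the Hamiltonians. -/
theorem hasSum_hamiltonian {z : Phase (g + 1)} (hz : z ∈ tangentSphere (g + 1))
    (hR : (spectralPoly lam z).map (algebraMap ℝ ℂ) = curvePoly (branchPoint lam ν)) {w : ℝ} {σ : ℂ}
    (hw : ∀ i, ‖branchPoint lam ν i * w‖ < 1)
    (hσ : ConvergesTo (invSqrtSeries (branchPoint lam ν)) w σ) (hlam : ∀ j, 0 < 1 - lam j * w) :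
    HasSum (fun k => hamiltonian lam k z * w ^ k)
      (1 - √(genFun w (fun j => (1 - lam j * w)⁻¹) z.1 z.2)) := by
  set e := branchPoint lam ν
  have h1 := formal_sqrt_mul hz hR
  have h2 := (invSqrtSeries_spec e).2
  have h3 := (genFun_of_level hR hw hσ hlam).2
  have h4 := hσ.sq_mul_prod
  rw [prod_branchPoint lam ν fun e => 1 - PowerSeries.C e * PowerSeries.X] at h2
  rw [prod_branchPoint lam ν fun e => 1 - e * (w : ℂ)] at h4
  rw [map_mul, map_prod] at h1
  have h5 : ∀ j, PowerSeries.map (algebraMap ℝ ℂ) (1 - PowerSeries.C (lam j) * PowerSeries.X)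
      = 1 - PowerSeries.C (lam j : ℂ) * PowerSeries.X := fun j => by simp
  simp only [h5] at h1
  -- Multiplying the inverse square root of `∏(1 - e_i w)` by the factors of the `ν_k` writes `1 - ∑
  -- H_k w^k` as a product of series whose convergence is known.
  have h6 : PowerSeries.map (algebraMap ℝ ℂ) (hamSeries lam z)
      = 1 - invSqrtSeries e * ∏ k, (1 - PowerSeries.C (ν k) * PowerSeries.X) := by
    rw [map_sub, map_one] at h1
    linear_combination (1 - PowerSeries.map (algebraMap ℝ ℂ) (hamSeries lam z)) * h2
      - invSqrtSeries e * (∏ k, (1 - PowerSeries.C (ν k) * PowerSeries.X)) * h1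
  have h7 : ConvergesTo (PowerSeries.map (algebraMap ℝ ℂ) (hamSeries lam z)) w
      (1 - σ * ∏ k, (1 - ν k * w)) := by
    rw [h6]
    exact (ConvergesTo.one _).sub (hσ.mul (ConvergesTo.prod Finset.univ fun k _ =>
      (ConvergesTo.one _).sub ((ConvergesTo.C _ _).mul (ConvergesTo.X _))))
  have h8 : σ * ∏ k, (1 - ν k * w) = (√(genFun w (fun j => (1 - lam j * w)⁻¹) z.1 z.2) : ℝ) := by
    push_cast at h3
    linear_combination (√(genFun w (fun j => (1 - lam j * w)⁻¹) z.1 z.2) : ℂ) * h4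
      - σ * (∏ k, (1 - ν k * w)) * h3
  rw [h8] at h7
  have h9 := h7.2
  simp only [PowerSeries.coeff_map, hamSeries, PowerSeries.coeff_mk, Complex.coe_algebraMap] at h9
  exact_mod_cast h9

/-- The roots of `m` are different from `x`, outside the convex hull of the `λ_j`. -/
theorem eval_mPoly_ne_zero {z : Phase (g + 1)} (hz : z ∈ tangentSphere (g + 1)) {x : ℝ}
    (hx : x ≠ 0) (hlam : ∀ j, 0 < 1 - lam j * x⁻¹) : (mPoly lam z).eval x ≠ 0 := by
  have hfac : ∀ j, x - lam j = x * (1 - lam j * x⁻¹) := fun j => by field_simp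
  have hne : ∀ j, x ≠ lam j := fun j h =>
    mul_ne_zero hx (hlam j).ne' (by rw [← hfac j, sub_eq_zero.2 h])
  rw [mPoly, eval_numerator lam _ x hne]
  refine mul_ne_zero (Finset.prod_ne_zero_iff.2 fun j _ => sub_ne_zero.2 (hne j)) fun h => ?_
  obtain ⟨i, hi⟩ := exists_ne_zero_of_mem hz
  have h1 : 0 < ∑ j, z.1 j * z.1 j / (1 - lam j * x⁻¹) :=
    Finset.sum_pos' (fun j _ => div_nonneg (mul_self_nonneg _) (hlam j).le)
      ⟨i, Finset.mem_univ i, div_pos (mul_self_pos.2 hi) (hlam i)⟩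
  refine h1.ne' ?_
  rw [← mul_zero x, ← h, Finset.mul_sum]
  refine Finset.sum_congr rfl fun j _ => ?_
  rw [hfac]
  have := (hlam j).ne'
  field_simp

/-- Positivity of the generating function is not available before isospectrality. Where it is
positive, the algebraic conservation law holds for every `y ≠ x`; where it is not, the vector field
is zero. -/
theorem isospectral_of_isSolution_generatingHamiltonian {I : Set ℝ} (hI : IsOpen I)
    (hI' : IsPreconnected I) {t₀ : ℝ} (ht₀ : t₀ ∈ I) {z : ℝ → Phase (g + 1)} {x : ℝ} (hx : x ≠ 0)
    (hlam : ∀ j, 0 < 1 - lam j * x⁻¹)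
    (hsol : IsSolution (fun z => 1 - √(genFun x⁻¹ (fun j => (1 - lam j * x⁻¹)⁻¹) z.1 z.2)) I z)
    {t : ℝ} (ht : t ∈ I) : spectralPoly lam (z t) = spectralPoly lam (z t₀) := by
  refine isospectral hI hI' ht₀ (fun t ht => (hsol t ht).2) (Set.finite_singleton x)
    (v := fun t => diracField _ (z t)) (fun t ht y hy => ?_) ht
  rcases lt_or_ge 0 (genFun x⁻¹ (fun j => (1 - lam j * x⁻¹)⁻¹) (z t).1 (z t).2) with hpos | hneg
  · refine (realGenFlow (fun j => inv_mul_cancel₀ (hlam j).ne') (hsol t ht).1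
      hpos).spectral_conserved y (isUnit_iff_ne_zero.2 fun h => hy ?_)
    have h' : 1 - y * x⁻¹ = 0 := h
    rw [Set.mem_singleton_iff]
    field_simp at h'
    linarith
  · have h := dirac_one_sub_sqrt_of_nonpos (hsol t ht).1 hneg
    simp [varM, varN, varL, numValue, diracField, h]

/-- The frequency vector of the flow of the generating Hamiltonian. -/
theorem hasSum_frequency {P₀ : curve (branchPoint lam ν)}
    (B : CanonicalBasis (branchPoint lam ν) P₀) {x σ : ℂ}
    (hσ : ConvergesTo (invSqrtSeries (branchPoint lam ν)) x⁻¹ σ) :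
    HasSum (fun k : ℕ => (x ^ (k + 1))⁻¹ • frequency B k)
      fun j => ∑ l : Fin g, normMatrix B j l * (1 / 2 * (x⁻¹ ^ ((l : ℕ) + 1) * σ)) := by
  refine Pi.hasSum.2 fun j => ?_
  have h1 : ∀ l : Fin g, HasSum (fun k : ℕ => (x ^ (k + 1))⁻¹ *
      if (l : ℕ) ≤ k then lambdaBar (branchPoint lam ν) (k - l) else 0)
      (x⁻¹ ^ ((l : ℕ) + 1) * σ) := by
    intro l
    -- The factor `w^l` shifts the coefficients and puts zeros in front; the extra `x⁻¹` turns
    -- `x^{-k}` into `x^{-k-1}`.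
    have h2 := ((((ConvergesTo.X x⁻¹).pow l).mul hσ).2).mul_left x⁻¹
    rw [← mul_assoc, ← pow_succ'] at h2
    refine h2.congr_fun fun k => ?_
    rw [PowerSeries.coeff_X_pow_mul', ← inv_pow, pow_succ', lambdaBar]
    ring
  have h3 := hasSum_sum (s := Finset.univ) fun l _ =>
    ((h1 l).mul_left (1 / 2)).mul_left (normMatrix B j l)
  refine h3.congr_fun fun k => ?_
  simp only [frequency, Pi.smul_apply, Finset.sum_apply, smul_eq_mul, Finset.mul_sum]
  exact Finset.sum_congr rfl fun l _ => by ring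

/-- Isospectrality carries the level set to all times. This gives positivity of the generating
function throughout, so that the algebraic flow over `ℝ` is available at every time. -/
theorem isLinearized_of_isSolution_generatingHamiltonian
    (he : Function.Injective (branchPoint lam ν)) {P₀ : curve (branchPoint lam ν)}
    (B : CanonicalBasis (branchPoint lam ν) P₀) {x : ℝ} {σ : ℂ} (hx : x ≠ 0)
    (hw : ∀ i, ‖branchPoint lam ν i * (x⁻¹ : ℝ)‖ < 1)
    (hσ : ConvergesTo (invSqrtSeries (branchPoint lam ν)) (x⁻¹ : ℝ) σ) {I : Set ℝ}
    {z : ℝ → Phase (g + 1)} {t₀ : ℝ} (hI : IsOpen I) (hI' : IsPreconnected I) (ht₀ : t₀ ∈ I)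
    (hsol : IsSolution (generatingHamiltonian lam x) I z) (hlevel : OnLevelSet lam ν (z t₀)) :
    (∀ t ∈ I, HasSum (fun k => hamiltonian lam k (z t) * (x ^ k)⁻¹)
      (generatingHamiltonian lam x (z t))) ∧
    IsLinearized lam B I z fun j =>
      ∑ l : Fin g, normMatrix B j l * (1 / 2 * ((x⁻¹ : ℝ) ^ ((l : ℕ) + 1) * σ)) := by
  have hlam : ∀ j, 0 < 1 - lam j * x⁻¹ := by
    intro j
    have h1 := hw (Sum.inl j)
    have h2 : branchPoint lam ν (Sum.inl j) * (x⁻¹ : ℝ) = ((lam j * x⁻¹ : ℝ) : ℂ) := by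
      rw [Complex.ofReal_mul]
      rfl
    rw [h2, Complex.norm_real] at h1
    linarith [(abs_lt.1 h1).2]
  have hxlam : ∀ j, x ≠ lam j := by
    rintro j rfl
    exact (hlam j).ne' (by rw [mul_inv_cancel₀ hx, sub_self])
  rw [generatingHamiltonian_eq hx hxlam] at hsol ⊢
  have hR : ∀ t ∈ I, (spectralPoly lam (z t)).map (algebraMap ℝ ℂ)
      = curvePoly (branchPoint lam ν) := by
    intro t ht
    rw [isospectral_of_isSolution_generatingHamiltonian hI hI' ht₀ hx hlam hsol ht]
    exact hlevel.map_spectralPoly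
  refine ⟨fun t ht => ?_, ?_⟩
  · simpa only [inv_pow] using hasSum_hamiltonian (hsol t ht).1 (hR t ht) hw hσ hlam
  · refine isLinearized_of_rootMotion he B hI (fun t ht => (hsol t ht).1)
      (v := fun t => diracField _ (z t)) (fun t ht => (hsol t ht).2) hR fun t ht μ hμ hm => ?_
    obtain ⟨hpos, hone⟩ := genFun_of_level (hR t ht) hw hσ hlam
    refine (realGenFlow (fun j => inv_mul_cancel₀ (hlam j).ne') (hsol t ht).1 hpos).exists_kappa
      hμ hm (fun k => isUnit_iff_ne_zero.2 fun h => ?_) fun i a ha => ?_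
    · have h' : 1 - μ k * x⁻¹ = 0 := h
      -- If `1 - μ_k/x` were not a unit, `x` would be a root of `m`, but it lies outside the range
      -- of those roots.
      have h1 : x = μ k := by
        field_simp at h'
        linarith
      refine eval_mPoly_ne_zero (hsol t ht).1 hx hlam ?_
      rw [hm, eval_prod]
      exact Finset.prod_eq_zero (Finset.mem_univ k) (by simp [h1])
    · have ha' : 2 * (√(genFun x⁻¹ (fun j => (1 - lam j * x⁻¹)⁻¹) (z t).1 (z t).2)
          * ∏ j, (1 - lam j * x⁻¹)) * a = x⁻¹ ^ ((i : ℕ) + 1) := ha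
      have h1 := congrArg (algebraMap ℝ ℂ) ha'
      rw [map_mul, map_mul, map_ofNat, map_pow] at h1
      simp only [Complex.coe_algebraMap] at h1
      change (a : ℂ) = _
      linear_combination (σ / 2) * h1 - (a : ℂ) * hone

end GeneratingFlow

end NeumannKdV

end

theorem theorem4 {g : ℕ} (lam : Fin (g + 1) → ℝ) (ν : Fin g → ℂ)
    (hbranch : Function.Injective (NeumannKdV.branchPoint lam ν))
    (P₀ : NeumannKdV.curve (NeumannKdV.branchPoint lam ν))
    (B : NeumannKdV.CanonicalBasis (NeumannKdV.branchPoint lam ν) P₀) :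
    (∀ (x : ℝ), (∀ i, ‖NeumannKdV.branchPoint lam ν i‖ < |x|) →
      ∃ v : Fin g → ℂ,
        HasSum (fun k : ℕ => ((x : ℂ) ^ (k + 1))⁻¹ • NeumannKdV.frequency B k) v ∧
        ∀ (I : Set ℝ) (z : ℝ → NeumannKdV.Phase (g + 1)) (t₀ : ℝ),
          IsOpen I → IsPreconnected I → t₀ ∈ I →
          NeumannKdV.IsSolution (NeumannKdV.generatingHamiltonian lam x) I z →
          NeumannKdV.OnLevelSet lam ν (z t₀) →
          (∀ t ∈ I, HasSum (fun k : ℕ => NeumannKdV.hamiltonian lam k (z t) * (x ^ k)⁻¹)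
            (NeumannKdV.generatingHamiltonian lam x (z t))) ∧
          NeumannKdV.IsLinearized lam B I z v) ∧
    (∀ (k : ℕ) (I : Set ℝ) (z : ℝ → NeumannKdV.Phase (g + 1)) (t₀ : ℝ),
      IsOpen I → IsPreconnected I → t₀ ∈ I →
      NeumannKdV.IsSolution (NeumannKdV.hamiltonian lam (k + 1)) I z →
      NeumannKdV.OnLevelSet lam ν (z t₀) →
      NeumannKdV.IsLinearized lam B I z (NeumannKdV.frequency B k)) := by
  refine ⟨fun x hx => ?_, fun k I z t₀ hI hI' ht₀ hsol hlevel =>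
    NeumannKdV.isLinearized_of_isSolution_hamiltonian hbranch B k hI hI' ht₀ hsol hlevel⟩
  -- There is always at least one branch point, so the bound on `|x|` is never vacuous.
  have hx0 : x ≠ 0 := abs_pos.1 ((norm_nonneg _).trans_lt (hx (Sum.inl 0)))
  have hw : ∀ i, ‖NeumannKdV.branchPoint lam ν i * (x⁻¹ : ℝ)‖ < 1 := by
    intro i
    rw [norm_mul, Complex.norm_real, norm_inv, Real.norm_eq_abs, ← div_eq_mul_inv,
      div_lt_one (abs_pos.2 hx0)]
    exact hx i
  obtain ⟨σ, hσ⟩ := NeumannKdV.exists_convergesTo_invSqrtSeries _ hw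
  refine ⟨_, NeumannKdV.hasSum_frequency B (by rwa [← Complex.ofReal_inv]), ?_⟩
  intro I z t₀ hI hI' ht₀ hsol hlevel
  rw [← Complex.ofReal_inv]
  exact NeumannKdV.isLinearized_of_isSolution_generatingHamiltonian hbranch B hx0 hw hσ hI hI' ht₀
    hsol hlevel
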